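/- **Setting.** Let $p_W$ be a probability density on $\mathbb R$ with mean zero, such that: the Fisher information $\mathrm I_W=\int (p_W'(x))^2/p_W(x)\,dx$ is finite (the integrand is $0$ where $p_W=0$); $\int w^2p_W(w)\,dw\le M_1$; $p_W\in C^3(\mathbb R)$ and $\|p_W^{(\ell)}\|_\infty\le M_2$ for $\ell\in\{0,1,2\}$. Let $K\ge 0$ be a three times differentiable kernel with $\int K=1$, $\int zK(z)\,dz=0$ and, for some constant $B$, $\|K^{(\ell)}\|_\infty\le B$ and $\int (K^{(\ell)})^2\le B$ for $\ell\in\{0,\dots,3\}$, and $\int z^2K(z)\,dz\le B$. Let $h_n=n^{-\eta_1}$, $h_n'=n^{-\eta_2}$ with $\eta_1\in(1/4,1)$, $\eta_2\in(1/4,1/3)$, and let $\gamma\in(0,\infty)$, $M\in\mathbb R$, $\eta>0$. Let $\mathcal F_{m,n}(M,\eta)$ be the set of $X\in\mathbb R^{m\times n}$ with $\|X\|_{op}\le M(m\vee n)^{1/2}$, $\|X\odot X\|_{op}\le M(m\vee n)^{1/2-\eta}$, all rows of Euclidean norm at most $Mn^{1/2-\eta}$ and all columns of Euclidean norm at most $Mm^{1/2-\eta}$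 (here $\odot$ is the entrywise product). For $Y\in\mathbb R^{m\times n}$ with average entry $\overline Y$ and $\varepsilon>0$ put $$\hat p_Y(x)=\frac1{mnh_n}\sum_{i,j}K\Big(\frac{Y_{ij}-\overline Y-x}{h_n}\Big),\qquad \hat p'_Y(x)=-\frac1{mn(h'_n)^2}\sum_{i,j}K'\Big(\frac{Y_{ij}-\overline Y-x}{h'_n}\Big),$$ $$\hat f_{Y,\varepsilon}(x)=-\frac{\hat p_Y'(x)}{\hat p_Y(x)+\varepsilon},\qquad \hat{\mathrm I}_{W,\varepsilon}=\frac1{mn}\sum_{i,j}\Big(\frac{\hat p_Y'(Y_{ij}-\overline Y)}{\hat p_Y(Y_{ij}-\overline Y)+\varepsilon}\Big)^2+\varepsilon ,$$ and let $\hat f_{Y,\varepsilon}(Y)$ be the matrix obtained by applying $\hat f_{Y,\varepsilon}$ to every entry of $Y$. **Theorem.** There exist constants $\varepsilon_0,C>0$ and $\nu\in(0,1]$ and a non-random function $\tau(\varepsilon)$ with $\lim_{\varepsilon\to0^+}\tau(\varepsilon)=0$, depending only on the data above (not on $m$, $n$, $X$), such that the following holds. Let $m=m(n)$ with $m(n)/n\to\gamma$,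 let $X=X_n\in\mathcal F_{m,n}(M,\eta)$ be deterministic, and let $Y=X+W$, where for each $n$ the entries of $W=W_n\in\mathbb R^{m\times n}$ are i.i.d. with density $p_W$ (all $W_n$ defined on one probability space, with arbitrary dependence between different $n$). Then there are random matrices $Z=Z_{n,\varepsilon}$ and $\Delta=\Delta_{n,\varepsilon}$ in $\mathbb R^{m\times n}$ with $$\hat f_{Y,\varepsilon}(Y)=\mathrm I_W X+\sqrt{\mathrm I_W}\,Z+\Delta\qquad\text{for all } \varepsilon>0 \text{ and all } n,$$ such that: 1. For each $\varepsilon>0$ and $n$ the entries of $Z$ are i.i.d. with mean $0$ and variance $1$, with a law that does not depend on $n$; and almost surely $\max_{i,j}|Z_{ij}|\le C\varepsilon^{-1}$ for all $n$ and all $\varepsilon\in(0,\varepsilon_0]$. 2. For each $\varepsilon\in(0,\varepsilon_0]$, almost surely $\limsup_{n\to\infty}(mn)^{-1/4}\|\Delta\|_{op}\le\tau(\varepsilon)$; and $\limsup_{n\to\infty}(mn)^{-(1+\nu)/4}\,\mathbb E\|\Delta\|_{op}^{1+\nu}\le\tau(\varepsilon)$. In particular $\lim_{\varepsilon\to0^+}\limsup_{n\to\infty}(mn)^{-1/4}\|\Delta\|_{op}=0$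 almost surely, in the sense of a non-random bound for each $\varepsilon$, and $\lim_{\varepsilon\to0^+}\limsup_{n\to\infty}(mn)^{-(1+\nu)/4}\,\mathbb E\|\Delta\|_{op}^{1+\nu}=0$. 3. For each $\varepsilon\in(0,\varepsilon_0]$, almost surely $\limsup_{n\to\infty}|\hat{\mathrm I}_{W,\varepsilon}-\mathrm I_W|\le\tau(\varepsilon)$; thus $\lim_{\varepsilon\to0^+}\limsup_{n\to\infty}|\hat{\mathrm I}_{W,\varepsilon}-\mathrm I_W|=0$. -/

import Mathlib

open MeasureTheory ProbabilityTheory Filter Topology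

noncomputable section

namespace MatrixDenoising

/-- Fisher information `∫ p'(x)² / p(x) dx` of the location family of the density `p`.
Where a nonnegative differentiable `p` vanishes, so does `p'`, and the integrand is `0`. -/
def fisherInfo (p : ℝ → ℝ) : ℝ := ∫ x, (deriv p x) ^ 2 / p x

/-- `p` is a centred probability density with finite Fisher information, second moment at most
`M₁`, of class `C³`, and with `p`, `p'`, `p''` bounded by `M₂`. -/
structure IsNoiseDensity (p : ℝ → ℝ) (M₁ M₂ : ℝ) : Prop where
  nonneg : ∀ x, 0 ≤ p x
  integrable : Integrable p
  integral_eq_one : ∫ x, p x = 1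
  mean_zero : ∫ x, x * p x = 0
  fisher_finite : Integrable (fun x => (deriv p x) ^ 2 / p x)
  sq_integrable : Integrable (fun x => x ^ 2 * p x)
  second_moment_le : ∫ x, x ^ 2 * p x ≤ M₁
  contDiff : ContDiff ℝ 3 p
  deriv_bound : ∀ ℓ : ℕ, ℓ ≤ 2 → ∀ x, |iteratedDeriv ℓ p x| ≤ M₂

/-- The probability measure on `ℝ` with density `p`. -/
def noiseLaw (p : ℝ → ℝ) : Measure ℝ := volume.withDensity (fun x => ENNReal.ofReal (p x))

/-- `K` is a nonnegative first order kernel, three times differentiable, satisfying the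
smoothness bounds with constant `B`. -/
structure IsKernel (K : ℝ → ℝ) (B : ℝ) : Prop where
  nonneg : ∀ z, 0 ≤ K z
  integrable : Integrable K
  integral_eq_one : ∫ z, K z = 1
  first_moment : ∫ z, z * K z = 0
  differentiable : ∀ ℓ : ℕ, ℓ < 3 → Differentiable ℝ (iteratedDeriv ℓ K)
  deriv_bound : ∀ ℓ : ℕ, ℓ ≤ 3 → ∀ z, |iteratedDeriv ℓ K z| ≤ B
  deriv_sq_integrable : ∀ ℓ : ℕ, ℓ ≤ 3 → Integrable (fun z => (iteratedDeriv ℓ K z) ^ 2)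
  deriv_sq_integral_le : ∀ ℓ : ℕ, ℓ ≤ 3 → ∫ z, (iteratedDeriv ℓ K z) ^ 2 ≤ B
  sq_integrable : Integrable (fun z => z ^ 2 * K z)
  second_moment_le : ∫ z, z ^ 2 * K z ≤ B

open scoped Matrix.Norms.L2Operator in
/-- Operator norm of a matrix between Euclidean spaces. -/
def opNorm {m n : ℕ} (A : Matrix (Fin m) (Fin n) ℝ) : ℝ := ‖A‖

/-- The signal class `F_{m,n}(M, η)` (without rank constraint). -/
def signalClass (m n : ℕ) (M η : ℝ) : Set (Matrix (Fin m) (Fin n) ℝ) :=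
  {X | opNorm X ≤ M * (max m n : ℝ) ^ (1 / 2 : ℝ) ∧
    opNorm (Matrix.hadamard X X) ≤ M * (max m n : ℝ) ^ (1 / 2 - η) ∧
    (∀ i, Real.sqrt (∑ j, X i j ^ 2) ≤ M * (n : ℝ) ^ (1 / 2 - η)) ∧
    (∀ j, Real.sqrt (∑ i, X i j ^ 2) ≤ M * (m : ℝ) ^ (1 / 2 - η))}

/-- The average entry of a matrix. -/
def avg {m n : ℕ} (Y : Matrix (Fin m) (Fin n) ℝ) : ℝ := (∑ i, ∑ j, Y i j) / (m * n)

/-- Kernel estimate of the noise density, with bandwidth `h`. -/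
def pHat {m n : ℕ} (K : ℝ → ℝ) (h : ℝ) (Y : Matrix (Fin m) (Fin n) ℝ) (x : ℝ) : ℝ :=
  1 / (m * n * h) * ∑ i, ∑ j, K ((Y i j - avg Y - x) / h)

/-- Kernel estimate of the derivative of the noise density, with bandwidth `h'`: it is the
derivative in `x` of the kernel estimate `pHat K h' Y x`, whence the minus sign. -/
def pHatDeriv {m n : ℕ} (K : ℝ → ℝ) (h' : ℝ) (Y : Matrix (Fin m) (Fin n) ℝ) (x : ℝ) : ℝ :=
  -(1 / (m * n * h' ^ 2) * ∑ i, ∑ j, deriv K ((Y i j - avg Y - x) / h'))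

/-- The estimated denoiser. -/
def fHat {m n : ℕ} (K : ℝ → ℝ) (h h' ε : ℝ) (Y : Matrix (Fin m) (Fin n) ℝ) (x : ℝ) : ℝ :=
  -(pHatDeriv K h' Y x / (pHat K h Y x + ε))

/-- The denoised matrix: the estimated denoiser applied to every entry of `Y`. -/
def denoised {m n : ℕ} (K : ℝ → ℝ) (h h' ε : ℝ) (Y : Matrix (Fin m) (Fin n) ℝ) :
    Matrix (Fin m) (Fin n) ℝ :=
  Matrix.of fun i j => fHat K h h' ε Y (Y i j)

/-- The estimated Fisher information. -/
def fisherHat {m n : ℕ} (K : ℝ → ℝ) (h h' ε : ℝ) (Y : Matrix (Fin m) (Fin n) ℝ) : ℝ :=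
  1 / (m * n) * ∑ i, ∑ j,
    (pHatDeriv K h' Y (Y i j - avg Y) / (pHat K h Y (Y i j - avg Y) + ε)) ^ 2 + ε

/-- The entries of the random matrix `A` are independent with common law `μ`. -/
def HasIIDEntries {Ω : Type*} [MeasurableSpace Ω] (P : Measure Ω) {m n : ℕ}
    (A : Ω → Matrix (Fin m) (Fin n) ℝ) (μ : Measure ℝ) : Prop :=
  iIndepFun (fun (ij : Fin m × Fin n) (ω : Ω) => A ω ij.1 ij.2) P ∧
    ∀ i j, HasLaw (fun ω => A ω i j) μ P

end MatrixDenoising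

end

/-! Write `f_ε = -p'/(p+ε)` for the regularised score and `W̄` for the average of the noise. The
estimated denoiser is uniformly close to a deterministic function `b`, the regularised score built
from the kernel smoothings of `p` and `p'`, with its argument shifted by `W̄`. Entry by entry,
`f̂(Y)` is then a sum of five pieces: the estimation error `f̂(Y) - b(Y + W̄)`; the shift `b(Y + W̄)
- b(Y)`; the centred part of `b(X+W) - f_ε(W)`; the mean `E b(X+W)`; and `f_ε(W)` itself. Everything
but the signal `I·X` and the noise has to be small in operator norm compared with `√n`.

The estimation error is `o(n^{-1/2})` in every entry, hence `o(√n)` in Frobenius norm. This follows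
from Bernstein's inequality on a polynomial grid, and it is where `η₁ < 1` and `η₂ < 1/3` enter
(`negligible_kernelSum`).

The shift is at most a constant times `n|W̄|`. Having only two moments, `W̄` has no rapidly decaying
tail, so this term is carried along in the deviation thresholds. It is removed at the end, almost
surely by truncation and Borel-Cantelli (`ae_tendsto_sqrt_mul_avg`) and in mean square by the
variance (`integral_avg_sq_le`).

The centred part splits into `(b - f_ε)(X+W)`, with uniformly small entries and hence small norm by
an epsilon-net (`negligible_opNorm`), and `f_ε(X+W) - f_ε(W)`, with entries bounded by a multiple of
`|X_ij|`. For the latter the row and column norms of `X` are `O(n^{1/2-η})`, and a dyadic chaining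
over sign vectors gives a norm of that order up to factors absorbed by `n^η`
(`negligible_opNorm_of_rows`).

The mean is expanded as `∫ b p - X_ij ∫ b p' + O(X_ij²)`. The quadratic term is controlled by `‖X ⊙
X‖`. The coefficient `-∫ b p'` is close to `∫ p'²/(p+ε)`, which tends to the Fisher information. The
constant `∫ b p` is a rank one matrix, harmless only if it is `o(n^{-1/2})`; this holds because `∫
f_ε p = 0` exactly, and an integration by parts makes only the bias of the smoothing of `p`, not
that of `p'`, matter (`abs_integral_regRatio_mul_le`). That bias is `o(n^{-1/2})` when both
exponents exceed `1/4`.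

Finally `f_ε(W)/√I` has variance slightly below one. Adding a small multiple of a bounded centred
function of `W` makes the variance exactly one and defines `Z` (`exists_whitening`); the correction
goes into `Δ`. -/

namespace MatrixDenoising

/-! ### Operator norms and bilinear forms -/

/-- Euclidean norm of a vector of real numbers. -/
noncomputable def vecNorm {m : ℕ} (u : Fin m → ℝ) : ℝ := Real.sqrt (∑ i, u i ^ 2)

/-- The bilinear form of a matrix. -/
noncomputable def bilin {m n : ℕ} (A : Matrix (Fin m) (Fin n) ℝ) (u : Fin m → ℝ) (v : Fin n → ℝ) : ℝ :=
  ∑ i, ∑ j, u i * A i j * v j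

section LinearAlgebra

variable {m n : ℕ}

lemma vecNorm_nonneg (u : Fin m → ℝ) : 0 ≤ vecNorm u := Real.sqrt_nonneg _

lemma vecNorm_sq (u : Fin m → ℝ) : vecNorm u ^ 2 = ∑ i, u i ^ 2 :=
  Real.sq_sqrt (Finset.sum_nonneg fun _ _ => sq_nonneg _)

lemma norm_toLp_eq_vecNorm (u : Fin m → ℝ) : ‖WithLp.toLp 2 u‖ = vecNorm u := by
  simp [EuclideanSpace.norm_eq, vecNorm]

lemma vecNorm_add_le (u v : Fin m → ℝ) : vecNorm (u + v) ≤ vecNorm u + vecNorm v := by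
  simpa only [← norm_toLp_eq_vecNorm, WithLp.toLp_add] using norm_add_le _ _

lemma vecNorm_smul (c : ℝ) (u : Fin m → ℝ) : vecNorm (c • u) = |c| * vecNorm u := by
  simp only [← norm_toLp_eq_vecNorm, WithLp.toLp_smul, norm_smul, Real.norm_eq_abs]

lemma vecNorm_mono {u v : Fin m → ℝ} (h : ∀ i, |u i| ≤ |v i|) : vecNorm u ≤ vecNorm v :=
  Real.sqrt_le_sqrt (Finset.sum_le_sum fun i _ => sq_le_sq.2 (h i))

lemma vecNorm_abs (u : Fin m → ℝ) : vecNorm (fun i => |u i|) = vecNorm u := by simp [vecNorm]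

lemma vecNorm_eq_zero {u : Fin m → ℝ} (h : vecNorm u = 0) : u = 0 := by
  rw [← norm_toLp_eq_vecNorm, norm_eq_zero] at h
  simpa using h

lemma sum_mul_le_vecNorm (u v : Fin m → ℝ) : ∑ i, u i * v i ≤ vecNorm u * vecNorm v :=
  Real.sum_mul_le_sqrt_mul_sqrt _ _ _

lemma bilin_eq_sum_mulVec (A : Matrix (Fin m) (Fin n) ℝ) (u : Fin m → ℝ) (v : Fin n → ℝ) :
    bilin A u v = ∑ i, u i * (A.mulVec v) i := by
  simp [bilin, Matrix.mulVec, dotProduct, Finset.mul_sum, mul_assoc]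

lemma bilin_add_left (A : Matrix (Fin m) (Fin n) ℝ) (u u' : Fin m → ℝ) (v : Fin n → ℝ) :
    bilin A (u + u') v = bilin A u v + bilin A u' v := by
  simp [bilin, add_mul, Finset.sum_add_distrib]

lemma bilin_add_right (A : Matrix (Fin m) (Fin n) ℝ) (u : Fin m → ℝ) (v v' : Fin n → ℝ) :
    bilin A u (v + v') = bilin A u v + bilin A u v' := by
  simp [bilin, mul_add, Finset.sum_add_distrib]

lemma bilin_smul_left (A : Matrix (Fin m) (Fin n) ℝ) (c : ℝ) (u : Fin m → ℝ) (v : Fin n → ℝ) :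
    bilin A (c • u) v = c * bilin A u v := by
  simp [bilin, Finset.mul_sum, mul_assoc]

lemma bilin_smul_right (A : Matrix (Fin m) (Fin n) ℝ) (c : ℝ) (u : Fin m → ℝ) (v : Fin n → ℝ) :
    bilin A u (c • v) = c * bilin A u v := by
  simp only [bilin, Finset.mul_sum, Pi.smul_apply, smul_eq_mul]
  exact Finset.sum_congr rfl fun i _ => Finset.sum_congr rfl fun j _ => by ring

lemma bilin_sum_left {ι : Type*} (s : Finset ι) (A : Matrix (Fin m) (Fin n) ℝ)
    (u : ι → Fin m → ℝ) (v : Fin n → ℝ) : bilin A (∑ k ∈ s, u k) v = ∑ k ∈ s, bilin A (u k) v := by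
  classical
  induction s using Finset.induction_on with
  | empty => simp [bilin]
  | insert a s ha ih => rw [Finset.sum_insert ha, Finset.sum_insert ha, bilin_add_left, ih]

lemma bilin_sum_right {ι : Type*} (s : Finset ι) (A : Matrix (Fin m) (Fin n) ℝ)
    (u : Fin m → ℝ) (v : ι → Fin n → ℝ) : bilin A u (∑ k ∈ s, v k) = ∑ k ∈ s, bilin A u (v k) := by
  classical
  induction s using Finset.induction_on with
  | empty => simp [bilin]
  | insert a s ha ih => rw [Finset.sum_insert ha, Finset.sum_insert ha, bilin_add_right, ih]

open scoped Matrix.Norms.L2Operator in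
lemma opNorm_nonneg (A : Matrix (Fin m) (Fin n) ℝ) : 0 ≤ opNorm A := norm_nonneg A

open scoped Matrix.Norms.L2Operator in
lemma opNorm_add_le (A B : Matrix (Fin m) (Fin n) ℝ) : opNorm (A + B) ≤ opNorm A + opNorm B :=
  norm_add_le A B

open scoped Matrix.Norms.L2Operator in
lemma opNorm_smul (c : ℝ) (A : Matrix (Fin m) (Fin n) ℝ) : opNorm (c • A) = |c| * opNorm A :=
  norm_smul c A

open scoped Matrix.Norms.L2Operator in
lemma vecNorm_mulVec_le (A : Matrix (Fin m) (Fin n) ℝ) (v : Fin n → ℝ) :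
    vecNorm (A.mulVec v) ≤ opNorm A * vecNorm v := by
  rw [← norm_toLp_eq_vecNorm, ← norm_toLp_eq_vecNorm]
  exact A.l2_opNorm_mulVec (WithLp.toLp 2 v)

lemma bilin_le (A : Matrix (Fin m) (Fin n) ℝ) (u : Fin m → ℝ) (v : Fin n → ℝ) :
    bilin A u v ≤ opNorm A * (vecNorm u * vecNorm v) := by
  rw [bilin_eq_sum_mulVec]
  refine (sum_mul_le_vecNorm _ _).trans ?_
  nlinarith [mul_le_mul_of_nonneg_left (vecNorm_mulVec_le A v) (vecNorm_nonneg u)]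

-- Testing with `u = A v` gives `‖Av‖² ≤ c ‖Av‖ ‖v‖`, from which one factor `‖Av‖` is cancelled.
open scoped Matrix.Norms.L2Operator in
lemma opNorm_le_of_bilin {A : Matrix (Fin m) (Fin n) ℝ} {c : ℝ} (hc : 0 ≤ c)
    (h : ∀ u v, bilin A u v ≤ c * (vecNorm u * vecNorm v)) : opNorm A ≤ c := by
  unfold opNorm
  rw [Matrix.l2_opNorm_def]
  refine ContinuousLinearMap.opNorm_le_bound _ hc fun x => ?_
  have h1 : vecNorm (A.mulVec x.ofLp) ^ 2 ≤
      c * (vecNorm (A.mulVec x.ofLp) * vecNorm x.ofLp) := by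
    refine le_trans (le_of_eq ?_) (h (A.mulVec x.ofLp) x.ofLp)
    rw [bilin_eq_sum_mulVec, vecNorm_sq]
    exact Finset.sum_congr rfl fun i _ => by ring
  have h2 : vecNorm (A.mulVec x.ofLp) ≤ c * vecNorm x.ofLp := by
    rcases (vecNorm_nonneg (A.mulVec x.ofLp)).eq_or_lt with h0 | h0
    · rw [← h0]; exact mul_nonneg hc (vecNorm_nonneg _)
    · nlinarith
  rw [← norm_toLp_eq_vecNorm, ← norm_toLp_eq_vecNorm] at h2
  exact h2

lemma opNorm_le_of_bilin_unit {A : Matrix (Fin m) (Fin n) ℝ} {c : ℝ} (hc : 0 ≤ c)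
    (h : ∀ u v, vecNorm u = 1 → vecNorm v = 1 → bilin A u v ≤ c) : opNorm A ≤ c := by
  refine opNorm_le_of_bilin hc fun u v => ?_
  rcases (vecNorm_nonneg u).eq_or_lt with hu | hu
  · simp [vecNorm_eq_zero hu.symm, bilin, vecNorm]
  rcases (vecNorm_nonneg v).eq_or_lt with hv | hv
  · simp [vecNorm_eq_zero hv.symm, bilin, vecNorm]
  have := h ((vecNorm u)⁻¹ • u) ((vecNorm v)⁻¹ • v)
    (by rw [vecNorm_smul, abs_of_pos (inv_pos.2 hu), inv_mul_cancel₀ hu.ne'])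
    (by rw [vecNorm_smul, abs_of_pos (inv_pos.2 hv), inv_mul_cancel₀ hv.ne'])
  rw [bilin_smul_left, bilin_smul_right] at this
  field_simp at this
  linarith

/-- Passing to absolute values in both test vectors preserves their norms, so a dominating
nonnegative matrix has the larger norm. This transfers entrywise quadratic remainders to the norm of
`X ⊙ X`. -/
lemma opNorm_le_of_abs_le {A N : Matrix (Fin m) (Fin n) ℝ} (h : ∀ i j, |A i j| ≤ N i j) :
    opNorm A ≤ opNorm N := by
  refine opNorm_le_of_bilin (opNorm_nonneg _) fun u v => ?_
  have h1 : bilin A u v ≤ bilin N (fun i => |u i|) (fun j => |v j|) := by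
    refine Finset.sum_le_sum fun i _ => Finset.sum_le_sum fun j _ => ?_
    refine (le_abs_self _).trans ?_
    rw [abs_mul, abs_mul]
    gcongr
    exact h i j
  have := bilin_le N (fun i => |u i|) (fun j => |v j|)
  rw [vecNorm_abs, vecNorm_abs] at this
  exact h1.trans this

lemma opNorm_le_sqrt_sum_sq (A : Matrix (Fin m) (Fin n) ℝ) :
    opNorm A ≤ Real.sqrt (∑ i, ∑ j, A i j ^ 2) := by
  refine opNorm_le_of_bilin (Real.sqrt_nonneg _) fun u v => ?_
  have h1 : bilin A u v ≤ ∑ i, |u i| * (vecNorm (A i) * vecNorm v) := by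
    refine Finset.sum_le_sum fun i _ => ?_
    have : ∑ j, u i * A i j * v j = u i * ∑ j, A i j * v j := by
      rw [Finset.mul_sum]; exact Finset.sum_congr rfl fun j _ => by ring
    rw [this]
    refine (le_abs_self _).trans ?_
    rw [abs_mul]
    refine mul_le_mul_of_nonneg_left ?_ (abs_nonneg _)
    refine abs_le'.2 ⟨sum_mul_le_vecNorm _ _, ?_⟩
    have := sum_mul_le_vecNorm (fun j => -A i j) v
    simpa [vecNorm] using this
  have h2 : ∑ i, |u i| * (vecNorm (A i) * vecNorm v)
      = (∑ i, |u i| * vecNorm (A i)) * vecNorm v := by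
    rw [Finset.sum_mul]; exact Finset.sum_congr rfl fun j _ => by ring
  have h3 := sum_mul_le_vecNorm (fun i => |u i|) (fun i => vecNorm (A i))
  have h4 : vecNorm (fun i => vecNorm (A i)) = Real.sqrt (∑ i, ∑ j, A i j ^ 2) := by
    unfold vecNorm
    congr 1
    exact Finset.sum_congr rfl fun i _ => vecNorm_sq (A i)
  rw [h4, vecNorm_abs] at h3
  rw [h2] at h1
  nlinarith [mul_le_mul_of_nonneg_right h3 (vecNorm_nonneg v)]

lemma opNorm_le_of_forall_abs_le {A : Matrix (Fin m) (Fin n) ℝ} {c : ℝ} (hc : 0 ≤ c)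
    (h : ∀ i j, |A i j| ≤ c) : opNorm A ≤ c * Real.sqrt ((m : ℝ) * n) := by
  refine (opNorm_le_sqrt_sum_sq A).trans ?_
  have h1 : ∑ i, ∑ j, A i j ^ 2 ≤ c ^ 2 * ((m : ℝ) * n) := by
    calc ∑ i, ∑ j, A i j ^ 2 ≤ ∑ _i : Fin m, ∑ _j : Fin n, c ^ 2 :=
          Finset.sum_le_sum fun i _ => Finset.sum_le_sum fun j _ => by
            rw [← sq_abs]; exact pow_le_pow_left₀ (abs_nonneg _) (h i j) 2
      _ = c ^ 2 * ((m : ℝ) * n) := by simp; ring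
  refine (Real.sqrt_le_sqrt h1).trans (le_of_eq ?_)
  rw [Real.sqrt_mul (sq_nonneg c), Real.sqrt_sq hc]

lemma vecNorm_one : vecNorm (fun _ : Fin m => (1 : ℝ)) = Real.sqrt m := by simp [vecNorm]

/-- The sum of the entries is the bilinear form at the all-ones vectors; for `X ⊙ X` this controls
the average of the squares of the signal. -/
lemma abs_sum_le_opNorm (A : Matrix (Fin m) (Fin n) ℝ) :
    |∑ i, ∑ j, A i j| ≤ opNorm A * Real.sqrt ((m : ℝ) * n) := by
  have h := bilin_le A (fun _ => 1) (fun _ => 1)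
  have h' := bilin_le A (fun _ => -1) (fun _ => 1)
  have e : vecNorm (fun _ : Fin m => (-1 : ℝ)) = Real.sqrt m := by simp [vecNorm]
  rw [e] at h'
  rw [vecNorm_one] at h h'
  rw [vecNorm_one, ← Real.sqrt_mul (Nat.cast_nonneg m)] at h
  rw [← Real.sqrt_mul (Nat.cast_nonneg m)] at h'
  refine abs_le'.2 ⟨by simpa [bilin] using h, by simpa [bilin] using h'⟩

end LinearAlgebra

/-! ### Discretization of the unit ball -/

/-- A `1/2`-net of the unit ball with at most `5 ^ d` elements. -/
lemma exists_half_net (d : ℕ) : ∃ U : Finset (Fin d → ℝ), U.card ≤ 5 ^ d ∧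
    (∀ u ∈ U, vecNorm u ≤ 1) ∧ ∀ u : Fin d → ℝ, vecNorm u ≤ 1 → ∃ u' ∈ U, vecNorm (u - u') ≤ 1 / 2 := by
  classical
  let E := EuclideanSpace ℝ (Fin d)
  let good : ℕ → Prop := fun k => ∃ s : Finset E, s.card = k ∧ (∀ c ∈ s, ‖c‖ ≤ 2) ∧
    ∀ c ∈ s, ∀ d ∈ s, c ≠ d → 1 ≤ ‖c - d‖
  have hbound : ∀ k, good k → k ≤ 5 ^ d := by
    rintro k ⟨s, rfl, h1, h2⟩
    simpa [E] using Besicovitch.card_le_of_separated s h1 h2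
  have hg0 : good 0 := ⟨∅, by simp⟩
  -- A 1-separated set of maximal size in the ball of radius 2 has at most `5 ^ d` points by volume
  -- comparison, and maximality makes it 1-dense there. Halving yields the net of the unit ball.
  obtain ⟨s, hs, h1, h2⟩ : good (Nat.findGreatest good (5 ^ d)) :=
    Nat.findGreatest_spec (P := good) (Nat.zero_le _) hg0
  refine ⟨s.image (fun c => (2⁻¹ : ℝ) • c.ofLp), ?_, ?_, ?_⟩
  · exact Finset.card_image_le.trans (hbound _ ⟨s, rfl, h1, h2⟩)
  · intro u hu
    obtain ⟨c, hc, rfl⟩ := Finset.mem_image.1 hu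
    have := h1 c hc
    rw [vecNorm_smul, ← norm_toLp_eq_vecNorm, abs_of_pos (by norm_num)]
    change 2⁻¹ * ‖c‖ ≤ 1
    linarith
  · intro u hu
    by_contra hcon
    push Not at hcon
    let x : E := WithLp.toLp 2 ((2 : ℝ) • u)
    have hfar : ∀ c ∈ s, 1 < ‖x - c‖ := by
      intro c hc
      have := hcon _ (Finset.mem_image_of_mem _ hc)
      have e : u - (2⁻¹ : ℝ) • c.ofLp = (2⁻¹ : ℝ) • ((2 : ℝ) • u - c.ofLp) := by
        rw [smul_sub, smul_smul]; norm_num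
      rw [e, vecNorm_smul, abs_of_pos (by norm_num), ← norm_toLp_eq_vecNorm] at this
      change 1 / 2 < 2⁻¹ * ‖x - c‖ at this
      linarith
    have hx : x ∉ s := fun hx => by have := hfar x hx; simp at this; linarith
    have hgood : good (s.card + 1) := by
      refine ⟨insert x s, Finset.card_insert_of_notMem hx, ?_, ?_⟩
      · intro c hc
        rcases Finset.mem_insert.1 hc with rfl | hc
        · change ‖WithLp.toLp 2 ((2 : ℝ) • u)‖ ≤ 2
          rw [norm_toLp_eq_vecNorm, vecNorm_smul, abs_of_pos (by norm_num)]; linarith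
        · exact h1 c hc
      · intro c hc e he hce
        rcases Finset.mem_insert.1 hc with rfl | hc <;> rcases Finset.mem_insert.1 he with rfl | he
        · exact absurd rfl hce
        · exact (hfar e he).le
        · rw [norm_sub_rev]; exact (hfar c hc).le
        · exact h2 c hc e he hce
    have := Nat.le_findGreatest (hbound _ hgood) hgood
    omega

/-- Rounding each of the two test vectors to the net loses at most half of the norm being estimated,
so each rounding costs a factor 2. -/
lemma opNorm_le_of_net {m n : ℕ} {A : Matrix (Fin m) (Fin n) ℝ} {U : Finset (Fin m → ℝ)}
    {V : Finset (Fin n → ℝ)}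
    (hU : ∀ u : Fin m → ℝ, vecNorm u ≤ 1 → ∃ u' ∈ U, vecNorm (u - u') ≤ 1 / 2)
    (hV : ∀ u : Fin n → ℝ, vecNorm u ≤ 1 → ∃ u' ∈ V, vecNorm (u - u') ≤ 1 / 2)
    {t : ℝ} (ht : 0 ≤ t) (h : ∀ u ∈ U, ∀ v ∈ V, bilin A u v ≤ t) : opNorm A ≤ 4 * t := by
  have key : ∀ v ∈ V, vecNorm (A.mulVec v) ≤ 2 * t := by
    intro v hv
    set w := A.mulVec v with hw
    rcases (vecNorm_nonneg w).eq_or_lt with h0 | h0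
    · rw [← h0]; linarith
    obtain ⟨u, hu, hu'⟩ := hU ((vecNorm w)⁻¹ • w)
      (by rw [vecNorm_smul, abs_of_pos (inv_pos.2 h0), inv_mul_cancel₀ h0.ne'])
    have h1 : bilin A ((vecNorm w)⁻¹ • w) v = vecNorm w := by
      rw [bilin_smul_left, bilin_eq_sum_mulVec, ← hw]
      have : ∑ i, w i * w i = vecNorm w ^ 2 := by
        rw [vecNorm_sq]; exact Finset.sum_congr rfl fun i _ => by ring
      rw [this]; field_simp
    have h2 : bilin A ((vecNorm w)⁻¹ • w - u) v ≤ 1 / 2 * vecNorm w := by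
      rw [bilin_eq_sum_mulVec, ← hw]
      exact (sum_mul_le_vecNorm _ _).trans (mul_le_mul_of_nonneg_right hu' h0.le)
    have h3 : bilin A ((vecNorm w)⁻¹ • w) v = bilin A ((vecNorm w)⁻¹ • w - u) v + bilin A u v := by
      rw [← bilin_add_left]; simp
    linarith [h u hu v hv]
  have hstep : opNorm A ≤ 2 * t + 1 / 2 * opNorm A := by
    refine opNorm_le_of_bilin_unit (by linarith [opNorm_nonneg A]) fun u v hu hv => ?_
    obtain ⟨v', hv', hd⟩ := hV v hv.le
    have h3 : bilin A u v = bilin A u (v - v') + bilin A u v' := by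
      rw [← bilin_add_right]; simp
    have h4 := bilin_le A u (v - v')
    have h5 : bilin A u v' ≤ 2 * t := by
      rw [bilin_eq_sum_mulVec]
      refine (sum_mul_le_vecNorm _ _).trans ?_
      rw [hu, one_mul]
      exact key v' hv'
    rw [hu, one_mul] at h4
    nlinarith [opNorm_nonneg A, mul_le_mul_of_nonneg_left hd (opNorm_nonneg A)]
  linarith

/-! ### Random matrices with independent centred bounded entries -/

/-- The entries of the random matrix `A` are independent, centred, and bounded by those of `c`. -/
structure IsCenteredBounded {Ω : Type*} [MeasurableSpace Ω] (P : Measure Ω) {m n : ℕ}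
    (A : Ω → Matrix (Fin m) (Fin n) ℝ) (c : Fin m → Fin n → ℝ) : Prop where
  indep : iIndepFun (fun (ij : Fin m × Fin n) (ω : Ω) => A ω ij.1 ij.2) P
  aemeasurable : ∀ i j, AEMeasurable (fun ω => A ω i j) P
  bound : ∀ i j, ∀ᵐ ω ∂P, |A ω i j| ≤ c i j
  mean : ∀ i j, ∫ ω, A ω i j ∂P = 0

section Hoeffding

variable {Ω : Type*} [MeasurableSpace Ω] {P : Measure Ω} {m n : ℕ}
  {A : Ω → Matrix (Fin m) (Fin n) ℝ} {c : Fin m → Fin n → ℝ}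

lemma hasSubgaussianMGF_mono {X : Ω → ℝ} {a b : NNReal} (h : HasSubgaussianMGF X a P)
    (hab : a ≤ b) : HasSubgaussianMGF X b P where
  integrable_exp_mul := h.integrable_exp_mul
  mgf_le t := (h.mgf_le t).trans (by
    apply Real.exp_le_exp.2
    have : (a : ℝ) ≤ b := hab
    gcongr)

/-- Hoeffding's inequality for a linear form in the entries. -/
lemma IsCenteredBounded.measureReal_sum_ge_le [IsProbabilityMeasure P] (h : IsCenteredBounded P A c)
    (w : Fin m → Fin n → ℝ) {V t : ℝ} (hV : ∑ i, ∑ j, (w i j * c i j) ^ 2 ≤ V) (ht : 0 ≤ t) :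
    P.real {ω | t ≤ ∑ i, ∑ j, w i j * A ω i j} ≤ Real.exp (-t ^ 2 / (2 * V)) := by
  have hsub : ∀ ij ∈ (Finset.univ : Finset (Fin m × Fin n)),
      HasSubgaussianMGF (fun ω => w ij.1 ij.2 * A ω ij.1 ij.2)
        ((w ij.1 ij.2 * c ij.1 ij.2) ^ 2).toNNReal P := by
    rintro ⟨i, j⟩ -
    have h1 : ∀ᵐ ω ∂P, w i j * A ω i j ∈ Set.Icc (-|w i j * c i j|) |w i j * c i j| := by
      filter_upwards [h.bound i j] with ω hω
      refine abs_le.1 ?_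
      rw [abs_mul, abs_mul]
      exact mul_le_mul_of_nonneg_left (hω.trans (le_abs_self _)) (abs_nonneg _)
    have h2 := hasSubgaussianMGF_of_mem_Icc_of_integral_eq_zero
      ((h.aemeasurable i j).const_mul (w i j)) h1 (by
        rw [integral_const_mul, h.mean, mul_zero])
    refine hasSubgaussianMGF_mono h2 (le_of_eq ?_)
    ext
    -- The sub-Gaussian parameter of a centred variable in an interval is the square of half its
    -- length, here `(w i j * c i j) ^ 2`.
    have e : |w i j * c i j| - -|w i j * c i j| = 2 * |w i j * c i j| := by ring
    rw [Real.coe_toNNReal _ (sq_nonneg _), e]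
    simp [mul_pow]
  have hind : iIndepFun (fun (ij : Fin m × Fin n) ω => w ij.1 ij.2 * A ω ij.1 ij.2) P :=
    h.indep.comp (fun ij x => w ij.1 ij.2 * x) (fun ij => measurable_const_mul _)
  have hs := HasSubgaussianMGF.sum_of_iIndepFun hind hsub
  have hle : ∑ ij : Fin m × Fin n, ((w ij.1 ij.2 * c ij.1 ij.2) ^ 2).toNNReal ≤ V.toNNReal := by
    rw [← NNReal.coe_le_coe, NNReal.coe_sum]
    refine le_trans (le_of_eq ?_) (hV.trans (Real.le_coe_toNNReal V))
    rw [Fintype.sum_prod_type]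
    exact Finset.sum_congr rfl fun i _ => Finset.sum_congr rfl fun j _ =>
      Real.coe_toNNReal _ (sq_nonneg _)
  have hV0 : 0 ≤ V := le_trans (Finset.sum_nonneg fun i _ => Finset.sum_nonneg fun j _ =>
    sq_nonneg _) hV
  have := (hasSubgaussianMGF_mono hs hle).measure_ge_le ht
  rw [Real.coe_toNNReal _ hV0] at this
  simpa [Finset.sum_apply, Fintype.sum_prod_type] using this

lemma IsCenteredBounded.measureReal_bilin_ge_le [IsProbabilityMeasure P] (h : IsCenteredBounded P A c)
    (u : Fin m → ℝ) (v : Fin n → ℝ) {V t : ℝ}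
    (hV : ∑ i, ∑ j, u i ^ 2 * v j ^ 2 * c i j ^ 2 ≤ V) (ht : 0 ≤ t) :
    P.real {ω | t ≤ bilin (A ω) u v} ≤ Real.exp (-t ^ 2 / (2 * V)) := by
  have := h.measureReal_sum_ge_le (fun i j => u i * v j) (V := V) (t := t)
    (by refine le_trans (le_of_eq ?_) hV
        exact Finset.sum_congr rfl fun i _ => Finset.sum_congr rfl fun j _ => by ring) ht
  convert this using 5
  exact Finset.sum_congr rfl fun i _ => Finset.sum_congr rfl fun j _ => by ring

lemma measureReal_biUnion_le {ι : Type*} (s : Finset ι) (f : ι → Set Ω) {q : ι → ℝ}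
    (h : ∀ i ∈ s, P.real (f i) ≤ q i) : P.real (⋃ i ∈ s, f i) ≤ ∑ i ∈ s, q i := by
  refine le_trans ?_ (Finset.sum_le_sum h)
  exact measureReal_biUnion_finset_le s f

/-- A random matrix with independent centred entries bounded by `R` has norm `O(R √(m + n))`. -/
lemma IsCenteredBounded.measureReal_opNorm_gt_le [IsProbabilityMeasure P] (h : IsCenteredBounded P A c) {R : ℝ} (hR : 0 < R)
    (hc : ∀ i j, |c i j| ≤ R) :
    P.real {ω | 12 * R * Real.sqrt ((m : ℝ) + n) < opNorm (A ω)} ≤ Real.exp (-((m : ℝ) + n)) := by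
  obtain ⟨U, hUc, hU1, hU⟩ := exists_half_net m
  obtain ⟨V, hVc, hV1, hV⟩ := exists_half_net n
  -- The net loses a factor 4, so `4 t` is the threshold. Hoeffding's exponent is then `9/2 (m+n)`,
  -- which beats the logarithm of the number of pairs in the nets, at most `2 (m+n)` since `5 ≤ e²`.
  set t := 3 * R * Real.sqrt ((m : ℝ) + n) with ht
  have ht0 : 0 ≤ t := by positivity
  have ht2 : t ^ 2 = 9 * R ^ 2 * ((m : ℝ) + n) := by
    rw [ht, mul_pow, Real.sq_sqrt (by positivity)]; ring
  have hsub : {ω | 12 * R * Real.sqrt ((m : ℝ) + n) < opNorm (A ω)} ⊆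
      ⋃ uv ∈ U ×ˢ V, {ω | t ≤ bilin (A ω) uv.1 uv.2} := by
    intro ω hω
    by_contra hcon
    simp only [Set.mem_iUnion, Set.mem_ofPred_eq, Finset.mem_product, Prod.exists, not_exists,
      not_le] at hcon
    have := opNorm_le_of_net (A := A ω) hU hV ht0 fun u hu v hv => (hcon u v ⟨hu, hv⟩).le
    simp only [Set.mem_ofPred_eq] at hω
    linarith
  have hone : ∀ uv ∈ U ×ˢ V, P.real {ω | t ≤ bilin (A ω) uv.1 uv.2} ≤
      Real.exp (-(9 / 2 * ((m : ℝ) + n))) := by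
    rintro ⟨u, v⟩ huv
    obtain ⟨hu, hv⟩ := Finset.mem_product.1 huv
    have hle : ∑ i, ∑ j, u i ^ 2 * v j ^ 2 * c i j ^ 2 ≤ R ^ 2 := by
      calc ∑ i, ∑ j, u i ^ 2 * v j ^ 2 * c i j ^ 2
          ≤ ∑ i, ∑ j, u i ^ 2 * v j ^ 2 * R ^ 2 := by
            refine Finset.sum_le_sum fun i _ => Finset.sum_le_sum fun j _ => ?_
            refine mul_le_mul_of_nonneg_left (sq_le_sq.2 ?_) (by positivity)
            exact (hc i j).trans (le_abs_self R)
        _ = vecNorm u ^ 2 * vecNorm v ^ 2 * R ^ 2 := by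
            rw [vecNorm_sq, vecNorm_sq, Finset.sum_mul_sum, Finset.sum_mul]
            exact Finset.sum_congr rfl fun i _ => (Finset.sum_mul _ _ _).symm
        _ ≤ 1 ^ 2 * 1 ^ 2 * R ^ 2 := by
            have h1 := pow_le_pow_left₀ (vecNorm_nonneg u) (hU1 u hu) 2
            have h2 := pow_le_pow_left₀ (vecNorm_nonneg v) (hV1 v hv) 2
            gcongr
        _ = R ^ 2 := by ring
    refine (h.measureReal_bilin_ge_le u v hle ht0).trans (le_of_eq ?_)
    rw [ht2]; congr 1; field_simp
  refine (measureReal_mono hsub (measure_ne_top P _)).trans ((measureReal_biUnion_le _ _ hone).trans ?_)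
  rw [Finset.sum_const, nsmul_eq_mul, Finset.card_product]
  have h5 : (5 : ℝ) ≤ Real.exp 2 := by
    have := Real.exp_one_gt_d9
    have e : Real.exp 2 = Real.exp 1 * Real.exp 1 := by rw [← Real.exp_add]; norm_num
    rw [e]; nlinarith
  have hcard : ((U.card * V.card : ℕ) : ℝ) ≤ Real.exp (2 * ((m : ℝ) + n)) := by
    calc ((U.card * V.card : ℕ) : ℝ) ≤ ((5 ^ m * 5 ^ n : ℕ) : ℝ) := by
          exact_mod_cast Nat.mul_le_mul hUc hVc
      _ = 5 ^ (m + n) := by push_cast; rw [pow_add]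
      _ ≤ Real.exp 2 ^ (m + n) := pow_le_pow_left₀ (by norm_num) h5 _
      _ = Real.exp (2 * ((m : ℝ) + n)) := by
          rw [← Real.exp_nat_mul]; congr 1; push_cast; ring
  calc _ ≤ Real.exp (2 * ((m : ℝ) + n)) * Real.exp (-(9 / 2 * ((m : ℝ) + n))) := by gcongr
    _ ≤ Real.exp (-((m : ℝ) + n)) := by
        rw [← Real.exp_add]
        apply Real.exp_le_exp.2
        have : (0:ℝ) ≤ (m : ℝ) + n := by positivity
        linarith

end Hoeffding

/-! ### Matrices tested on vectors with entries in `{-1, 0, 1}` -/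

/-- The real vector with the given signs. -/
def signVec {m : ℕ} (σ : Fin m → SignType) : Fin m → ℝ := fun i => (σ i : ℝ)

lemma abs_signType_coe (s : SignType) : |(s : ℝ)| = if s = 0 then 0 else 1 := by
  cases s <;> simp

/-- Greedy signed binary expansion. -/
lemma exists_sign_digits {x : ℝ} (hx : |x| ≤ 2) (L : ℕ) : ∃ d : ℕ → SignType,
    (∀ l, (2⁻¹ : ℝ) ^ l * |(d l : ℝ)| ≤ |x|) ∧
    |x - ∑ l ∈ Finset.range L, (2⁻¹ : ℝ) ^ l * (d l : ℝ)| ≤ min |x| (2 * 2⁻¹ ^ L) := by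
  induction L with
  | zero => exact ⟨fun _ => 0, by simp, by simpa using hx⟩
  | succ L ih =>
    obtain ⟨d, hd, hr⟩ := ih
    set r := x - ∑ l ∈ Finset.range L, (2⁻¹ : ℝ) ^ l * (d l : ℝ) with hrdef
    obtain ⟨hr1, hr2⟩ := le_min_iff.1 hr
    have hp : (0 : ℝ) < 2⁻¹ ^ L := by positivity
    have hsum : ∀ s : SignType, x - ∑ l ∈ Finset.range (L + 1),
        (2⁻¹ : ℝ) ^ l * ((Function.update d L s l : SignType) : ℝ) = r - 2⁻¹ ^ L * (s : ℝ) := by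
      intro s
      rw [Finset.sum_range_succ, Function.update_self, hrdef, sub_add_eq_sub_sub]
      congr 2
      refine Finset.sum_congr rfl fun l hl => ?_
      rw [Function.update_of_ne (Finset.mem_range.1 hl).ne]
    have hle : ∀ s : SignType, (2⁻¹ : ℝ) ^ L * |(s : ℝ)| ≤ |x| → ∀ l,
        (2⁻¹ : ℝ) ^ l * |((Function.update d L s l : SignType) : ℝ)| ≤ |x| := by
      intro s hs l
      by_cases h : l = L
      · subst h; simpa using hs
      · rw [Function.update_of_ne h]; exact hd l
    -- A nonzero digit is used only if the current power of two is at most the remainder, which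
    -- never exceeds `|x|`. Hence no single digit term is larger than `|x|`, and the remainder bound
    -- halves at each step.
    by_cases hbig : (2⁻¹ : ℝ) ^ L ≤ |r|
    · refine ⟨Function.update d L (SignType.sign r), hle _ ?_, ?_⟩
      · rw [abs_signType_coe]
        split_ifs <;> linarith [abs_nonneg x]
      · rw [hsum]
        have e : |r - 2⁻¹ ^ L * (SignType.sign r : ℝ)| = |r| - 2⁻¹ ^ L := by
          rcases lt_trichotomy r 0 with h | h | h
          · rw [abs_of_neg h] at hbig ⊢
            simp only [sign_neg h, SignType.coe_neg_one]
            rw [abs_of_nonpos (by linarith)]; ring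
          · rw [h, abs_zero] at hbig; linarith
          · rw [abs_of_pos h] at hbig ⊢
            simp only [sign_pos h, SignType.coe_one]
            rw [abs_of_nonneg (by linarith)]; ring
        rw [e, pow_succ]
        exact le_min (by linarith) (by linarith)
    · refine ⟨Function.update d L 0, hle _ (by simp), ?_⟩
      rw [hsum]
      push Not at hbig
      simp only [SignType.coe_zero, mul_zero, sub_zero, pow_succ]
      exact le_min hr1 (by linarith)

/-- The expansion is taken coordinatewise. Each digit term is dominated by the corresponding entry
of `u`, so every layer has norm at most one; the tails, at most `2·2^{-L}` in each of the `m`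
coordinates, have norm at most `2·2^{-L} √m`. -/
lemma exists_signVec_expansion {m : ℕ} {u : Fin m → ℝ} (hu : vecNorm u = 1) {L : ℕ}
    (hL : 8 * Real.sqrt m ≤ 2 ^ L) : ∃ σ : ℕ → Fin m → SignType,
    (∀ l, (2⁻¹ : ℝ) ^ l * vecNorm (signVec (σ l)) ≤ 1) ∧
    vecNorm (u - ∑ l ∈ Finset.range L, (2⁻¹ : ℝ) ^ l • signVec (σ l)) ≤ 1 / 4 := by
  have hu1 : ∀ i, |u i| ≤ 2 := by
    intro i
    have h1 : u i ^ 2 ≤ vecNorm u ^ 2 := by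
      rw [vecNorm_sq]
      exact Finset.single_le_sum (f := fun i => u i ^ 2) (fun _ _ => sq_nonneg _) (Finset.mem_univ i)
    rw [hu] at h1
    nlinarith [sq_abs (u i), abs_nonneg (u i)]
  choose d hd1 hd2 using fun i => exists_sign_digits (hu1 i) L
  refine ⟨fun l i => d i l, fun l => ?_, ?_⟩
  · rw [← hu]
    have : (2⁻¹ : ℝ) ^ l * vecNorm (signVec fun i => d i l)
        = vecNorm ((2⁻¹ : ℝ) ^ l • signVec fun i => d i l) := by
      rw [vecNorm_smul, abs_of_pos (by positivity)]
    rw [this]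
    refine vecNorm_mono fun i => ?_
    simp only [Pi.smul_apply, smul_eq_mul, signVec, abs_mul]
    rw [abs_of_pos (a := (2⁻¹ : ℝ) ^ l) (by positivity)]
    exact hd1 i l
  · have h1 : vecNorm (u - ∑ l ∈ Finset.range L, (2⁻¹ : ℝ) ^ l • signVec fun i => d i l)
        ≤ vecNorm ((2 * (2⁻¹ : ℝ) ^ L) • fun _ : Fin m => (1 : ℝ)) := by
      refine vecNorm_mono fun i => ?_
      simp only [Pi.smul_apply, Pi.sub_apply, Finset.sum_apply, smul_eq_mul, signVec, mul_one]
      exact ((hd2 i).trans (min_le_right _ _)).trans (le_abs_self _)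
    rw [vecNorm_smul, vecNorm_one, abs_of_pos (by positivity)] at h1
    refine h1.trans ?_
    rw [inv_pow]
    have : (0 : ℝ) < 2 ^ L := by positivity
    field_simp
    linarith

/-- Each of the `L²` pairs of dyadic layers contributes at most `κ`. The two remainders contribute
at most `1/4 + 5/16 = 9/16` of the norm, and `1/(1 - 9/16) = 16/7 ≤ 3`. -/
lemma opNorm_le_of_signVec {m n : ℕ} {A : Matrix (Fin m) (Fin n) ℝ} {κ : ℝ} (hκ : 0 ≤ κ)
    (h : ∀ σ τ, bilin A (signVec σ) (signVec τ) ≤ κ * (vecNorm (signVec σ) * vecNorm (signVec τ)))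
    {L : ℕ} (hm : 8 * Real.sqrt m ≤ 2 ^ L) (hn : 8 * Real.sqrt n ≤ 2 ^ L) :
    opNorm A ≤ 3 * κ * (L : ℝ) ^ 2 := by
  have hstep : opNorm A ≤ κ * (L : ℝ) ^ 2 + 9 / 16 * opNorm A := by
    refine opNorm_le_of_bilin_unit (by have := opNorm_nonneg A; positivity) fun u v hu hv => ?_
    obtain ⟨σ, hσ1, hσ2⟩ := exists_signVec_expansion hu hm
    obtain ⟨τ, hτ1, hτ2⟩ := exists_signVec_expansion hv hn
    set u' := ∑ l ∈ Finset.range L, (2⁻¹ : ℝ) ^ l • signVec (σ l) with hu'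
    set v' := ∑ l ∈ Finset.range L, (2⁻¹ : ℝ) ^ l • signVec (τ l) with hv'
    have hnu : vecNorm u' ≤ 5 / 4 := by
      have h1 : u' = u + (-1 : ℝ) • (u - u') := by ext i; simp
      rw [h1]
      refine (vecNorm_add_le _ _).trans ?_
      rw [vecNorm_smul, hu]
      norm_num
      linarith
    have hmain : bilin A u' v' ≤ κ * (L : ℝ) ^ 2 := by
      rw [hu', bilin_sum_left]
      have : ∀ l ∈ Finset.range L, bilin A ((2⁻¹ : ℝ) ^ l • signVec (σ l)) v' ≤ L * κ := by
        intro l _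
        rw [hv', bilin_sum_right]
        have : ∀ k ∈ Finset.range L,
            bilin A ((2⁻¹ : ℝ) ^ l • signVec (σ l)) ((2⁻¹ : ℝ) ^ k • signVec (τ k)) ≤ κ := by
          intro k _
          rw [bilin_smul_left, bilin_smul_right]
          have h1 := h (σ l) (τ k)
          have h2 : ((2⁻¹ : ℝ) ^ l * vecNorm (signVec (σ l))) *
              ((2⁻¹ : ℝ) ^ k * vecNorm (signVec (τ k))) ≤ 1 :=
            mul_le_one₀ (hσ1 l) (by have := vecNorm_nonneg (signVec (τ k)); positivity) (hτ1 k)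
          calc (2⁻¹ : ℝ) ^ l * ((2⁻¹ : ℝ) ^ k * bilin A (signVec (σ l)) (signVec (τ k)))
              ≤ (2⁻¹ : ℝ) ^ l * ((2⁻¹ : ℝ) ^ k *
                (κ * (vecNorm (signVec (σ l)) * vecNorm (signVec (τ k))))) := by gcongr
            _ = κ * (((2⁻¹ : ℝ) ^ l * vecNorm (signVec (σ l))) *
              ((2⁻¹ : ℝ) ^ k * vecNorm (signVec (τ k)))) := by ring
            _ ≤ κ * 1 := by gcongr
            _ = κ := mul_one κ
        simpa using Finset.sum_le_sum this
      have := Finset.sum_le_sum this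
      simp only [Finset.sum_const, Finset.card_range, nsmul_eq_mul] at this
      linarith [this, sq (L : ℝ)]
    have e1 : bilin A u v = bilin A (u - u') v + bilin A u' v := by rw [← bilin_add_left]; simp
    have e2 : bilin A u' v = bilin A u' (v - v') + bilin A u' v' := by
      rw [← bilin_add_right]; simp
    have b1 := bilin_le A (u - u') v
    have b2 := bilin_le A u' (v - v')
    have b3 : vecNorm u' * vecNorm (v - v') ≤ 5 / 4 * (1 / 4) :=
      mul_le_mul hnu hτ2 (vecNorm_nonneg _) (by norm_num)
    rw [hv, mul_one] at b1
    have hA := opNorm_nonneg A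
    nlinarith [mul_le_mul_of_nonneg_left hσ2 hA, mul_le_mul_of_nonneg_left b3 hA]
  have : 0 ≤ κ * (L : ℝ) ^ 2 := by positivity
  linarith

lemma vecNorm_signVec_sq {m : ℕ} (σ : Fin m → SignType) :
    vecNorm (signVec σ) ^ 2 = ((Finset.univ.filter fun i => σ i ≠ 0).card : ℝ) := by
  rw [vecNorm_sq, Finset.card_filter]
  push_cast
  refine Finset.sum_congr rfl fun i _ => ?_
  rw [signVec, ← sq_abs, abs_signType_coe]
  by_cases h : σ i = 0 <;> simp [h]

lemma sum_pow_card_signs (m : ℕ) (q : ℝ) :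
    ∑ σ : Fin m → SignType, q ^ (Finset.univ.filter fun i => σ i ≠ 0).card = (1 + 2 * q) ^ m := by
  have h := Finset.prod_univ_sum (fun _ : Fin m => (Finset.univ : Finset SignType))
    (fun _ s => if s = 0 then (1 : ℝ) else q)
  have e : ∑ s : SignType, (if s = 0 then (1 : ℝ) else q) = 1 + 2 * q := by
    rw [show (Finset.univ : Finset SignType) = {0, -1, 1} from rfl]
    simp; ring
  rw [e] at h
  simp only [Finset.prod_const, Finset.card_univ, Fintype.card_fin, Fintype.piFinset_univ] at h
  rw [h]
  refine Finset.sum_congr rfl fun σ _ => ?_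
  rw [Finset.prod_ite]
  simp

/-- The full sum is `(1 + 2q)^m ≤ exp (2qm)`. Leaving out the zero vector subtracts 1 and makes the
sum small: this is the entropy side of the union bound over sign vectors. -/
lemma sum_pow_card_signs_ne_zero_le {m : ℕ} {q : ℝ} (hq : 0 ≤ q) (hqm : 2 * q * m ≤ 1) :
    ∑ σ ∈ Finset.univ.filter (fun σ : Fin m → SignType => σ ≠ 0),
      q ^ (Finset.univ.filter fun i => σ i ≠ 0).card ≤ 4 * q * m := by
  have h1 : ∑ σ : Fin m → SignType, q ^ (Finset.univ.filter fun i => σ i ≠ 0).card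
      = ∑ σ ∈ Finset.univ.filter (fun σ : Fin m → SignType => σ ≠ 0),
      q ^ (Finset.univ.filter fun i => σ i ≠ 0).card + 1 := by
    rw [← Finset.sum_filter_add_sum_filter_not Finset.univ (fun σ : Fin m → SignType => σ ≠ 0)]
    congr 1
    rw [Finset.filter_congr (q := fun σ => σ = 0) (by simp), Finset.filter_eq' Finset.univ]
    simp
  rw [sum_pow_card_signs] at h1
  have h2 : (1 + 2 * q) ^ m ≤ Real.exp (2 * q * m) := by
    have := Real.add_one_le_exp (2 * q)
    calc (1 + 2 * q) ^ m ≤ Real.exp (2 * q) ^ m :=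
          pow_le_pow_left₀ (by positivity) (by linarith) m
      _ = Real.exp (2 * q * m) := by rw [← Real.exp_nat_mul]; congr 1; ring
  have h3 := Real.abs_exp_sub_one_le (x := 2 * q * m) (by rw [abs_of_nonneg (by positivity)]; exact hqm)
  rw [abs_of_nonneg (a := 2 * q * m) (by positivity)] at h3
  linarith [le_abs_self (Real.exp (2 * q * m) - 1)]

section

variable {Ω : Type*} [MeasurableSpace Ω] {P : Measure Ω} {m n : ℕ}
  {A : Ω → Matrix (Fin m) (Fin n) ℝ} {c : Fin m → Fin n → ℝ}

/-- A random matrix with independent centred bounded entries has norm of the order of the largest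
norm of a row or of a column of the matrix of bounds, up to logarithmic factors. -/
lemma IsCenteredBounded.measureReal_opNorm_gt_le_of_rows [IsProbabilityMeasure P]
    (h : IsCenteredBounded P A c) {R κ : ℝ} (hR : 0 < R) (hκ : 0 ≤ κ)
    (hrow : ∀ i, ∑ j, c i j ^ 2 ≤ R ^ 2) (hcol : ∀ j, ∑ i, c i j ^ 2 ≤ R ^ 2) {L : ℕ}
    (hm : 8 * Real.sqrt m ≤ 2 ^ L) (hn : 8 * Real.sqrt n ≤ 2 ^ L)
    {q : ℝ} (hq : q = Real.exp (-κ ^ 2 / (4 * R ^ 2))) (hqm : 2 * q * m ≤ 1) (hqn : 2 * q * n ≤ 1) :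
    P.real {ω | 3 * κ * (L : ℝ) ^ 2 < opNorm (A ω)} ≤ 16 * q ^ 2 * (m * n) := by
  classical
  have hq0 : 0 ≤ q := by rw [hq]; positivity
  set U := Finset.univ.filter (fun σ : Fin m → SignType => σ ≠ 0)
  set V := Finset.univ.filter (fun σ : Fin n → SignType => σ ≠ 0)
  let N : ∀ d : ℕ, (Fin d → SignType) → ℝ := fun d σ => vecNorm (signVec σ)
  have hsub : {ω | 3 * κ * (L : ℝ) ^ 2 < opNorm (A ω)} ⊆
      ⋃ p ∈ U ×ˢ V, {ω | κ * (N m p.1 * N n p.2) ≤ bilin (A ω) (signVec p.1) (signVec p.2)} := by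
    intro ω hω
    by_contra hcon
    simp only [Set.mem_iUnion, Set.mem_ofPred_eq, Finset.mem_product, Prod.exists, not_exists,
      not_le] at hcon hω
    refine absurd hω (not_lt.2 (opNorm_le_of_signVec hκ (fun σ τ => ?_) hm hn))
    by_cases h0 : σ = 0
    · subst h0; simp [bilin, signVec, vecNorm]
    by_cases h1 : τ = 0
    · subst h1; simp [bilin, signVec, vecNorm]
    exact (hcon σ τ ⟨by simp [U, h0], by simp [V, h1]⟩).le
  have hcard : ∀ {d : ℕ} (σ : Fin d → SignType), σ ≠ 0 → 1 ≤ N d σ ^ 2 := by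
    intro d σ hσ
    change 1 ≤ vecNorm (signVec σ) ^ 2
    rw [vecNorm_signVec_sq]
    obtain ⟨i, hi⟩ := Function.ne_iff.1 hσ
    exact_mod_cast Finset.card_pos.2 ⟨i, by simpa using hi⟩
  -- For supports of sizes `s` and `t`, the row and column bounds make the variance proxy at most
  -- `R² min(s,t)`. The exponent is therefore at least `κ² max(s,t) / (2R²)`, hence at least `κ²
  -- (s+t) / (4R²)`, which is `q ^ s * q ^ t` after exponentiation and so makes the union bound
  -- factor. A net of the whole ball would lose a power of the dimension here.
  have hone : ∀ p ∈ U ×ˢ V,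
      P.real {ω | κ * (N m p.1 * N n p.2) ≤ bilin (A ω) (signVec p.1) (signVec p.2)} ≤
      q ^ (Finset.univ.filter fun i => p.1 i ≠ 0).card *
        q ^ (Finset.univ.filter fun i => p.2 i ≠ 0).card := by
    rintro ⟨σ, τ⟩ hp
    obtain ⟨hσ, hτ⟩ := Finset.mem_product.1 hp
    have hσ' := hcard σ (Finset.mem_filter.1 hσ).2
    have hτ' := hcard τ (Finset.mem_filter.1 hτ).2
    have hσ0 : N m σ ≠ 0 := by rintro h; rw [h] at hσ'; norm_num at hσ'
    have hτ0 : N n τ ≠ 0 := by rintro h; rw [h] at hτ'; norm_num at hτ'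
    have hle1 : ∀ s : SignType, (s : ℝ) ^ 2 ≤ 1 := by intro s; cases s <;> simp
    have hV1 : ∑ i, ∑ j, signVec σ i ^ 2 * signVec τ j ^ 2 * c i j ^ 2 ≤ N m σ ^ 2 * R ^ 2 := by
      change _ ≤ vecNorm (signVec σ) ^ 2 * R ^ 2
      rw [vecNorm_sq, Finset.sum_mul]
      refine Finset.sum_le_sum fun i _ => ?_
      refine le_trans ?_ (mul_le_mul_of_nonneg_left (hrow i) (sq_nonneg _))
      rw [Finset.mul_sum]
      refine Finset.sum_le_sum fun j _ => ?_
      have := mul_le_mul_of_nonneg_left (hle1 (τ j)) (sq_nonneg (signVec σ i))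
      rw [mul_one] at this
      exact mul_le_mul_of_nonneg_right this (sq_nonneg _)
    have hV2 : ∑ i, ∑ j, signVec σ i ^ 2 * signVec τ j ^ 2 * c i j ^ 2 ≤ N n τ ^ 2 * R ^ 2 := by
      change _ ≤ vecNorm (signVec τ) ^ 2 * R ^ 2
      rw [vecNorm_sq, Finset.sum_mul, Finset.sum_comm]
      refine Finset.sum_le_sum fun j _ => ?_
      refine le_trans ?_ (mul_le_mul_of_nonneg_left (hcol j) (sq_nonneg _))
      rw [Finset.mul_sum]
      refine Finset.sum_le_sum fun i _ => ?_
      have := mul_le_mul_of_nonneg_right (hle1 (σ i)) (sq_nonneg (signVec τ j))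
      rw [one_mul] at this
      exact mul_le_mul_of_nonneg_right this (sq_nonneg _)
    have ht : 0 ≤ κ * (N m σ * N n τ) :=
      mul_nonneg hκ (mul_nonneg (vecNorm_nonneg _) (vecNorm_nonneg _))
    rw [← pow_add, hq, ← Real.exp_nat_mul]
    push_cast
    rw [← vecNorm_signVec_sq, ← vecNorm_signVec_sq]
    change _ ≤ Real.exp ((N m σ ^ 2 + N n τ ^ 2) * _)
    rcases le_total (N m σ ^ 2) (N n τ ^ 2) with hst | hst
    · refine (h.measureReal_bilin_ge_le _ _ hV1 ht).trans (Real.exp_le_exp.2 ?_)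
      rw [mul_pow, mul_pow]
      have : -(κ ^ 2 * (N m σ ^ 2 * N n τ ^ 2)) / (2 * (N m σ ^ 2 * R ^ 2))
          = (2 * N n τ ^ 2) * (-κ ^ 2 / (4 * R ^ 2)) := by field_simp; norm_num
      rw [this]
      refine mul_le_mul_of_nonpos_right (by linarith) ?_
      rw [neg_div]
      have : 0 ≤ κ ^ 2 / (4 * R ^ 2) := by positivity
      linarith
    · refine (h.measureReal_bilin_ge_le _ _ hV2 ht).trans (Real.exp_le_exp.2 ?_)
      rw [mul_pow, mul_pow]
      have : -(κ ^ 2 * (N m σ ^ 2 * N n τ ^ 2)) / (2 * (N n τ ^ 2 * R ^ 2))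
          = (2 * N m σ ^ 2) * (-κ ^ 2 / (4 * R ^ 2)) := by field_simp; norm_num
      rw [this]
      refine mul_le_mul_of_nonpos_right (by linarith) ?_
      rw [neg_div]
      have : 0 ≤ κ ^ 2 / (4 * R ^ 2) := by positivity
      linarith
  refine (measureReal_mono hsub (measure_ne_top P _)).trans
    ((measureReal_biUnion_le _ _ hone).trans ?_)
  rw [Finset.sum_product]
  refine le_trans (le_of_eq (Finset.sum_mul_sum U V
    (fun σ => q ^ (Finset.univ.filter fun i => σ i ≠ 0).card)
    (fun σ => q ^ (Finset.univ.filter fun i => σ i ≠ 0).card)).symm) ?_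
  have hU := sum_pow_card_signs_ne_zero_le hq0 hqm
  have hV := sum_pow_card_signs_ne_zero_le hq0 hqn
  calc _ ≤ (4 * q * m) * (4 * q * n) :=
        mul_le_mul hU hV (Finset.sum_nonneg fun _ _ => pow_nonneg hq0 _) (by positivity)
    _ = 16 * q ^ 2 * (m * n) := by ring

end

/-! ### Elementary calculus -/

lemma abs_sub_le_of_hasDerivAt {g g' : ℝ → ℝ} {M : ℝ} (h : ∀ x, HasDerivAt g (g' x) x)
    (hb : ∀ x, |g' x| ≤ M) (x y : ℝ) : |g x - g y| ≤ M * |x - y| := by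
  have := Convex.norm_image_sub_le_of_norm_hasDerivWithin_le (f := g) (f' := g') (s := Set.univ)
    (C := M) (x := y) (y := x) (fun z _ => (h z).hasDerivWithinAt) (fun z _ => hb z) convex_univ
    (Set.mem_univ _) (Set.mem_univ _)
  simpa using this

/-- The mean value inequality for `t ↦ g t - t g' x` between `x` and `x + s`; only a Lipschitz
derivative is needed. -/
lemma abs_taylor_le {g g' : ℝ → ℝ} {M : ℝ} (hM : 0 ≤ M) (h : ∀ x, HasDerivAt g (g' x) x)
    (hL : ∀ x y, |g' x - g' y| ≤ M * |x - y|) (x s : ℝ) :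
    |g (x + s) - g x - s * g' x| ≤ M * s ^ 2 := by
  have hd : ∀ t, HasDerivAt (fun t => g t - t * g' x) (g' t - g' x) t := fun t => by
    have := (h t).sub ((hasDerivAt_id t).mul_const (g' x))
    rw [one_mul] at this
    exact this
  have := Convex.norm_image_sub_le_of_norm_hasDerivWithin_le (f := fun t => g t - t * g' x)
    (f' := fun t => g' t - g' x) (s := Set.uIcc x (x + s)) (C := M * |s|) (x := x) (y := x + s)
    (fun z _ => (hd z).hasDerivWithinAt) (fun z hz => by
      refine (hL z x).trans (mul_le_mul_of_nonneg_left ?_ hM)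
      have := Set.abs_sub_left_of_mem_uIcc hz
      simpa using this) (convex_uIcc _ _) Set.left_mem_uIcc Set.right_mem_uIcc
  simp only [add_sub_cancel_left, Real.norm_eq_abs] at this
  rw [mul_assoc, ← sq, sq_abs] at this
  refine le_trans (le_of_eq ?_) this
  congr 1; ring

lemma abs_div_sub_div_le {ε a b a' b' : ℝ} (hε : 0 < ε) (hb : 0 ≤ b) (hb' : 0 ≤ b') :
    |a / (b + ε) - a' / (b' + ε)| ≤ |a - a'| / ε + |a'| * |b - b'| / ε ^ 2 := by
  have e : a / (b + ε) - a' / (b' + ε) = (a - a') / (b + ε) + a' * (b' - b) / ((b + ε) * (b' + ε)) := by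
    field_simp; ring
  rw [e]
  refine (abs_add_le _ _).trans (add_le_add ?_ ?_)
  · rw [abs_div, abs_of_pos (a := b + ε) (by positivity)]
    gcongr
    linarith
  · rw [abs_div, abs_mul, abs_sub_comm b' b, abs_of_pos (a := (b + ε) * (b' + ε)) (by positivity), sq]
    gcongr <;> linarith

/-- The regularized score `-a / (b + ε)`. -/
noncomputable def regRatio (ε : ℝ) (q₁ q₀ : ℝ → ℝ) (x : ℝ) : ℝ := -(q₁ x / (q₀ x + ε))

lemma abs_regRatio_le {ε M : ℝ} (hε : 0 < ε) {q₁ q₀ : ℝ → ℝ} {x : ℝ} (h0 : 0 ≤ q₀ x)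
    (h1 : |q₁ x| ≤ M) : |regRatio ε q₁ q₀ x| ≤ M / ε := by
  rw [regRatio, abs_neg, abs_div, abs_of_pos (a := q₀ x + ε) (by positivity)]
  have hM : 0 ≤ M := (abs_nonneg _).trans h1
  exact div_le_div₀ hM h1 hε (by linarith)

lemma abs_regRatio_sub_le {ε : ℝ} (hε : 0 < ε) {q₁ q₀ r₁ r₀ : ℝ → ℝ} {x y : ℝ}
    (h0 : 0 ≤ q₀ x) (h0' : 0 ≤ r₀ y) :
    |regRatio ε q₁ q₀ x - regRatio ε r₁ r₀ y| ≤
      |q₁ x - r₁ y| / ε + |r₁ y| * |q₀ x - r₀ y| / ε ^ 2 := by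
  have := abs_div_sub_div_le (a := q₁ x) (a' := r₁ y) hε h0 h0'
  rwa [regRatio, regRatio, neg_sub_neg, abs_sub_comm]

lemma hasDerivAt_regRatio {ε : ℝ} (hε : 0 < ε) {q₁ q₀ q₁' q₀' : ℝ → ℝ} {x : ℝ} (h0 : 0 ≤ q₀ x)
    (hq₁ : HasDerivAt q₁ (q₁' x) x) (hq₀ : HasDerivAt q₀ (q₀' x) x) :
    HasDerivAt (regRatio ε q₁ q₀)
      (-((q₁' x * (q₀ x + ε) - q₁ x * q₀' x) / (q₀ x + ε) ^ 2)) x := by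
  unfold regRatio
  exact (hq₁.div (hq₀.add_const ε) (by positivity)).neg

/-! ### The noise density -/

namespace IsNoiseDensity

variable {p : ℝ → ℝ} {M₁ M₂ : ℝ}

lemma abs_le (hp : IsNoiseDensity p M₁ M₂) (x : ℝ) : |p x| ≤ M₂ := by
  simpa using hp.deriv_bound 0 (by norm_num) x

lemma abs_deriv_le (hp : IsNoiseDensity p M₁ M₂) (x : ℝ) : |deriv p x| ≤ M₂ := by
  simpa using hp.deriv_bound 1 (by norm_num) x

lemma abs_deriv_deriv_le (hp : IsNoiseDensity p M₁ M₂) (x : ℝ) : |deriv (deriv p) x| ≤ M₂ := by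
  simpa [iteratedDeriv_succ] using hp.deriv_bound 2 le_rfl x

lemma bound_nonneg (hp : IsNoiseDensity p M₁ M₂) : 0 ≤ M₂ := (abs_nonneg _).trans (hp.abs_le 0)

lemma contDiff_deriv (hp : IsNoiseDensity p M₁ M₂) : ContDiff ℝ 2 (deriv p) :=
  (contDiff_succ_iff_deriv.1 (show ContDiff ℝ (2 + 1) p from hp.contDiff)).2.2

lemma hasDerivAt (hp : IsNoiseDensity p M₁ M₂) (x : ℝ) : HasDerivAt p (deriv p x) x :=
  (hp.contDiff.differentiable (by norm_num)).differentiableAt.hasDerivAt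

lemma hasDerivAt_deriv (hp : IsNoiseDensity p M₁ M₂) (x : ℝ) :
    HasDerivAt (deriv p) (deriv (deriv p) x) x :=
  (hp.contDiff_deriv.differentiable (by norm_num)).differentiableAt.hasDerivAt

lemma continuous (hp : IsNoiseDensity p M₁ M₂) : Continuous p := hp.contDiff.continuous

lemma continuous_deriv (hp : IsNoiseDensity p M₁ M₂) : Continuous (deriv p) :=
  hp.contDiff_deriv.continuous

lemma continuous_deriv_deriv (hp : IsNoiseDensity p M₁ M₂) : Continuous (deriv (deriv p)) :=
  hp.contDiff_deriv.continuous_deriv (by norm_num)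

lemma abs_sub_le (hp : IsNoiseDensity p M₁ M₂) (x y : ℝ) : |p x - p y| ≤ M₂ * |x - y| :=
  abs_sub_le_of_hasDerivAt hp.hasDerivAt hp.abs_deriv_le x y

lemma abs_deriv_sub_le (hp : IsNoiseDensity p M₁ M₂) (x y : ℝ) :
    |deriv p x - deriv p y| ≤ M₂ * |x - y| :=
  abs_sub_le_of_hasDerivAt hp.hasDerivAt_deriv hp.abs_deriv_deriv_le x y

lemma deriv_eq_zero (hp : IsNoiseDensity p M₁ M₂) {x : ℝ} (hx : p x = 0) : deriv p x = 0 := by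
  have : IsLocalMin p x := Filter.Eventually.of_forall fun y => by rw [hx]; exact hp.nonneg y
  exact this.deriv_eq_zero

/-- From `|p'| p ≤ p'² + p²`. Finite Fisher information thereby yields the integrability of `p'`. -/
lemma abs_deriv_le_add (hp : IsNoiseDensity p M₁ M₂) (x : ℝ) :
    |deriv p x| ≤ (deriv p x) ^ 2 / p x + p x := by
  rcases (hp.nonneg x).eq_or_lt with h | h
  · rw [hp.deriv_eq_zero h.symm, ← h]; simp
  · have e : (deriv p x) ^ 2 / p x + p x = ((deriv p x) ^ 2 + p x ^ 2) / p x := by field_simp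
    rw [e, le_div_iff₀ h, ← sq_abs]
    nlinarith [sq_nonneg (|deriv p x| - p x), abs_nonneg (deriv p x)]

lemma integrable_deriv (hp : IsNoiseDensity p M₁ M₂) : Integrable (deriv p) := by
  refine (hp.fisher_finite.add hp.integrable).mono' hp.continuous_deriv.aestronglyMeasurable ?_
  exact Eventually.of_forall fun x => hp.abs_deriv_le_add x

lemma integrable_mul_self (hp : IsNoiseDensity p M₁ M₂) : Integrable fun x => x * p x := by
  refine (hp.sq_integrable.add hp.integrable).mono'
    (continuous_id.mul hp.continuous).aestronglyMeasurable (Eventually.of_forall fun x => ?_)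
  have := hp.nonneg x
  simp only [Real.norm_eq_abs, abs_mul, abs_of_nonneg this, Pi.add_apply]
  nlinarith [sq_nonneg (|x| - 1), sq_abs x, abs_nonneg x]

/-- Bounded functions are integrable against the density. -/
lemma integrable_bdd_mul (hp : IsNoiseDensity p M₁ M₂) {φ : ℝ → ℝ} {C : ℝ} (hm : Measurable φ)
    (hb : ∀ x, |φ x| ≤ C) : Integrable fun x => φ x * p x :=
  hp.integrable.bdd_mul hm.aestronglyMeasurable (Eventually.of_forall hb)

lemma integrable_bdd_mul_deriv (hp : IsNoiseDensity p M₁ M₂) {φ : ℝ → ℝ} {C : ℝ} (hm : Measurable φ)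
    (hb : ∀ x, |φ x| ≤ C) : Integrable fun x => φ x * deriv p x :=
  hp.integrable_deriv.bdd_mul hm.aestronglyMeasurable (Eventually.of_forall hb)

lemma abs_integral_bdd_mul_le (hp : IsNoiseDensity p M₁ M₂) {φ : ℝ → ℝ} {C : ℝ} (hb : ∀ x, |φ x| ≤ C) :
    |∫ x, φ x * p x| ≤ C := by
  have h : ‖∫ x, φ x * p x‖ ≤ ∫ x, C * p x :=
    norm_integral_le_of_norm_le (hp.integrable.const_mul C) (Eventually.of_forall fun x => by
      rw [norm_mul, Real.norm_eq_abs, Real.norm_eq_abs, abs_of_nonneg (hp.nonneg x)]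
      exact mul_le_mul_of_nonneg_right (hb x) (hp.nonneg x))
  rwa [integral_const_mul, hp.integral_eq_one, mul_one] at h

lemma isProbabilityMeasure (hp : IsNoiseDensity p M₁ M₂) : IsProbabilityMeasure (noiseLaw p) := by
  constructor
  rw [noiseLaw, withDensity_apply _ MeasurableSet.univ, Measure.restrict_univ,
    ← ofReal_integral_eq_lintegral_ofReal hp.integrable (Eventually.of_forall hp.nonneg),
    hp.integral_eq_one, ENNReal.ofReal_one]

lemma integral_noiseLaw (hp : IsNoiseDensity p M₁ M₂) (φ : ℝ → ℝ) :
    ∫ x, φ x ∂(noiseLaw p) = ∫ x, φ x * p x := by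
  rw [noiseLaw, integral_withDensity_eq_integral_toReal_smul
    (hp.continuous.measurable.ennreal_ofReal) (by simp)]
  refine integral_congr_ae (Eventually.of_forall fun x => ?_)
  simp only [ENNReal.toReal_ofReal (hp.nonneg x), smul_eq_mul]
  ring

lemma integrable_noiseLaw_iff (hp : IsNoiseDensity p M₁ M₂) {φ : ℝ → ℝ} :
    Integrable φ (noiseLaw p) ↔ Integrable fun x => φ x * p x := by
  rw [noiseLaw, integrable_withDensity_iff
    (hp.continuous.measurable.ennreal_ofReal) (by simp)]
  simp only [ENNReal.toReal_ofReal (hp.nonneg _)]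

lemma integral_comp_of_hasLaw (hp : IsNoiseDensity p M₁ M₂) {Ω : Type*} [MeasurableSpace Ω]
    {P : Measure Ω} {w : Ω → ℝ} (hw : HasLaw w (noiseLaw p) P) {φ : ℝ → ℝ} (hφ : Measurable φ) :
    ∫ ω, φ (w ω) ∂P = ∫ x, φ x * p x := by
  rw [← hp.integral_noiseLaw]
  exact hw.integral_comp hφ.aestronglyMeasurable

lemma integrable_comp_of_hasLaw (hp : IsNoiseDensity p M₁ M₂) {Ω : Type*} [MeasurableSpace Ω]
    {P : Measure Ω} {w : Ω → ℝ} (hw : HasLaw w (noiseLaw p) P) {φ : ℝ → ℝ}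
    (hi : Integrable fun x => φ x * p x) : Integrable (fun ω => φ (w ω)) P := by
  have h : Integrable φ (P.map w) := by rw [hw.map_eq]; exact hp.integrable_noiseLaw_iff.2 hi
  exact h.comp_aemeasurable hw.aemeasurable

/-! ### The regularized score of the noise density -/

/-- The regularized score is centred. -/
lemma integral_score_mul (hp : IsNoiseDensity p M₁ M₂) {ε : ℝ} (hε : 0 < ε) :
    ∫ x, regRatio ε (deriv p) p x * p x = 0 := by
  have hpos : ∀ x, 0 < p x + ε := fun x => by linarith [hp.nonneg x]
  -- The product of the regularised score with `p` has the explicit primitive `-(p - ε log (1 +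
  -- p/ε))`. It lies between `-p` and `0`, hence is integrable, so its derivative integrates to
  -- zero.
  have h1 : ∀ x, HasDerivAt (fun x => -(p x - ε * Real.log (1 + p x / ε)))
      (regRatio ε (deriv p) p x * p x) x := by
    intro x
    have hx : 1 + p x / ε ≠ 0 := by have := hp.nonneg x; positivity
    have := ((hp.hasDerivAt x).sub (((((hp.hasDerivAt x).div_const ε).const_add 1).log hx).const_mul
      ε)).neg
    refine this.congr_deriv ?_
    have := (hpos x).ne'
    have e : 1 + p x / ε = (p x + ε) / ε := by field_simp; ring
    unfold regRatio
    rw [e]; field_simp; ring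
  have hm : Measurable (regRatio ε (deriv p) p) :=
    (hp.continuous_deriv.measurable.div (hp.continuous.measurable.add_const ε)).neg
  refine integral_eq_zero_of_hasDerivAt_of_integrable h1
    (hp.integrable_bdd_mul hm fun x => abs_regRatio_le hε (hp.nonneg x) (hp.abs_deriv_le x)) ?_
  have hc : Continuous fun x => -(p x - ε * Real.log (1 + p x / ε)) :=
    continuous_iff_continuousAt.2 fun x => (h1 x).continuousAt
  refine hp.integrable.mono' hc.aestronglyMeasurable (Eventually.of_forall fun x => ?_)
  have h0 := hp.nonneg x
  have h2 : 0 ≤ Real.log (1 + p x / ε) := Real.log_nonneg (by have : 0 ≤ p x / ε := by positivity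
                                                              linarith)
  have h3 : Real.log (1 + p x / ε) ≤ p x / ε := by
    have := Real.log_le_sub_one_of_pos (x := 1 + p x / ε) (by positivity)
    linarith
  have h4 : ε * Real.log (1 + p x / ε) ≤ p x := by
    calc ε * Real.log (1 + p x / ε) ≤ ε * (p x / ε) := by gcongr
      _ = p x := by field_simp
  rw [Real.norm_eq_abs, abs_neg, abs_of_nonneg (by linarith)]
  nlinarith

lemma measurable_score (hp : IsNoiseDensity p M₁ M₂) (ε : ℝ) : Measurable (regRatio ε (deriv p) p) :=
  (hp.continuous_deriv.measurable.div (hp.continuous.measurable.add_const ε)).neg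

lemma abs_score_le (hp : IsNoiseDensity p M₁ M₂) {ε : ℝ} (hε : 0 < ε) (x : ℝ) :
    |regRatio ε (deriv p) p x| ≤ M₂ / ε :=
  abs_regRatio_le hε (hp.nonneg x) (hp.abs_deriv_le x)

lemma abs_score_sub_le (hp : IsNoiseDensity p M₁ M₂) {ε : ℝ} (hε : 0 < ε) (x y : ℝ) :
    |regRatio ε (deriv p) p x - regRatio ε (deriv p) p y| ≤
      (M₂ / ε + M₂ ^ 2 / ε ^ 2) * |x - y| := by
  refine (abs_regRatio_sub_le hε (hp.nonneg x) (hp.nonneg y)).trans ?_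
  have h1 := hp.abs_deriv_sub_le x y
  have h2 := hp.abs_sub_le x y
  have h3 := hp.abs_deriv_le y
  have h4 : |deriv p y| * |p x - p y| ≤ M₂ * (M₂ * |x - y|) :=
    mul_le_mul h3 h2 (abs_nonneg _) hp.bound_nonneg
  calc _ ≤ M₂ * |x - y| / ε + M₂ * (M₂ * |x - y|) / ε ^ 2 := by gcongr
    _ = _ := by ring

/-- The correlation of the regularized score with the score tends to the Fisher information. -/
lemma tendsto_integral_score_mul_deriv (hp : IsNoiseDensity p M₁ M₂) :
    Tendsto (fun ε => -∫ x, regRatio ε (deriv p) p x * deriv p x) (𝓝[>] 0) (𝓝 (fisherInfo p)) := by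
  have e : (fun ε => -∫ x, regRatio ε (deriv p) p x * deriv p x) =
      fun ε => ∫ x, deriv p x ^ 2 / (p x + ε) := by
    ext ε
    rw [← integral_neg]
    congr 1; ext x
    rw [regRatio]; ring
  rw [e]
  refine tendsto_integral_filter_of_dominated_convergence (fun x => deriv p x ^ 2 / p x)
    (Eventually.of_forall fun ε => ((hp.continuous_deriv.measurable.pow_const 2).div
      (hp.continuous.measurable.add_const ε)).aestronglyMeasurable) ?_ hp.fisher_finite ?_
  · filter_upwards [self_mem_nhdsWithin] with ε hε
    refine Eventually.of_forall fun x => ?_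
    have hε' : (0 : ℝ) < ε := hε
    have h0 := hp.nonneg x
    rw [Real.norm_eq_abs, abs_of_nonneg (by positivity)]
    rcases h0.eq_or_lt with h | h
    · rw [hp.deriv_eq_zero h.symm]; simp
    · gcongr; linarith
  · refine Eventually.of_forall fun x => ?_
    rcases (hp.nonneg x).eq_or_lt with h | h
    · rw [hp.deriv_eq_zero h.symm]; simp
    · refine Tendsto.mono_left ?_ nhdsWithin_le_nhds
      have : Tendsto (fun ε => p x + ε) (𝓝 0) (𝓝 (p x + 0)) := tendsto_const_nhds.add tendsto_id
      rw [add_zero] at this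
      exact tendsto_const_nhds.div this h.ne'

lemma sq_score_mul_le (hp : IsNoiseDensity p M₁ M₂) {ε : ℝ} (hε : 0 < ε) (x : ℝ) :
    regRatio ε (deriv p) p x ^ 2 * p x ≤ deriv p x ^ 2 / p x := by
  have h0 := hp.nonneg x
  rcases h0.eq_or_lt with h | h
  · rw [hp.deriv_eq_zero h.symm, ← h]; simp
  · rw [regRatio, neg_sq, div_pow, le_div_iff₀ h, mul_assoc, div_mul_eq_mul_div,
      div_le_iff₀ (by positivity)]
    gcongr
    nlinarith

lemma tendsto_integral_score_sq (hp : IsNoiseDensity p M₁ M₂) :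
    Tendsto (fun ε => ∫ x, regRatio ε (deriv p) p x ^ 2 * p x) (𝓝[>] 0) (𝓝 (fisherInfo p)) := by
  refine tendsto_integral_filter_of_dominated_convergence (fun x => deriv p x ^ 2 / p x)
    (Eventually.of_forall fun ε => (((hp.measurable_score ε).pow_const 2).mul
      hp.continuous.measurable).aestronglyMeasurable) ?_ hp.fisher_finite ?_
  · filter_upwards [self_mem_nhdsWithin] with ε hε
    refine Eventually.of_forall fun x => ?_
    have h0 := hp.nonneg x
    rw [Real.norm_eq_abs, abs_of_nonneg (by positivity)]
    exact hp.sq_score_mul_le hε x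
  · refine Eventually.of_forall fun x => ?_
    rcases (hp.nonneg x).eq_or_lt with h | h
    · simp [regRatio, hp.deriv_eq_zero h.symm]
    · refine Tendsto.mono_left ?_ nhdsWithin_le_nhds
      have h1 : Tendsto (fun ε => p x + ε) (𝓝 0) (𝓝 (p x + 0)) := tendsto_const_nhds.add tendsto_id
      rw [add_zero] at h1
      have h2 := (((tendsto_const_nhds (x := deriv p x)).div h1 h.ne').neg.pow 2).mul_const (p x)
      have e : (-(deriv p x / p x)) ^ 2 * p x = deriv p x ^ 2 / p x := by field_simp
      rw [e] at h2
      exact h2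

lemma integral_score_sq_le (hp : IsNoiseDensity p M₁ M₂) {ε : ℝ} (hε : 0 < ε) :
    ∫ x, regRatio ε (deriv p) p x ^ 2 * p x ≤ fisherInfo p := by
  refine integral_mono_of_nonneg (Eventually.of_forall fun x => ?_) hp.fisher_finite
    (Eventually.of_forall fun x => hp.sq_score_mul_le hε x)
  have := hp.nonneg x
  positivity

/-- If the information vanished, `p` would be constant, which no density on the line is. Positivity
allows the division by `√I` that defines `Z`. -/
lemma fisherInfo_pos (hp : IsNoiseDensity p M₁ M₂) : 0 < fisherInfo p := by
  have hnn : ∀ x, 0 ≤ deriv p x ^ 2 / p x := fun x => div_nonneg (sq_nonneg _) (hp.nonneg x)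
  refine lt_of_le_of_ne (integral_nonneg hnn) fun h => ?_
  have h1 := (integral_eq_zero_iff_of_nonneg hnn hp.fisher_finite).1 h.symm
  have h2 : deriv p =ᵐ[volume] fun _ => 0 := by
    filter_upwards [h1] with x hx
    simp only [Pi.zero_apply, div_eq_zero_iff, sq_eq_zero_iff] at hx
    exact hx.elim id fun h => hp.deriv_eq_zero h
  have h3 : deriv p = fun _ => 0 := (hp.continuous_deriv.ae_eq_iff_eq volume continuous_const).1 h2
  have h4 : ∀ x, p x = p 0 := fun x =>
    is_const_of_deriv_eq_zero (hp.contDiff.differentiable (by norm_num)) (fun x => congrFun h3 x) x 0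
  have h5 : Integrable (fun _ : ℝ => p 0) := by
    have := hp.integrable
    rwa [show p = fun _ => p 0 from funext h4] at this
  have h6 := hp.integral_eq_one
  rw [show p = fun _ => p 0 from funext h4] at h6
  rw [integrable_const_iff] at h5
  rcases h5 with h5 | h5
  · rw [h5] at h6; simp at h6
  · have := h5.measure_univ_lt_top
    simp at this

end IsNoiseDensity

/-! ### Averages of matrices -/

section Avg

variable {m n : ℕ}

lemma avg_const (hmn : (m : ℝ) * n ≠ 0) (c : ℝ) : avg (fun (_ : Fin m) (_ : Fin n) => c) = c := by
  simp only [avg, Finset.sum_const, Finset.card_univ, Fintype.card_fin, nsmul_eq_mul]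
  rw [← mul_assoc, mul_div_cancel_left₀ _ hmn]

lemma avg_affine (hmn : (m : ℝ) * n ≠ 0) (a b d : ℝ) (f g : Fin m → Fin n → ℝ) :
    avg (fun i j => a * f i j + b * g i j + d) = a * avg f + b * avg g + d := by
  conv_rhs => rw [← avg_const hmn d]
  simp only [avg, Finset.sum_add_distrib, ← Finset.mul_sum]
  ring

lemma avg_mono {A B : Matrix (Fin m) (Fin n) ℝ} (h : ∀ i j, A i j ≤ B i j) : avg A ≤ avg B := by
  unfold avg
  gcongr
  exact h _ _

lemma avg_nonneg {A : Matrix (Fin m) (Fin n) ℝ} (h : ∀ i j, 0 ≤ A i j) : 0 ≤ avg A :=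
  div_nonneg (Finset.sum_nonneg fun i _ => Finset.sum_nonneg fun j _ => h i j) (by positivity)

lemma abs_avg_le (A : Matrix (Fin m) (Fin n) ℝ) : |avg A| ≤ avg (fun i j => |A i j|) := by
  unfold avg
  rw [abs_div, abs_of_nonneg (a := (m : ℝ) * n) (by positivity)]
  gcongr
  refine (Finset.abs_sum_le_sum_abs _ _).trans ?_
  gcongr
  exact Finset.abs_sum_le_sum_abs _ _

lemma abs_avg_le_of_forall {A : Matrix (Fin m) (Fin n) ℝ} (hmn : (m : ℝ) * n ≠ 0) {c : ℝ}
    (h : ∀ i j, |A i j| ≤ c) : |avg A| ≤ c := by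
  rw [← avg_const hmn c]
  exact (abs_avg_le A).trans (avg_mono h)

/-- The matrix of the deviations from the average, with opposite sign. -/
noncomputable def avgSub (X : Matrix (Fin m) (Fin n) ℝ) : Matrix (Fin m) (Fin n) ℝ :=
  fun i j => avg X - X i j

lemma avg_avgSub (hmn : (m : ℝ) * n ≠ 0) (X : Matrix (Fin m) (Fin n) ℝ) : avg (avgSub X) = 0 := by
  have : avgSub X = fun i j => (-1) * X i j + 0 * X i j + avg X := by
    ext i j; simp only [avgSub]; ring
  rw [this, avg_affine hmn (-1) 0 (avg X) X X]; ring

lemma avg_avgSub_sq_le (hmn : (m : ℝ) * n ≠ 0) (X : Matrix (Fin m) (Fin n) ℝ) :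
    avg (fun i j => avgSub X i j ^ 2) ≤ avg (fun i j => X i j ^ 2) := by
  have : (fun i j => avgSub X i j ^ 2) =
      fun i j => 1 * X i j ^ 2 + (-2 * avg X) * X i j + avg X ^ 2 := by
    ext i j; simp only [avgSub]; ring
  rw [this, avg_affine hmn 1 (-2 * avg X) (avg X ^ 2) (fun i j => X i j ^ 2) X]
  nlinarith [sq_nonneg (avg X)]

end Avg

/-! ### Kernel smoothing -/

namespace IsKernel

variable {K : ℝ → ℝ} {B : ℝ}

lemma hasDerivAt_iteratedDeriv (hK : IsKernel K B) {ℓ : ℕ} (hℓ : ℓ < 3) (x : ℝ) :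
    HasDerivAt (iteratedDeriv ℓ K) (iteratedDeriv (ℓ + 1) K x) x := by
  rw [iteratedDeriv_succ]
  exact (hK.differentiable ℓ hℓ x).hasDerivAt

lemma hasDerivAt (hK : IsKernel K B) (x : ℝ) : HasDerivAt K (deriv K x) x := by
  simpa using hK.hasDerivAt_iteratedDeriv (ℓ := 0) (by norm_num) x

lemma continuous (hK : IsKernel K B) : Continuous K :=
  continuous_iff_continuousAt.2 fun x => (hK.hasDerivAt x).continuousAt

lemma continuous_deriv (hK : IsKernel K B) : Continuous (deriv K) := by
  have := (hK.differentiable 1 (by norm_num)).continuous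
  rwa [iteratedDeriv_one] at this

lemma abs_le (hK : IsKernel K B) (x : ℝ) : |K x| ≤ B := by
  simpa using hK.deriv_bound 0 (by norm_num) x

lemma abs_deriv_le (hK : IsKernel K B) (x : ℝ) : |deriv K x| ≤ B := by
  simpa using hK.deriv_bound 1 (by norm_num) x

lemma abs_sub_le (hK : IsKernel K B) (x y : ℝ) : |K x - K y| ≤ B * |x - y| :=
  abs_sub_le_of_hasDerivAt hK.hasDerivAt hK.abs_deriv_le x y

lemma abs_deriv_sub_le (hK : IsKernel K B) (x y : ℝ) : |deriv K x - deriv K y| ≤ B * |x - y| := by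
  have := abs_sub_le_of_hasDerivAt (hK.hasDerivAt_iteratedDeriv (ℓ := 1) (by norm_num))
    (hK.deriv_bound 2 (by norm_num)) x y
  simpa using this

lemma bound_nonneg (hK : IsKernel K B) : 0 ≤ B := (abs_nonneg _).trans (hK.abs_le 0)

lemma integrable_mul_self (hK : IsKernel K B) : Integrable fun x => x * K x := by
  refine (hK.sq_integrable.add hK.integrable).mono'
    (continuous_id.mul hK.continuous).aestronglyMeasurable (Eventually.of_forall fun x => ?_)
  have := hK.nonneg x
  simp only [Real.norm_eq_abs, abs_mul, abs_of_nonneg this, Pi.add_apply]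
  nlinarith [sq_nonneg (|x| - 1), sq_abs x, abs_nonneg x]

lemma integrable_mul_bdd (hK : IsKernel K B) {φ : ℝ → ℝ} {C : ℝ} (hm : Continuous φ)
    (hb : ∀ x, |φ x| ≤ C) : Integrable fun z => K z * φ z :=
  hK.integrable.mul_bdd hm.aestronglyMeasurable (Eventually.of_forall hb)

lemma abs_integral_mul_le (hK : IsKernel K B) {φ ψ : ℝ → ℝ} (hψ : Integrable fun z => K z * ψ z)
    (hb : ∀ x, |φ x| ≤ ψ x) : |∫ z, K z * φ z| ≤ ∫ z, K z * ψ z :=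
  norm_integral_le_of_norm_le (f := fun z => K z * φ z) hψ (Eventually.of_forall fun x => by
    rw [norm_mul, Real.norm_eq_abs, Real.norm_eq_abs, abs_of_nonneg (hK.nonneg x)]
    exact mul_le_mul_of_nonneg_left (hb x) (hK.nonneg x))

lemma integral_mul_const (hK : IsKernel K B) (c : ℝ) : ∫ z, K z * c = c := by
  rw [MeasureTheory.integral_mul_const, hK.integral_eq_one, one_mul]

lemma integrable_mul_quadratic (hK : IsKernel K B) (a b c : ℝ) :
    Integrable fun z => K z * (a + b * z + c * z ^ 2) := by
  have h := ((hK.integrable.const_mul a).add (hK.integrable_mul_self.const_mul b)).add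
    (hK.sq_integrable.const_mul c)
  refine h.congr (Eventually.of_forall fun z => ?_)
  simp only [Pi.add_apply]; ring

lemma integral_mul_quadratic (hK : IsKernel K B) (a b c : ℝ) :
    ∫ z, K z * (a + b * z + c * z ^ 2) = a + c * ∫ z, z ^ 2 * K z := by
  have h : (fun z => K z * (a + b * z + c * z ^ 2)) =
      fun z => (a * K z + b * (z * K z)) + c * (z ^ 2 * K z) := by ext z; ring
  have h1 : Integrable fun z => a * K z := hK.integrable.const_mul a
  have h2 : Integrable fun z => b * (z * K z) := hK.integrable_mul_self.const_mul b
  have h3 : Integrable fun z => c * (z ^ 2 * K z) := hK.sq_integrable.const_mul c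
  have h12 : Integrable fun z => a * K z + b * (z * K z) := h1.add h2
  rw [h, integral_add h12 h3, integral_add h1 h2, integral_const_mul,
    integral_const_mul, integral_const_mul, hK.integral_eq_one, hK.first_moment]
  ring

end IsKernel

section Smooth

variable {m n : ℕ}

/-- The average over the shifts `s i j` of the convolution of `u` with the kernel of bandwidth `h`. -/
noncomputable def smooth (K : ℝ → ℝ) (h : ℝ) (s : Matrix (Fin m) (Fin n) ℝ) (u : ℝ → ℝ) (x : ℝ) : ℝ :=
  avg (fun i j => ∫ z, K z * u (x + s i j + h * z))

variable {K : ℝ → ℝ} {B : ℝ} {h M : ℝ} {s : Matrix (Fin m) (Fin n) ℝ} {u u' : ℝ → ℝ}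

lemma abs_smooth_le (hK : IsKernel K B) (hmn : (m : ℝ) * n ≠ 0) (hb : ∀ x, |u x| ≤ M) (x : ℝ) :
    |smooth K h s u x| ≤ M := by
  refine abs_avg_le_of_forall hmn fun i j => ?_
  have := hK.abs_integral_mul_le (φ := fun z => u (x + s i j + h * z)) (ψ := fun _ => M)
    (hK.integrable.mul_const M) (fun z => hb _)
  rwa [hK.integral_mul_const] at this

lemma smooth_nonneg (hK : IsKernel K B) (hu : ∀ x, 0 ≤ u x) (x : ℝ) : 0 ≤ smooth K h s u x :=
  avg_nonneg fun _ _ => integral_nonneg fun z => mul_nonneg (hK.nonneg z) (hu _)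

lemma hasDerivAt_smooth (hK : IsKernel K B) (hu : ∀ x, HasDerivAt u (u' x) x) {M₀ : ℝ}
    (hb0 : ∀ x, |u x| ≤ M₀) (hc' : Continuous u') (hb : ∀ x, |u' x| ≤ M) (x : ℝ) :
    HasDerivAt (smooth K h s u) (smooth K h s u' x) x := by
  have hc : Continuous u := continuous_iff_continuousAt.2 fun x => (hu x).continuousAt
  have h1 : ∀ i j, HasDerivAt (fun x => ∫ z, K z * u (x + s i j + h * z))
      (∫ z, K z * u' (x + s i j + h * z)) x := by
    intro i j
    refine (hasDerivAt_integral_of_dominated_loc_of_deriv_le (s := Set.univ)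
      (F := fun x z => K z * u (x + s i j + h * z)) (F' := fun x z => K z * u' (x + s i j + h * z))
      (bound := fun z => K z * M) univ_mem (Eventually.of_forall fun y => ?_) ?_ ?_
      (Eventually.of_forall fun z y _ => ?_) (hK.integrable.mul_const M)
      (Eventually.of_forall fun z y _ => ?_)).2
    · exact (hK.continuous.mul (hc.comp (by fun_prop))).aestronglyMeasurable
    · exact hK.integrable_mul_bdd (hc.comp (by fun_prop)) fun z => hb0 _
    · exact (hK.continuous.mul (hc'.comp (by fun_prop))).aestronglyMeasurable
    · rw [norm_mul, Real.norm_eq_abs, Real.norm_eq_abs, abs_of_nonneg (hK.nonneg z)]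
      exact mul_le_mul_of_nonneg_left (hb _) (hK.nonneg z)
    · have h2 : HasDerivAt (fun y => y + s i j + h * z) 1 y := by
        simpa [add_assoc] using (hasDerivAt_id y).add_const (s i j + h * z)
      have := ((hu (y + s i j + h * z)).comp y h2).const_mul (K z)
      rw [mul_one] at this
      exact this
  unfold smooth avg
  exact (HasDerivAt.fun_sum fun i _ => HasDerivAt.fun_sum fun j _ => h1 i j).div_const _

/-- Smoothing with a centred kernel and centred shifts is exact up to the second order. -/
lemma abs_smooth_sub_le (hK : IsKernel K B) (hmn : (m : ℝ) * n ≠ 0)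
    (hu : ∀ x, HasDerivAt u (u' x) x) {M₀ : ℝ} (hb0 : ∀ x, |u x| ≤ M₀) (hM : 0 ≤ M)
    (hL : ∀ x y, |u' x - u' y| ≤ M * |x - y|) (hs : avg s = 0) (x : ℝ) :
    |smooth K h s u x - u x| ≤ 2 * M * (avg (fun i j => s i j ^ 2) + h ^ 2 * B) := by
  have hc : Continuous u := continuous_iff_continuousAt.2 fun x => (hu x).continuousAt
  -- The linear term in `h * z` disappears because the kernel is centred. The linear term in the
  -- shift survives for each entry and disappears only after averaging, since `avg s = 0`.
  have hij : ∀ i j, |(∫ z, K z * u (x + s i j + h * z)) - u x - s i j * u' x|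
      ≤ 2 * M * (s i j ^ 2 + h ^ 2 * B) := by
    intro i j
    set σ := s i j
    have hi1 : Integrable fun z => K z * u (x + σ + h * z) :=
      hK.integrable_mul_bdd (hc.comp (by fun_prop)) fun z => hb0 _
    have hi2 := hK.integrable_mul_quadratic (u x + σ * u' x) (h * u' x) 0
    have e : ∫ z, K z * (u (x + σ + h * z) - u x - (σ + h * z) * u' x)
        = (∫ z, K z * u (x + σ + h * z)) - u x - σ * u' x := by
      have e1 : (fun z => K z * (u (x + σ + h * z) - u x - (σ + h * z) * u' x)) = fun z =>
          K z * u (x + σ + h * z) - K z * ((u x + σ * u' x) + (h * u' x) * z + 0 * z ^ 2) := by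
        ext z; ring
      rw [e1, integral_sub hi1 hi2, hK.integral_mul_quadratic]
      ring
    rw [← e]
    have hi3 := hK.integrable_mul_quadratic (2 * M * σ ^ 2) 0 (2 * M * h ^ 2)
    refine (hK.abs_integral_mul_le (ψ := fun z => 2 * M * σ ^ 2 + 0 * z + 2 * M * h ^ 2 * z ^ 2)
      hi3 fun z => ?_).trans ?_
    · have := abs_taylor_le hM hu hL x (σ + h * z)
      rw [← add_assoc] at this
      refine this.trans ?_
      nlinarith [mul_nonneg hM (sq_nonneg (σ - h * z))]
    · rw [hK.integral_mul_quadratic]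
      have := mul_le_mul_of_nonneg_left hK.second_moment_le
        (show 0 ≤ 2 * M * h ^ 2 by positivity)
      linarith
  have e : smooth K h s u x - u x =
      avg (fun i j => (∫ z, K z * u (x + s i j + h * z)) - u x - s i j * u' x) := by
    have e1 : (fun i j => (∫ z, K z * u (x + s i j + h * z)) - u x - s i j * u' x) =
        fun i j => 1 * (∫ z, K z * u (x + s i j + h * z)) + (-u' x) * s i j + (-u x) := by
      ext i j; ring
    rw [e1, avg_affine hmn 1 (-u' x) (-u x) (fun i j => ∫ z, K z * u (x + s i j + h * z)) s, hs,
      smooth]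
    ring
  rw [e]
  refine (abs_avg_le _).trans ((avg_mono hij).trans (le_of_eq ?_))
  have e2 : (fun i j => 2 * M * (s i j ^ 2 + h ^ 2 * B)) =
      fun i j => (2 * M) * s i j ^ 2 + 0 * s i j + 2 * M * h ^ 2 * B := by
    ext i j; ring
  rw [e2, avg_affine hmn (2 * M) 0 _ (fun i j => s i j ^ 2) s]
  ring

/-- Meant for `u = p'`, whose derivative carries no Lipschitz bound, so that a second order
expansion is unavailable. The displacement is bounded by `|y| ≤ θ + y²/θ`, which brings in only
second moments; `θ` is a free small parameter. -/
lemma abs_smooth_sub_le_of_lipschitz (hK : IsKernel K B) (hmn : (m : ℝ) * n ≠ 0)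
    (hb0 : ∀ x, |u x| ≤ M) (hL : ∀ x y, |u x - u y| ≤ M * |x - y|) {θ : ℝ} (hθ : 0 < θ) (x : ℝ) :
    |smooth K h s u x - u x| ≤ M * (θ + 2 * (avg (fun i j => s i j ^ 2) + h ^ 2 * B) / θ) := by
  have hM : 0 ≤ M := (abs_nonneg _).trans (hb0 0)
  have hc : Continuous u := by
    have : LipschitzWith M.toNNReal u := LipschitzWith.of_dist_le_mul fun x y => by
      rw [Real.dist_eq, Real.dist_eq, Real.coe_toNNReal _ hM]; exact hL x y
    exact this.continuous
  have hij : ∀ i j, |(∫ z, K z * u (x + s i j + h * z)) - u x|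
      ≤ M * (θ + 2 * (s i j ^ 2 + h ^ 2 * B) / θ) := by
    intro i j
    set σ := s i j
    have hi1 : Integrable fun z => K z * u (x + σ + h * z) :=
      hK.integrable_mul_bdd (hc.comp (by fun_prop)) fun z => hb0 _
    have e : ∫ z, K z * (u (x + σ + h * z) - u x) = (∫ z, K z * u (x + σ + h * z)) - u x := by
      have e1 : (fun z => K z * (u (x + σ + h * z) - u x)) = fun z =>
          K z * u (x + σ + h * z) - K z * u x := by ext z; ring
      rw [e1, integral_sub hi1 (hK.integrable.mul_const _), hK.integral_mul_const]
    rw [← e]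
    have hi3 := hK.integrable_mul_quadratic (M * θ + 2 * M * σ ^ 2 / θ) 0 (2 * M * h ^ 2 / θ)
    refine (hK.abs_integral_mul_le
      (ψ := fun z => M * θ + 2 * M * σ ^ 2 / θ + 0 * z + 2 * M * h ^ 2 / θ * z ^ 2)
      hi3 fun z => ?_).trans ?_
    · have h1 := hL (x + σ + h * z) x
      have h2 : |σ + h * z| ≤ θ + (σ + h * z) ^ 2 / θ := by
        rw [← sub_le_iff_le_add', le_div_iff₀ hθ, ← sq_abs (σ + h * z)]
        nlinarith [sq_nonneg (|σ + h * z| - θ), abs_nonneg (σ + h * z)]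
      have h3 : (σ + h * z) ^ 2 ≤ 2 * σ ^ 2 + 2 * (h ^ 2 * z ^ 2) := by
        nlinarith [sq_nonneg (σ - h * z)]
      have h4 : (σ + h * z) ^ 2 / θ ≤ (2 * σ ^ 2 + 2 * (h ^ 2 * z ^ 2)) / θ := by gcongr
      have e3 : x + σ + h * z - x = σ + h * z := by ring
      rw [e3] at h1
      calc |u (x + σ + h * z) - u x| ≤ M * |σ + h * z| := h1
        _ ≤ M * (θ + (2 * σ ^ 2 + 2 * (h ^ 2 * z ^ 2)) / θ) :=
            mul_le_mul_of_nonneg_left (h2.trans (by linarith)) hM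
        _ = _ := by ring
    · rw [hK.integral_mul_quadratic]
      have := mul_le_mul_of_nonneg_left hK.second_moment_le
        (show 0 ≤ 2 * M * h ^ 2 / θ by positivity)
      refine (add_le_add_right this _).trans (le_of_eq ?_)
      ring
  have e : smooth K h s u x - u x = avg (fun i j => (∫ z, K z * u (x + s i j + h * z)) - u x) := by
    have e1 : (fun i j => (∫ z, K z * u (x + s i j + h * z)) - u x) =
        fun i j => 1 * (∫ z, K z * u (x + s i j + h * z)) + 0 * s i j + (-u x) := by
      ext i j; ring
    rw [e1, avg_affine hmn 1 0 (-u x) (fun i j => ∫ z, K z * u (x + s i j + h * z)) s, smooth]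
    ring
  rw [e]
  refine (abs_avg_le _).trans ((avg_mono hij).trans (le_of_eq ?_))
  have e2 : (fun i j => M * (θ + 2 * (s i j ^ 2 + h ^ 2 * B) / θ)) =
      fun i j => (M * 2 / θ) * s i j ^ 2 + 0 * s i j + (M * θ + M * 2 * h ^ 2 * B / θ) := by
    ext i j; ring
  rw [e2, avg_affine hmn (M * 2 / θ) 0 _ (fun i j => s i j ^ 2) s]
  ring

end Smooth

/-! ### Expansion of the mean of a smooth function of a shifted noise variable -/

namespace IsNoiseDensity

variable {p : ℝ → ℝ} {M₁ M₂ : ℝ}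

/-- Integration by parts puts the derivative on `p`. In this form it is visibly Lipschitz in `s`,
although `β'` is only bounded, which gives a quadratic remainder in `abs_integral_shift_sub_le`. -/
lemma hasDerivAt_integral_shift (hp : IsNoiseDensity p M₁ M₂) {β β' : ℝ → ℝ} {C ℓ : ℝ}
    (hβ : ∀ x, HasDerivAt β (β' x) x) (hC : ∀ x, |β x| ≤ C) (hℓ : ∀ x, |β' x| ≤ ℓ) (s : ℝ) :
    HasDerivAt (fun s => ∫ x, β (x + s) * p x) (-∫ x, β (x + s) * deriv p x) s := by
  have hc : Continuous β := continuous_iff_continuousAt.2 fun x => (hβ x).continuousAt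
  have hm' : Measurable β' := by
    have : β' = deriv β := funext fun x => (hβ x).deriv.symm
    rw [this]; exact measurable_deriv β
  have hsh : ∀ s, Measurable fun x : ℝ => x + s := fun s => measurable_id.add_const s
  have h1 := (hasDerivAt_integral_of_dominated_loc_of_deriv_le (s := Set.univ) (x₀ := s)
    (μ := volume)
    (F := fun s x => β (x + s) * p x) (F' := fun s x => β' (x + s) * p x)
    (bound := fun x => ℓ * p x) univ_mem
    (Eventually.of_forall fun y =>
      (hp.integrable_bdd_mul (hc.measurable.comp (hsh y)) fun x => hC _).aestronglyMeasurable)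
    (hp.integrable_bdd_mul (hc.measurable.comp (hsh s)) fun x => hC _)
    (hp.integrable_bdd_mul (hm'.comp (hsh s)) fun x => hℓ _).aestronglyMeasurable
    (Eventually.of_forall fun x y _ => by
      rw [norm_mul, Real.norm_eq_abs, Real.norm_eq_abs, abs_of_nonneg (hp.nonneg x)]
      exact mul_le_mul_of_nonneg_right (hℓ _) (hp.nonneg x))
    (hp.integrable.const_mul ℓ)
    (Eventually.of_forall fun x y _ => by
      have h2 : HasDerivAt (fun y => x + y) 1 y := (hasDerivAt_id y).const_add x
      have := ((hβ (x + y)).comp y h2).mul_const (p x)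
      rw [mul_one] at this
      exact this)).2
  have h3 : ∫ x, β (x + s) * deriv p x = -∫ x, β' (x + s) * p x := by
    refine integral_mul_deriv_eq_deriv_mul_of_integrable (u := fun x => β (x + s))
      (u' := fun x => β' (x + s)) (fun x _ => ?_) (fun x _ => hp.hasDerivAt x)
      (hp.integrable_bdd_mul_deriv (hc.measurable.comp (hsh s)) fun x => hC _)
      (hp.integrable_bdd_mul (hm'.comp (hsh s)) fun x => hℓ _)
      (hp.integrable_bdd_mul (hc.measurable.comp (hsh s)) fun x => hC _)
    have h2 : HasDerivAt (fun y => y + s) 1 x := (hasDerivAt_id x).add_const s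
    have := (hβ (x + s)).comp x h2
    rw [mul_one] at this
    exact this
  rw [h3, neg_neg]
  exact h1

lemma abs_integral_mul_deriv_le (hp : IsNoiseDensity p M₁ M₂) {φ : ℝ → ℝ} {C : ℝ}
    (hb : ∀ x, |φ x| ≤ C) : |∫ x, φ x * deriv p x| ≤ C * ∫ x, |deriv p x| := by
  rw [← integral_const_mul]
  exact norm_integral_le_of_norm_le (f := fun x => φ x * deriv p x)
    (hp.integrable_deriv.abs.const_mul C) (Eventually.of_forall fun x => by
      rw [norm_mul]; exact mul_le_mul_of_nonneg_right (hb x) (abs_nonneg _))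

lemma abs_integral_shift_sub_le (hp : IsNoiseDensity p M₁ M₂) {β β' : ℝ → ℝ} {C ℓ : ℝ}
    (hβ : ∀ x, HasDerivAt β (β' x) x) (hC : ∀ x, |β x| ≤ C) (hℓ : ∀ x, |β' x| ≤ ℓ) (s : ℝ) :
    |(∫ x, β (x + s) * p x) - (∫ x, β x * p x) + s * ∫ x, β x * deriv p x| ≤
      ℓ * (∫ x, |deriv p x|) * s ^ 2 := by
  have hc : Continuous β := continuous_iff_continuousAt.2 fun x => (hβ x).continuousAt
  have hℓ0 : 0 ≤ ℓ := (abs_nonneg _).trans (hℓ 0)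
  have hsh : ∀ s, Measurable fun x : ℝ => x + s := fun s => measurable_id.add_const s
  have hA : 0 ≤ ∫ x, |deriv p x| := integral_nonneg fun _ => abs_nonneg _
  have := abs_taylor_le (M := ℓ * ∫ x, |deriv p x|) (by positivity)
    (hp.hasDerivAt_integral_shift hβ hC hℓ) (fun x y => by
      have h1 : ∀ s, Integrable fun z => β (z + s) * deriv p z := fun s =>
        hp.integrable_bdd_mul_deriv (hc.measurable.comp (hsh s)) fun x => hC _
      rw [neg_sub_neg, ← integral_sub (h1 y) (h1 x)]
      have h2 : (fun z => β (z + y) * deriv p z - β (z + x) * deriv p z) =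
          fun z => (β (z + y) - β (z + x)) * deriv p z := by ext z; ring
      rw [h2]
      refine (hp.abs_integral_mul_deriv_le (C := ℓ * |x - y|) fun z => ?_).trans (le_of_eq (by ring))
      have := abs_sub_le_of_hasDerivAt hβ hℓ (z + y) (z + x)
      rw [abs_sub_comm x y]
      simpa using this) 0 s
  simp only [zero_add, add_zero] at this
  convert this using 2
  ring

/-- The mean of the regularized score of smoothed densities is controlled by the smoothing bias. -/
lemma abs_integral_regRatio_mul_le (hp : IsNoiseDensity p M₁ M₂) {ε : ℝ} (hε : 0 < ε)
    {q₀ q₁ Q : ℝ → ℝ} {D : ℝ} (hq₀ : ∀ x, 0 ≤ q₀ x) (hq₁ : ∀ x, |q₁ x| ≤ M₂)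
    (hq₀m : Continuous q₀) (hq₁m : Continuous q₁)
    (hQ : ∀ x, HasDerivAt Q (q₁ x) x) (hD₀ : ∀ x, |q₀ x - p x| ≤ D) (hD : ∀ x, |Q x - p x| ≤ D) :
    |∫ x, regRatio ε q₁ q₀ x * p x| ≤ D * (M₂ / ε ^ 2 + (∫ x, |deriv p x|) / ε) := by
  have hpos : ∀ x, 0 < p x + ε := fun x => by linarith [hp.nonneg x]
  have hD0 : 0 ≤ D := (abs_nonneg _).trans (hD 0)
  have hQc : Continuous Q := continuous_iff_continuousAt.2 fun x => (hQ x).continuousAt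
  have hmes : ∀ {q₁ q₀ : ℝ → ℝ}, Continuous q₁ → Continuous q₀ → Measurable (regRatio ε q₁ q₀) :=
    fun h1 h0 => (h1.measurable.div (h0.measurable.add_const ε)).neg
  have i1 := hp.integrable_bdd_mul (hmes hq₁m hq₀m) fun x => abs_regRatio_le hε (hq₀ x) (hq₁ x)
  have i2 := hp.integrable_bdd_mul (hmes hq₁m hp.continuous)
    fun x => abs_regRatio_le hε (hp.nonneg x) (hq₁ x)
  have i3 := hp.integrable_bdd_mul (hmes hp.continuous_deriv hp.continuous)
    fun x => abs_regRatio_le hε (hp.nonneg x) (hp.abs_deriv_le x)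
  have e1 : |(∫ x, regRatio ε q₁ q₀ x * p x) - ∫ x, regRatio ε q₁ p x * p x| ≤ M₂ * D / ε ^ 2 := by
    rw [← integral_sub i1 i2]
    have : (fun x => regRatio ε q₁ q₀ x * p x - regRatio ε q₁ p x * p x) =
      fun x => (regRatio ε q₁ q₀ x - regRatio ε q₁ p x) * p x := by ext x; ring
    rw [this]
    refine hp.abs_integral_bdd_mul_le fun x => ?_
    refine (abs_regRatio_sub_le hε (hq₀ x) (hp.nonneg x)).trans ?_
    rw [sub_self, abs_zero, zero_div, zero_add]
    gcongr
    · exact hp.bound_nonneg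
    · exact hq₁ x
    · exact hD₀ x
  -- After replacing `q₀` by `p` and subtracting the vanishing mean of the exact score, `-∫ (q₁ -
  -- p') w` remains. Since `q₁ = Q'`, integration by parts turns it into `∫ (Q - p) w'` with `|w'| ≤
  -- |p'|/ε`: the error of `q₁` itself never enters, only that of its primitive.
  let w : ℝ → ℝ := fun x => p x / (p x + ε)
  let w' : ℝ → ℝ := fun x => ε * deriv p x / (p x + ε) ^ 2
  have hw : ∀ x, HasDerivAt w (w' x) x := fun x => by
    refine ((hp.hasDerivAt x).div ((hp.hasDerivAt x).add_const ε) (hpos x).ne').congr_deriv ?_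
    simp only [w']; ring
  have hwc : Continuous w := continuous_iff_continuousAt.2 fun x => (hw x).continuousAt
  have hwi : Integrable w := by
    refine (hp.integrable.div_const ε).mono' hwc.aestronglyMeasurable
      (Eventually.of_forall fun x => ?_)
    have := hp.nonneg x
    rw [Real.norm_eq_abs, abs_of_nonneg (by positivity)]
    simp only [w]; gcongr; linarith
  have hw'b : ∀ x, ‖w' x‖ ≤ |deriv p x| / ε := fun x => by
    have := hp.nonneg x
    simp only [w', Real.norm_eq_abs]
    rw [abs_div, abs_mul, abs_of_pos hε, abs_of_pos (a := (p x + ε) ^ 2) (by positivity),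
      div_le_div_iff₀ (by positivity) hε]
    nlinarith [mul_nonneg (abs_nonneg (deriv p x)) (show 0 ≤ (p x + ε) ^ 2 - ε ^ 2 by nlinarith)]
  have hw'm : AEStronglyMeasurable w' := by
    have : w' = deriv w := funext fun x => (hw x).deriv.symm
    rw [this]; exact (measurable_deriv w).aestronglyMeasurable
  have hw'i : Integrable w' :=
    (hp.integrable_deriv.abs.div_const ε).mono' hw'm (Eventually.of_forall hw'b)
  have hd1 : ∀ x, HasDerivAt (fun x => Q x - p x) (q₁ x - deriv p x) x :=
    fun x => (hQ x).sub (hp.hasDerivAt x)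
  have ibp : ∫ x, (Q x - p x) * w' x = -∫ x, (q₁ x - deriv p x) * w x := by
    refine integral_mul_deriv_eq_deriv_mul_of_integrable (fun x _ => hd1 x) (fun x _ => hw x)
      (hw'i.bdd_mul (hQc.sub hp.continuous).aestronglyMeasurable (Eventually.of_forall hD))
      (hwi.bdd_mul (hq₁m.sub hp.continuous_deriv).aestronglyMeasurable (c := M₂ + M₂)
        (Eventually.of_forall fun x => (abs_sub _ _).trans (add_le_add (hq₁ x) (hp.abs_deriv_le x))))
      (hwi.bdd_mul (hQc.sub hp.continuous).aestronglyMeasurable (Eventually.of_forall hD))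
  have e2 : ∫ x, regRatio ε q₁ p x * p x = ∫ x, (Q x - p x) * w' x := by
    rw [ibp, ← integral_neg, ← sub_zero (∫ x, regRatio ε q₁ p x * p x),
      ← hp.integral_score_mul hε, ← integral_sub i2 i3]
    congr 1; ext x
    simp only [regRatio, w]; ring
  have e3 : |∫ x, (Q x - p x) * w' x| ≤ D * ((∫ x, |deriv p x|) / ε) := by
    rw [← integral_div, ← integral_const_mul]
    refine norm_integral_le_of_norm_le (f := fun x => (Q x - p x) * w' x)
      ((hp.integrable_deriv.abs.div_const ε).const_mul D) (Eventually.of_forall fun x => ?_)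
    rw [norm_mul]
    exact mul_le_mul (hD x) (hw'b x) (norm_nonneg _) hD0
  rw [e2] at e1
  have := abs_sub_abs_le_abs_sub (∫ x, regRatio ε q₁ q₀ x * p x) (∫ x, (Q x - p x) * w' x)
  calc _ ≤ M₂ * D / ε ^ 2 + D * ((∫ x, |deriv p x|) / ε) := by linarith
    _ = _ := by ring

end IsNoiseDensity

/-! ### Exponential inequalities -/

section Chernoff

variable {Ω : Type*} [MeasurableSpace Ω] {P : Measure Ω}

lemma integrable_exp_mul_of_abs_le [IsFiniteMeasure P] {ξ : Ω → ℝ} (hm : AEMeasurable ξ P) {L : ℝ}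
    (hb : ∀ᵐ ω ∂P, |ξ ω| ≤ L) (r : ℝ) : Integrable (fun ω => Real.exp (r * ξ ω)) P := by
  refine Integrable.of_bound (C := Real.exp (|r| * L))
    (Real.measurable_exp.comp_aemeasurable (hm.const_mul r)).aestronglyMeasurable ?_
  filter_upwards [hb] with ω hω
  rw [Real.norm_eq_abs, Real.abs_exp]
  apply Real.exp_le_exp.2
  calc r * ξ ω ≤ |r * ξ ω| := le_abs_self _
    _ = |r| * |ξ ω| := abs_mul _ _
    _ ≤ |r| * L := by gcongr

lemma measureReal_sum_ge_le_of_mgf_le [IsProbabilityMeasure P] {ι : Type*} [Fintype ι]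
    {ξ : ι → Ω → ℝ} (hind : iIndepFun ξ P) (hm : ∀ i, AEMeasurable (ξ i) P) {L : ℝ}
    (hb : ∀ i, ∀ᵐ ω ∂P, |ξ i ω| ≤ L) {r a : ℝ} (hr : 0 ≤ r)
    (hmgf : ∀ i, ∫ ω, Real.exp (r * ξ i ω) ∂P ≤ Real.exp a) (t : ℝ) :
    P.real {ω | t ≤ ∑ i, ξ i ω} ≤ Real.exp (-(r * t) + Fintype.card ι * a) := by
  have hbs : ∀ᵐ ω ∂P, |(∑ i, ξ i) ω| ≤ ∑ _i : ι, L := by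
    filter_upwards [ae_all_iff.2 hb] with ω hω
    rw [Finset.sum_apply]
    exact (Finset.abs_sum_le_sum_abs _ _).trans (Finset.sum_le_sum fun i _ => hω i)
  have hms : AEMeasurable (∑ i, ξ i) P := Finset.aemeasurable_sum _ fun i _ => hm i
  have h1 := measure_ge_le_exp_mul_mgf t hr (integrable_exp_mul_of_abs_le hms hbs r)
  rw [hind.mgf_sum₀ hm] at h1
  have h2 : ∏ i, mgf (ξ i) P r ≤ Real.exp (Fintype.card ι * a) := by
    calc ∏ i, mgf (ξ i) P r ≤ ∏ _i : ι, Real.exp a :=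
          Finset.prod_le_prod (fun i _ => mgf_nonneg) fun i _ => hmgf i
      _ = Real.exp (Fintype.card ι * a) := by
          rw [Finset.prod_const, Finset.card_univ, ← Real.exp_nat_mul]
  simp only [Finset.sum_apply] at h1
  refine h1.trans ?_
  rw [Real.exp_add, neg_mul]
  gcongr

/-- Uses `e^y ≤ 1 + y + y²` for `|y| ≤ 1`, whence the constraint `r * L ≤ 1`. -/
lemma integral_exp_le_of_centered [IsProbabilityMeasure P] {ξ : Ω → ℝ} (hm : AEMeasurable ξ P)
    {L v r : ℝ} (hb : ∀ᵐ ω ∂P, |ξ ω| ≤ L) (h0 : ∫ ω, ξ ω ∂P = 0) (hv : ∫ ω, ξ ω ^ 2 ∂P ≤ v)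
    (hr : 0 ≤ r) (hrL : r * L ≤ 1) : ∫ ω, Real.exp (r * ξ ω) ∂P ≤ Real.exp (r ^ 2 * v) := by
  have i1 : Integrable ξ P := Integrable.of_bound hm.aestronglyMeasurable L hb
  have i2 : Integrable (fun ω => ξ ω ^ 2) P := by
    refine Integrable.of_bound (C := L ^ 2) (hm.pow_const 2).aestronglyMeasurable ?_
    filter_upwards [hb] with ω hω
    rw [norm_pow]
    exact pow_le_pow_left₀ (norm_nonneg _) hω 2
  have h1 : ∫ ω, Real.exp (r * ξ ω) ∂P ≤ ∫ ω, (1 + r * ξ ω + r ^ 2 * ξ ω ^ 2) ∂P := by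
    refine integral_mono_ae (integrable_exp_mul_of_abs_le hm hb r)
      (((integrable_const 1).add (i1.const_mul r)).add (i2.const_mul (r ^ 2))) ?_
    filter_upwards [hb] with ω hω
    have : |r * ξ ω| ≤ 1 := by
      rw [abs_mul, abs_of_nonneg hr]
      exact (mul_le_mul_of_nonneg_left hω hr).trans hrL
    have := (abs_le.1 (Real.abs_exp_sub_one_sub_id_le this)).2
    rw [mul_pow] at this
    linarith
  have h2 : ∫ ω, (1 + r * ξ ω + r ^ 2 * ξ ω ^ 2) ∂P = 1 + r ^ 2 * ∫ ω, ξ ω ^ 2 ∂P := by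
    have j1 : Integrable (fun ω => 1 + r * ξ ω) P := (integrable_const 1).add (i1.const_mul r)
    rw [integral_add j1 (i2.const_mul (r ^ 2)), integral_add (integrable_const 1) (i1.const_mul r),
      integral_const_mul, integral_const_mul, h0]
    simp
  rw [h2] at h1
  have h3 := Real.add_one_le_exp (r ^ 2 * v)
  nlinarith [mul_le_mul_of_nonneg_left hv (sq_nonneg r)]

/-- Bernstein's inequality. -/
lemma measureReal_sum_ge_le_of_centered [IsProbabilityMeasure P] {ι : Type*} [Fintype ι]
    {ξ : ι → Ω → ℝ} (hind : iIndepFun ξ P) (hm : ∀ i, AEMeasurable (ξ i) P) {L v r : ℝ}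
    (hb : ∀ i, ∀ᵐ ω ∂P, |ξ i ω| ≤ L) (h0 : ∀ i, ∫ ω, ξ i ω ∂P = 0)
    (hv : ∀ i, ∫ ω, ξ i ω ^ 2 ∂P ≤ v) (hr : 0 ≤ r) (hrL : r * L ≤ 1) (t : ℝ) :
    P.real {ω | t ≤ ∑ i, ξ i ω} ≤ Real.exp (-(r * t) + Fintype.card ι * (r ^ 2 * v)) :=
  measureReal_sum_ge_le_of_mgf_le hind hm hb hr
    (fun i => integral_exp_le_of_centered (hm i) (hb i) (h0 i) (hv i) hr hrL) t

end Chernoff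

/-! ### Kernel sums -/

/-- Bounded, Lipschitz and square integrable functions. -/
structure IsRegularKernel (k : ℝ → ℝ) (B : ℝ) : Prop where
  bound_pos : 0 < B
  abs_le : ∀ z, |k z| ≤ B
  lipschitz : ∀ x y, |k x - k y| ≤ B * |x - y|
  sq_integrable : Integrable fun z => k z ^ 2
  integral_sq_le : ∫ z, k z ^ 2 ≤ B

namespace IsRegularKernel

variable {k : ℝ → ℝ} {B : ℝ}

lemma continuous (hk : IsRegularKernel k B) : Continuous k := by
  have : LipschitzWith B.toNNReal k := LipschitzWith.of_dist_le_mul fun x y => by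
    rw [Real.dist_eq, Real.dist_eq, Real.coe_toNNReal _ hk.bound_pos.le]; exact hk.lipschitz x y
  exact this.continuous

lemma neg (hk : IsRegularKernel k B) : IsRegularKernel (fun z => -k z) B where
  bound_pos := hk.bound_pos
  abs_le z := by rw [abs_neg]; exact hk.abs_le z
  lipschitz x y := by rw [neg_sub_neg, abs_sub_comm]; exact hk.lipschitz x y
  sq_integrable := by simpa using hk.sq_integrable
  integral_sq_le := by simpa using hk.integral_sq_le

end IsRegularKernel

lemma IsKernel.bound_pos {K : ℝ → ℝ} {B : ℝ} (hK : IsKernel K B) : 0 < B := by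
  refine lt_of_le_of_ne hK.bound_nonneg fun h => ?_
  have h1 : K = fun _ => 0 := funext fun x => by
    have := hK.abs_le x
    rw [← h] at this
    exact abs_nonpos_iff.1 this
  have := hK.integral_eq_one
  rw [h1] at this
  simp at this

lemma IsKernel.isRegularKernel {K : ℝ → ℝ} {B : ℝ} (hK : IsKernel K B) : IsRegularKernel K B where
  bound_pos := hK.bound_pos
  abs_le := hK.abs_le
  lipschitz := hK.abs_sub_le
  sq_integrable := by simpa using hK.deriv_sq_integrable 0 (by norm_num)
  integral_sq_le := by simpa using hK.deriv_sq_integral_le 0 (by norm_num)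

lemma IsKernel.isRegularKernel_deriv {K : ℝ → ℝ} {B : ℝ} (hK : IsKernel K B) :
    IsRegularKernel (deriv K) B where
  bound_pos := hK.bound_pos
  abs_le := hK.abs_deriv_le
  lipschitz := hK.abs_deriv_sub_le
  sq_integrable := by simpa using hK.deriv_sq_integrable 1 (by norm_num)
  integral_sq_le := by simpa using hK.deriv_sq_integral_le 1 (by norm_num)

section KernelSum

variable {m n : ℕ}

/-- The kernel sum at `x` of the entries of `Y`. -/
noncomputable def kernelSum (k : ℝ → ℝ) (h : ℝ) (Y : Matrix (Fin m) (Fin n) ℝ) (x : ℝ) : ℝ :=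
  ∑ i, ∑ j, k ((Y i j - x) / h)

/-- The mean of the kernel sum at `x` of the entries of `X + W`, for `W` with entries of density
`p`. -/
noncomputable def kernelMean (k : ℝ → ℝ) (h : ℝ) (X : Matrix (Fin m) (Fin n) ℝ) (p : ℝ → ℝ) (x : ℝ) : ℝ :=
  ∑ i, ∑ j, ∫ w, k ((X i j + w - x) / h) * p w

variable {k p : ℝ → ℝ} {B M₁ M₂ h : ℝ} {X : Matrix (Fin m) (Fin n) ℝ}

lemma abs_kernelSum_sub_le (hk : IsRegularKernel k B) (hh : 0 < h) (Y : Matrix (Fin m) (Fin n) ℝ)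
    (x y : ℝ) : |kernelSum k h Y x - kernelSum k h Y y| ≤ (m : ℝ) * n * (B * |x - y| / h) := by
  simp only [kernelSum, ← Finset.sum_sub_distrib]
  refine (Finset.abs_sum_le_sum_abs _ _).trans ?_
  calc _ ≤ ∑ _i : Fin m, ∑ _j : Fin n, B * |x - y| / h := by
        refine Finset.sum_le_sum fun i _ => (Finset.abs_sum_le_sum_abs _ _).trans
          (Finset.sum_le_sum fun j _ => (hk.lipschitz _ _).trans (le_of_eq ?_))
        rw [← sub_div, sub_sub_sub_cancel_left, abs_div, abs_of_pos hh, abs_sub_comm]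
        ring
    _ = _ := by simp; ring

lemma abs_kernelMean_sub_le (hp : IsNoiseDensity p M₁ M₂) (hk : IsRegularKernel k B) (hh : 0 < h)
    (x y : ℝ) : |kernelMean k h X p x - kernelMean k h X p y| ≤ (m : ℝ) * n * (B * |x - y| / h) := by
  simp only [kernelMean, ← Finset.sum_sub_distrib]
  refine (Finset.abs_sum_le_sum_abs _ _).trans ?_
  have hi : ∀ i j x, Integrable fun w => k ((X i j + w - x) / h) * p w := fun i j x =>
    hp.integrable_bdd_mul (hk.continuous.comp (by fun_prop)).measurable fun _ => hk.abs_le _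
  calc _ ≤ ∑ _i : Fin m, ∑ _j : Fin n, B * |x - y| / h := by
        refine Finset.sum_le_sum fun i _ => (Finset.abs_sum_le_sum_abs _ _).trans
          (Finset.sum_le_sum fun j _ => ?_)
        rw [← integral_sub (hi i j x) (hi i j y)]
        simp only [← sub_mul]
        refine hp.abs_integral_bdd_mul_le fun w => (hk.lipschitz _ _).trans (le_of_eq ?_)
        rw [← sub_div, sub_sub_sub_cancel_left, abs_div, abs_of_pos hh, abs_sub_comm]
        ring
    _ = _ := by simp; ring

variable {Ω : Type*} [MeasurableSpace Ω] {P : Measure Ω} {W : Ω → Matrix (Fin m) (Fin n) ℝ}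

/-- The substitution `z = (c + w)/h` produces the factor `h`; this gain over the trivial bound `B²`
is what makes Bernstein, rather than Hoeffding, sufficient for the deviations. -/
lemma integral_sq_kernel_le (hp : IsNoiseDensity p M₁ M₂) (hk : IsRegularKernel k B) (hh : 0 < h)
    (c : ℝ) : ∫ w, k ((c + w) / h) ^ 2 * p w ≤ M₂ * B * h := by
  have e1 : ∫ w, k ((c + w) / h) ^ 2 = h * ∫ z, k z ^ 2 := by
    rw [integral_add_left_eq_self (fun w => k (w / h) ^ 2) c,
      Measure.integral_comp_div (fun z => k z ^ 2) h, abs_of_pos hh, smul_eq_mul]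
  have i1 : Integrable fun w => k ((c + w) / h) ^ 2 := by
    have := (hk.sq_integrable.comp_div hh.ne').comp_add_left c
    exact this
  calc ∫ w, k ((c + w) / h) ^ 2 * p w ≤ ∫ w, k ((c + w) / h) ^ 2 * M₂ := by
        refine integral_mono_of_nonneg
          (Eventually.of_forall fun w => mul_nonneg (sq_nonneg _) (hp.nonneg w)) (i1.mul_const _)
          (Eventually.of_forall fun w => ?_)
        exact mul_le_mul_of_nonneg_left ((le_abs_self _).trans (hp.abs_le w)) (sq_nonneg _)
    _ = M₂ * h * ∫ z, k z ^ 2 := by rw [integral_mul_const, e1]; ring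
    _ ≤ M₂ * h * B := by
        have := hp.bound_nonneg
        gcongr
        exact hk.integral_sq_le
    _ = _ := by ring

lemma measureReal_kernelSum_sub_ge_le [IsProbabilityMeasure P] (hp : IsNoiseDensity p M₁ M₂)
    (hk : IsRegularKernel k B) (hh : 0 < h) (hW : HasIIDEntries P W (noiseLaw p)) {r : ℝ}
    (hr : 0 ≤ r) (hrB : r * (2 * B) ≤ 1) (x t : ℝ) :
    P.real {ω | t ≤ kernelSum k h (X + W ω) x - kernelMean k h X p x} ≤
      Real.exp (-(r * t) + (m : ℝ) * n * (r ^ 2 * (M₂ * B * h))) := by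
  let φ : Fin m × Fin n → ℝ → ℝ := fun ij w =>
    k ((X ij.1 ij.2 + w - x) / h) - ∫ w, k ((X ij.1 ij.2 + w - x) / h) * p w
  have hφc : ∀ ij : Fin m × Fin n, Measurable fun w => k ((X ij.1 ij.2 + w - x) / h) := fun ij =>
    (hk.continuous.comp (by fun_prop)).measurable
  have hφm : ∀ ij, Measurable (φ ij) := fun ij => (hφc ij).sub_const _
  have hi : ∀ ij : Fin m × Fin n, Integrable fun w => k ((X ij.1 ij.2 + w - x) / h) * p w := fun ij =>
    hp.integrable_bdd_mul (hφc ij) fun _ => hk.abs_le _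
  have hφb : ∀ ij w, |φ ij w| ≤ 2 * B := fun ij w => by
    refine (abs_sub _ _).trans ?_
    have h1 := hk.abs_le ((X ij.1 ij.2 + w - x) / h)
    have h2 := hp.abs_integral_bdd_mul_le fun w => hk.abs_le ((X ij.1 ij.2 + w - x) / h)
    linarith
  have hsplit : ∀ ij : Fin m × Fin n, (fun w => φ ij w * p w) = fun w => k ((X ij.1 ij.2 + w - x) / h) * p w -
      (∫ w, k ((X ij.1 ij.2 + w - x) / h) * p w) * p w := fun ij => by
    ext w; simp only [φ]; ring
  have h0 : ∀ ij, ∫ ω, φ ij (W ω ij.1 ij.2) ∂P = 0 := fun ij => by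
    rw [hp.integral_comp_of_hasLaw (hW.2 ij.1 ij.2) (hφm ij), hsplit,
      integral_sub (hi ij) (hp.integrable.const_mul _), integral_const_mul, hp.integral_eq_one]
    ring
  have hv : ∀ ij, ∫ ω, φ ij (W ω ij.1 ij.2) ^ 2 ∂P ≤ M₂ * B * h := fun ij => by
    rw [hp.integral_comp_of_hasLaw (hW.2 ij.1 ij.2) ((hφm ij).pow_const 2)]
    have h1 := integral_sq_kernel_le hp hk hh (X ij.1 ij.2 - x)
    refine le_trans ?_ h1
    set a := ∫ w, k ((X ij.1 ij.2 + w - x) / h) * p w with ha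
    have e : (fun w => φ ij w ^ 2 * p w) = fun w => (k ((X ij.1 ij.2 - x + w) / h) ^ 2 * p w
        - 2 * a * (k ((X ij.1 ij.2 + w - x) / h) * p w)) + a ^ 2 * p w := by
      ext w
      simp only [φ, ← ha]
      rw [show X ij.1 ij.2 - x + w = X ij.1 ij.2 + w - x by ring]
      ring
    have i2 : Integrable fun w => k ((X ij.1 ij.2 - x + w) / h) ^ 2 * p w :=
      hp.integrable_bdd_mul (C := B ^ 2) ((hk.continuous.comp (by fun_prop)).measurable.pow_const 2)
        fun w => by
          rw [abs_pow]; exact pow_le_pow_left₀ (abs_nonneg _) (hk.abs_le _) 2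
    have i3 : Integrable fun w => k ((X ij.1 ij.2 - x + w) / h) ^ 2 * p w
        - 2 * a * (k ((X ij.1 ij.2 + w - x) / h) * p w) := i2.sub ((hi ij).const_mul _)
    rw [e, integral_add i3 (hp.integrable.const_mul _), integral_sub i2 ((hi ij).const_mul _),
      integral_const_mul, integral_const_mul, hp.integral_eq_one, ← ha]
    nlinarith [sq_nonneg a]
  have hind : iIndepFun (fun ij ω => φ ij (W ω ij.1 ij.2)) P := hW.1.comp φ hφm
  have := measureReal_sum_ge_le_of_centered hind
    (fun ij => (hφm ij).comp_aemeasurable (hW.2 ij.1 ij.2).aemeasurable)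
    (fun ij => Eventually.of_forall fun ω => hφb ij _) h0 hv hr hrB t
  rw [Fintype.card_prod, Fintype.card_fin, Fintype.card_fin] at this
  push_cast at this
  convert this using 5 with ω
  rw [Fintype.sum_prod_type, kernelSum, kernelMean]
  simp only [φ, Finset.sum_sub_distrib, Matrix.add_apply]

lemma measureReal_abs_kernelSum_sub_ge_le [IsProbabilityMeasure P] (hp : IsNoiseDensity p M₁ M₂)
    (hk : IsRegularKernel k B) (hh : 0 < h) (hW : HasIIDEntries P W (noiseLaw p)) {r : ℝ}
    (hr : 0 ≤ r) (hrB : r * (2 * B) ≤ 1) (x t : ℝ) :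
    P.real {ω | t ≤ |kernelSum k h (X + W ω) x - kernelMean k h X p x|} ≤
      2 * Real.exp (-(r * t) + (m : ℝ) * n * (r ^ 2 * (M₂ * B * h))) := by
  have h1 := measureReal_kernelSum_sub_ge_le (X := X) hp hk hh hW hr hrB x t
  have h2 := measureReal_kernelSum_sub_ge_le (X := X) hp hk.neg hh hW hr hrB x t
  have hsub : {ω | t ≤ |kernelSum k h (X + W ω) x - kernelMean k h X p x|} ⊆
      {ω | t ≤ kernelSum k h (X + W ω) x - kernelMean k h X p x} ∪
      {ω | t ≤ kernelSum (fun z => -k z) h (X + W ω) x - kernelMean (fun z => -k z) h X p x} := by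
    intro ω hω
    have e1 : kernelSum (fun z => -k z) h (X + W ω) x = -kernelSum k h (X + W ω) x := by
      simp [kernelSum]
    have e2 : kernelMean (fun z => -k z) h X p x = -kernelMean k h X p x := by
      simp [kernelMean, integral_neg]
    simp only [Set.mem_union, Set.mem_ofPred_eq] at hω ⊢
    rw [e1, e2, neg_sub_neg, ← neg_sub (kernelSum k h (X + W ω) x)]
    exact le_abs.1 hω
  refine (measureReal_mono hsub (measure_ne_top P _)).trans
    ((measureReal_union_le _ _).trans ?_)
  linarith

/-- Uniform deviations of the kernel sums over a bounded interval. -/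
lemma measureReal_exists_kernelSum_gt_le [IsProbabilityMeasure P] (hp : IsNoiseDensity p M₁ M₂)
    (hk : IsRegularKernel k B) (hh : 0 < h) (hW : HasIIDEntries P W (noiseLaw p)) {r R t ϑ : ℝ}
    (hr : 0 ≤ r) (hrB : r * (2 * B) ≤ 1) (hR : 0 ≤ R) (hϑ : 0 < ϑ)
    (hϑt : (m : ℝ) * n * (B * ϑ / h) ≤ t / 4) :
    P.real {ω | ∃ x, |x| ≤ R ∧ t < |kernelSum k h (X + W ω) x - kernelMean k h X p x|} ≤
      (2 * (R / ϑ) + 5) * (2 * Real.exp (-(r * (t / 2)) + (m : ℝ) * n * (r ^ 2 * (M₂ * B * h)))) := by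
  -- Grid of mesh `ϑ` covering the interval. The sum and its mean each move by at most `t/4` from a
  -- point to the grid point below it, so a deviation above `t` leaves one of at least `t/2` on the
  -- grid.
  set G : Finset ℤ := Finset.Icc (-(⌊R / ϑ⌋ + 1)) (⌊R / ϑ⌋ + 1) with hG
  have hRϑ : 0 ≤ R / ϑ := by positivity
  have hsub : {ω | ∃ x, |x| ≤ R ∧ t < |kernelSum k h (X + W ω) x - kernelMean k h X p x|} ⊆
      ⋃ g ∈ G, {ω | t / 2 ≤ |kernelSum k h (X + W ω) (g * ϑ) - kernelMean k h X p (g * ϑ)|} := by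
    rintro ω ⟨x, hx, hxt⟩
    have hxϑ : |x / ϑ| ≤ R / ϑ := by rw [abs_div, abs_of_pos hϑ]; gcongr
    obtain ⟨hx1, hx2⟩ := abs_le.1 hxϑ
    have hg : ⌊x / ϑ⌋ ∈ G := by
      rw [hG, Finset.mem_Icc]
      constructor
      · rw [Int.le_floor]
        push_cast
        linarith [Int.lt_floor_add_one (R / ϑ)]
      · exact (Int.floor_le_floor hx2).trans (by omega)
    simp only [Set.mem_iUnion, Set.mem_ofPred_eq]
    refine ⟨⌊x / ϑ⌋, hg, ?_⟩
    have hd : |x - ⌊x / ϑ⌋ * ϑ| ≤ ϑ := by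
      have h1 := Int.floor_le (x / ϑ)
      have h2 := Int.lt_floor_add_one (x / ϑ)
      rw [le_div_iff₀ hϑ] at h1
      rw [div_lt_iff₀ hϑ] at h2
      rw [abs_le]; constructor <;> linarith
    have hle : (m : ℝ) * n * (B * |x - ⌊x / ϑ⌋ * ϑ| / h) ≤ t / 4 := by
      refine le_trans ?_ hϑt
      have := hk.bound_pos
      gcongr
    have h1 := (abs_kernelSum_sub_le hk hh (X + W ω) x (⌊x / ϑ⌋ * ϑ)).trans hle
    have h2 := (abs_kernelMean_sub_le (X := X) hp hk hh x (⌊x / ϑ⌋ * ϑ)).trans hle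
    set a := kernelSum k h (X + W ω) x
    set b := kernelMean k h X p x
    set a' := kernelSum k h (X + W ω) (⌊x / ϑ⌋ * ϑ)
    set b' := kernelMean k h X p (⌊x / ϑ⌋ * ϑ)
    have h3 : |a - b| ≤ |a - a'| + |a' - b'| + |b' - b| := by
      have := abs_add_three (a - a') (a' - b') (b' - b)
      refine le_trans (le_of_eq ?_) this
      congr 1; ring
    rw [abs_sub_comm b' b] at h3
    linarith
  refine (measureReal_mono hsub (measure_ne_top P _)).trans
    ((measureReal_biUnion_le _ _ fun g _ =>
      measureReal_abs_kernelSum_sub_ge_le hp hk hh hW hr hrB _ _).trans ?_)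
  rw [Finset.sum_const, nsmul_eq_mul]
  refine mul_le_mul_of_nonneg_right ?_ (by positivity)
  rw [hG, Int.card_Icc]
  have h0 : 0 ≤ ⌊R / ϑ⌋ := Int.floor_nonneg.2 hRϑ
  have h1 : ((⌊R / ϑ⌋ + 1 + 1 - -(⌊R / ϑ⌋ + 1)).toNat : ℤ) = 2 * ⌊R / ϑ⌋ + 3 := by
    rw [Int.toNat_of_nonneg (by omega)]; ring
  have h2 : (((⌊R / ϑ⌋ + 1 + 1 - -(⌊R / ϑ⌋ + 1)).toNat : ℤ) : ℝ) = 2 * ⌊R / ϑ⌋ + 3 := by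
    rw [h1]; push_cast; ring
  rw [Int.cast_natCast] at h2
  rw [h2]
  linarith [Int.floor_le (R / ϑ)]

end KernelSum

/-! ### Negligible sequences of events -/

/-- The probabilities of the events decay faster than every power of `n`. -/
def Negligible {Ω : Type*} [MeasurableSpace Ω] (P : Measure Ω) (E : ℕ → Set Ω) : Prop :=
  ∀ k : ℕ, Tendsto (fun n : ℕ => (n : ℝ) ^ k * P.real (E n)) atTop (𝓝 0)

/-- The numbers `m n` are eventually between `a * n` and `b * n`. -/
structure Proportional (m : ℕ → ℕ) (a b : ℝ) : Prop where
  pos : 0 < a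
  eventually_le : ∀ᶠ n : ℕ in atTop, a * n ≤ m n ∧ (m n : ℝ) ≤ b * n

section Negligible

variable {Ω : Type*} [MeasurableSpace Ω] {P : Measure Ω}

lemma tendsto_rpow_mul_exp_neg_rpow (A : ℝ) {c θ : ℝ} (hc : 0 < c) (hθ : 0 < θ) :
    Tendsto (fun n : ℕ => (n : ℝ) ^ A * Real.exp (-(c * (n : ℝ) ^ θ))) atTop (𝓝 0) := by
  have h1 := (tendsto_rpow_mul_exp_neg_mul_atTop_nhds_zero (A / θ) c hc).comp
    ((tendsto_rpow_atTop hθ).comp tendsto_natCast_atTop_atTop)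
  refine h1.congr fun n => ?_
  simp only [Function.comp, neg_mul]
  rw [← Real.rpow_mul (Nat.cast_nonneg n), mul_div_cancel₀ _ hθ.ne']

lemma tendsto_natCast_rpow_neg {θ : ℝ} (hθ : 0 < θ) :
    Tendsto (fun n : ℕ => (n : ℝ) ^ (-θ)) atTop (𝓝 0) :=
  (tendsto_rpow_neg_atTop hθ).comp tendsto_natCast_atTop_atTop

lemma Negligible.of_le {E : ℕ → Set Ω} {f : ℕ → ℝ} (h : ∀ᶠ n in atTop, P.real (E n) ≤ f n)
    (hf : ∀ k : ℕ, Tendsto (fun n : ℕ => (n : ℝ) ^ k * f n) atTop (𝓝 0)) : Negligible P E :=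
  fun k => squeeze_zero' (Eventually.of_forall fun n => by positivity)
    (h.mono fun n hn => by gcongr) (hf k)

lemma Negligible.mono [IsFiniteMeasure P] {E F : ℕ → Set Ω} (hF : Negligible P F)
    (h : ∀ᶠ n in atTop, E n ⊆ F n) : Negligible P E :=
  Negligible.of_le (h.mono fun _ hn => measureReal_mono hn) hF

lemma Negligible.union {E F : ℕ → Set Ω} (hE : Negligible P E) (hF : Negligible P F) :
    Negligible P fun n => E n ∪ F n :=
  Negligible.of_le (f := fun n => P.real (E n) + P.real (F n))
    (Eventually.of_forall fun n => measureReal_union_le _ _) fun k => by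
      simpa [mul_add] using (hE k).add (hF k)

/-- The convergence half of Borel-Cantelli, which tolerates arbitrary dependence between different
`n`. -/
lemma ae_eventually_notMem_of_summable [IsFiniteMeasure P] {E : ℕ → Set Ω} {f : ℕ → ℝ}
    (hf : Summable f) (h : ∀ᶠ n in atTop, P.real (E n) ≤ f n) :
    ∀ᵐ ω ∂P, ∀ᶠ n in atTop, ω ∉ E n := by
  refine ae_eventually_notMem ?_
  have h1 : Summable fun n => P.real (E n) :=
    summable_of_isBigO_nat hf (Asymptotics.IsBigO.of_bound 1 (h.mono fun n hn => by
      rw [Real.norm_eq_abs, abs_of_nonneg measureReal_nonneg, one_mul]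
      exact hn.trans (le_abs_self _)))
  have h2 : ∀ n, P (E n) = ENNReal.ofReal (P.real (E n)) := fun n =>
    (ENNReal.ofReal_toReal (measure_ne_top P _)).symm
  simp_rw [h2]
  exact h1.tsum_ofReal_ne_top

lemma Negligible.ae_eventually [IsFiniteMeasure P] {E : ℕ → Set Ω} (hE : Negligible P E) :
    ∀ᵐ ω ∂P, ∀ᶠ n in atTop, ω ∉ E n := by
  refine ae_eventually_notMem_of_summable (f := fun n => 1 / (n : ℝ) ^ 2)
    (Real.summable_one_div_nat_pow.2 (by norm_num)) ?_
  filter_upwards [(hE 2).eventually_le_const (show (0 : ℝ) < 1 by norm_num), eventually_gt_atTop 0]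
    with n hn hn0
  have : (0 : ℝ) < n := by exact_mod_cast hn0
  rw [le_div_iff₀ (by positivity)]
  linarith

variable {m : ℕ → ℕ} {a b : ℝ}
  {A : ∀ n : ℕ, Ω → Matrix (Fin (m n)) (Fin n) ℝ} {c : ∀ n : ℕ, Fin (m n) → Fin n → ℝ}

lemma negligible_opNorm [IsProbabilityMeasure P] {R : ℝ} (hR : 0 < R) (hA : ∀ n, IsCenteredBounded P (A n) (c n))
    (hc : ∀ᶠ n in atTop, ∀ i j, |c n i j| ≤ R) :
    Negligible P fun n => {ω | 12 * R * Real.sqrt ((m n : ℝ) + n) < opNorm (A n ω)} := by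
  refine Negligible.of_le (f := fun n => Real.exp (-(n : ℝ))) ?_ fun k => ?_
  · filter_upwards [hc] with n hn
    refine ((hA n).measureReal_opNorm_gt_le hR hn).trans (Real.exp_le_exp.2 ?_)
    have : (0 : ℝ) ≤ m n := Nat.cast_nonneg _
    linarith
  · have := tendsto_rpow_mul_exp_neg_rpow k one_pos one_pos
    simpa using this

lemma negligible_opNorm_of_rows [IsProbabilityMeasure P] (hm : Proportional m a b) {D η : ℝ} (hD : 0 < D) (hη : 0 < η)
    (hA : ∀ n, IsCenteredBounded P (A n) (c n))
    (hrow : ∀ᶠ n : ℕ in atTop, ∀ i, ∑ j, c n i j ^ 2 ≤ (D * (n : ℝ) ^ (1 / 2 - η)) ^ 2)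
    (hcol : ∀ᶠ n : ℕ in atTop, ∀ j, ∑ i, c n i j ^ 2 ≤ (D * (n : ℝ) ^ (1 / 2 - η)) ^ 2)
    {δ : ℝ} (hδ : 0 < δ) :
    Negligible P fun n => {ω | δ * Real.sqrt n < opNorm (A n ω)} := by
  intro k
  -- The parameters make `q = n^{-s}`, so that the failure probability is of order `n^{2-2s}` and
  -- beats `n^k`. With `L` of order `n^{η/4}` and `√(log n) ≤ n^{η/4}`, the norm bound `3 κ L²` is
  -- of order `n^{1/2 - η/4}`.
  set s : ℝ := k + 3 with hs
  have hs0 : 0 < s := by positivity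
  set κ : ℕ → ℝ := fun n => D * (n : ℝ) ^ (1 / 2 - η) * Real.sqrt (4 * s * Real.log n) with hκ
  set L : ℕ → ℕ := fun n => ⌈(n : ℝ) ^ (η / 4)⌉₊ with hL
  have hb0 : ∀ᶠ n : ℕ in atTop, (n : ℝ) ≥ 1 := by
    filter_upwards [eventually_ge_atTop 1] with n hn
    exact_mod_cast hn
  have hpow : ∀ C : ℝ, ∀ᶠ n : ℕ in atTop, 8 * Real.sqrt (C * n) ≤ 2 ^ L n := by
    intro C
    have h1 := tendsto_rpow_mul_exp_neg_rpow 1 (c := Real.log 2)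
      (Real.log_pos (by norm_num)) (show 0 < η / 4 by positivity)
    have h2 : ∀ᶠ n : ℕ in atTop, (n : ℝ) ^ (1 : ℝ) * Real.exp (-(Real.log 2 * (n : ℝ) ^ (η / 4)))
        ≤ 1 / (8 * (|C| + 1)) := h1.eventually_le_const (by positivity)
    filter_upwards [h2, hb0] with n hn hn1
    have e2 : (2 : ℝ) ^ L n ≥ Real.exp (Real.log 2 * (n : ℝ) ^ (η / 4)) := by
      rw [← Real.rpow_natCast, Real.rpow_def_of_pos (by norm_num)]
      apply Real.exp_le_exp.2
      have := Real.log_nonneg (show (1 : ℝ) ≤ 2 by norm_num)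
      gcongr
      exact Nat.le_ceil _
    rw [Real.rpow_one, Real.exp_neg, ← div_eq_mul_inv, div_le_div_iff₀ (by positivity)
      (by positivity), one_mul] at hn
    have e3 : Real.sqrt (C * n) ≤ (|C| + 1) * n := by
      rw [Real.sqrt_le_left (by positivity)]
      have h3 : C * n ≤ (|C| + 1) * n := by
        gcongr
        linarith [le_abs_self C]
      have h4 : 1 ≤ (|C| + 1) * n := by nlinarith [abs_nonneg C]
      nlinarith
    calc 8 * Real.sqrt (C * n) ≤ 8 * ((|C| + 1) * n) := by gcongr
      _ = n * (8 * (|C| + 1)) := by ring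
      _ ≤ _ := hn.trans e2
  have hsmall : ∀ᶠ n : ℕ in atTop, 3 * κ n * (L n : ℝ) ^ 2 ≤ δ * Real.sqrt n := by
    have hlog : ∀ᶠ n : ℕ in atTop, Real.log n ≤ (n : ℝ) ^ (η / 2) := by
      have := ((isLittleO_log_rpow_atTop (show 0 < η / 2 by positivity)).comp_tendsto
        tendsto_natCast_atTop_atTop).bound (show (0 : ℝ) < 1 by norm_num)
      filter_upwards [this] with n hn
      simp only [Function.comp, one_mul] at hn
      rw [Real.norm_of_nonneg (by positivity)] at hn
      exact hn.trans (le_of_eq (Real.norm_of_nonneg (by positivity)))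
    have hlim := ((tendsto_natCast_rpow_neg (show 0 < η / 4 by positivity)).const_mul
      (3 * D * Real.sqrt (4 * s) * 4)).eventually_le_const (u := δ) (by simpa using hδ)
    filter_upwards [hlog, hlim, hb0] with n h1 h2 hn1
    have hn0 : (0 : ℝ) < n := by linarith
    have e1 : Real.sqrt (4 * s * Real.log n) ≤ Real.sqrt (4 * s) * (n : ℝ) ^ (η / 4) := by
      rw [Real.sqrt_mul (by positivity)]
      gcongr
      rw [Real.sqrt_le_left (by positivity), ← Real.rpow_natCast, ← Real.rpow_mul hn0.le]
      convert h1 using 2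
      push_cast; ring
    have e2 : (L n : ℝ) ^ 2 ≤ 4 * (n : ℝ) ^ (η / 2) := by
      have h3 : (L n : ℝ) ≤ 2 * (n : ℝ) ^ (η / 4) := by
        have h4 := Nat.ceil_lt_add_one (show 0 ≤ (n : ℝ) ^ (η / 4) by positivity)
        have h5 : 1 ≤ (n : ℝ) ^ (η / 4) := Real.one_le_rpow hn1 (by positivity)
        linarith
      calc (L n : ℝ) ^ 2 ≤ (2 * (n : ℝ) ^ (η / 4)) ^ 2 := by gcongr
        _ = 4 * ((n : ℝ) ^ (η / 4) * (n : ℝ) ^ (η / 4)) := by ring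
        _ = 4 * (n : ℝ) ^ (η / 2) := by rw [← Real.rpow_add hn0]; congr 2; ring
    have e3 : (n : ℝ) ^ (1 / 2 - η) * (n : ℝ) ^ (η / 4) * (n : ℝ) ^ (η / 2)
        = (n : ℝ) ^ (-(η / 4)) * Real.sqrt n := by
      rw [Real.sqrt_eq_rpow, ← Real.rpow_add hn0, ← Real.rpow_add hn0, ← Real.rpow_add hn0]
      congr 1; ring
    calc 3 * κ n * (L n : ℝ) ^ 2
        ≤ 3 * (D * (n : ℝ) ^ (1 / 2 - η) * (Real.sqrt (4 * s) * (n : ℝ) ^ (η / 4))) *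
          (4 * (n : ℝ) ^ (η / 2)) := by simp only [hκ]; gcongr
      _ = 3 * D * Real.sqrt (4 * s) * 4 *
          ((n : ℝ) ^ (1 / 2 - η) * (n : ℝ) ^ (η / 4) * (n : ℝ) ^ (η / 2)) := by ring
      _ = 3 * D * Real.sqrt (4 * s) * 4 * (n : ℝ) ^ (-(η / 4)) * Real.sqrt n := by rw [e3]; ring
      _ ≤ δ * Real.sqrt n := by gcongr
  have hfin : ∀ᶠ n : ℕ in atTop, (n : ℝ) ^ k * P.real {ω | δ * Real.sqrt n < opNorm (A n ω)} ≤
      (16 * b) * (n : ℝ) ^ (-(1 : ℝ)) := by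
    have hlim := ((tendsto_natCast_rpow_neg (show (0 : ℝ) < 1 by norm_num)).const_mul
      (2 * (|b| + 1))).eventually_le_const (u := 1) (by simp)
    filter_upwards [hsmall, hpow 1, hpow b, hrow, hcol, hm.eventually_le, hb0, hlim]
      with n h1 h2 h3 h4 h5 h6 hn1 h7
    have hn0 : (0 : ℝ) < n := by linarith
    have hR : 0 < D * (n : ℝ) ^ (1 / 2 - η) := by positivity
    have hlog0 : 0 ≤ Real.log n := Real.log_nonneg hn1
    have hq : (n : ℝ) ^ (-s) = Real.exp (-κ n ^ 2 / (4 * (D * (n : ℝ) ^ (1 / 2 - η)) ^ 2)) := by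
      rw [Real.rpow_def_of_pos hn0]
      congr 1
      simp only [hκ]
      rw [mul_pow _ (Real.sqrt _), Real.sq_sqrt (by positivity)]
      field_simp
    have hqn : (n : ℝ) ^ (-s) * n ≤ (n : ℝ) ^ (-(1 : ℝ)) := by
      have h8 : (n : ℝ) ^ (-s) * n = (n : ℝ) ^ (-s + 1) := by
        rw [Real.rpow_add hn0, Real.rpow_one]
      rw [h8]
      refine Real.rpow_le_rpow_of_exponent_le hn1 ?_
      have : (0 : ℝ) ≤ k := Nat.cast_nonneg k
      linarith
    have hpos1 : 0 ≤ (n : ℝ) ^ (-(1 : ℝ)) := by positivity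
    have hb : 0 ≤ b := by
      have := hm.pos
      by_contra hb
      nlinarith [h6.1, h6.2]
    have hqn1 : 2 * (n : ℝ) ^ (-s) * n ≤ 1 := by
      rw [abs_of_nonneg hb] at h7
      nlinarith
    have hqm : 2 * (n : ℝ) ^ (-s) * m n ≤ 1 := by
      rw [abs_of_nonneg hb] at h7
      have : 2 * (n : ℝ) ^ (-s) * m n ≤ 2 * (n : ℝ) ^ (-s) * (b * n) := by
        gcongr; exact h6.2
      nlinarith
    have hmain := (hA n).measureReal_opNorm_gt_le_of_rows (L := L n) (q := (n : ℝ) ^ (-s)) hR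
      (show 0 ≤ κ n by simp only [hκ]; positivity) h4 h5
      ((mul_le_mul_of_nonneg_left (Real.sqrt_le_sqrt h6.2) (by norm_num)).trans h3)
      (by simpa using h2) hq hqm hqn1
    have hsub : P.real {ω | δ * Real.sqrt n < opNorm (A n ω)} ≤
        P.real {ω | 3 * κ n * (L n : ℝ) ^ 2 < opNorm (A n ω)} :=
      measureReal_mono fun ω hω => lt_of_le_of_lt h1 hω
    calc (n : ℝ) ^ k * P.real {ω | δ * Real.sqrt n < opNorm (A n ω)}
        ≤ (n : ℝ) ^ k * (16 * ((n : ℝ) ^ (-s)) ^ 2 * (b * n * n)) := by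
          gcongr
          exact (hsub.trans hmain).trans (by gcongr; exact h6.2)
      _ = (16 * b) * ((n : ℝ) ^ (k : ℝ) * (((n : ℝ) ^ (-s)) * (n : ℝ) ^ (-s)) *
          ((n : ℝ) ^ (1 : ℝ) * (n : ℝ) ^ (1 : ℝ))) := by
          rw [Real.rpow_natCast, Real.rpow_one]; ring
      _ = (16 * b) * (n : ℝ) ^ (k + (-s + -s) + (1 + 1) : ℝ) := by
          rw [Real.rpow_add hn0, Real.rpow_add hn0, Real.rpow_add hn0 (-s), Real.rpow_add hn0 1]
      _ ≤ (16 * b) * (n : ℝ) ^ (-(1 : ℝ)) := by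
          gcongr
          have : (0 : ℝ) ≤ k := Nat.cast_nonneg k
          simp only [hs]; linarith
  refine squeeze_zero' (Eventually.of_forall fun n => by positivity) hfin ?_
  simpa using (tendsto_natCast_rpow_neg (show (0 : ℝ) < 1 by norm_num)).const_mul (16 * b)

lemma isCenteredBounded_comp {p : ℝ → ℝ} {M₁ M₂ : ℝ} (hp : IsNoiseDensity p M₁ M₂) {m n : ℕ}
    {W : Ω → Matrix (Fin m) (Fin n) ℝ} (hW : HasIIDEntries P W (noiseLaw p))
    {φ : Fin m → Fin n → ℝ → ℝ} (hφ : ∀ i j, Measurable (φ i j)) {c : Fin m → Fin n → ℝ}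
    (hc : ∀ i j w, |φ i j w| ≤ c i j) :
    IsCenteredBounded P (fun ω i j => φ i j (W ω i j) - ∫ w, φ i j w * p w) fun i j => 2 * c i j where
  indep := hW.1.comp (fun ij w => φ ij.1 ij.2 w - ∫ w, φ ij.1 ij.2 w * p w)
    fun ij => (hφ ij.1 ij.2).sub_const _
  aemeasurable i j := ((hφ i j).sub_const _).comp_aemeasurable (hW.2 i j).aemeasurable
  bound i j := Eventually.of_forall fun ω => by
    have h1 := hc i j (W ω i j)
    have h2 := hp.abs_integral_bdd_mul_le (hc i j)
    exact (abs_sub _ _).trans (by linarith)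
  mean i j := by
    rw [hp.integral_comp_of_hasLaw (hW.2 i j) ((hφ i j).sub_const _)]
    simp only [sub_mul]
    rw [integral_sub (hp.integrable_bdd_mul (hφ i j) (hc i j)) (hp.integrable.const_mul _),
      integral_const_mul, hp.integral_eq_one]
    ring

lemma negligible_avg [IsProbabilityMeasure P] {p : ℝ → ℝ} {M₁ M₂ : ℝ} (hp : IsNoiseDensity p M₁ M₂)
    (hm : Proportional m a b) {W : ∀ n : ℕ, Ω → Matrix (Fin (m n)) (Fin n) ℝ}
    (hW : ∀ n, HasIIDEntries P (W n) (noiseLaw p)) {φ : ℝ → ℝ} (hφ : Measurable φ) {C : ℝ}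
    (hC : ∀ x, |φ x| ≤ C) {δ : ℝ} (hδ : 0 < δ) :
    Negligible P fun n => {ω | δ < |avg (fun i j => φ (W n ω i j)) - ∫ x, φ x * p x|} := by
  set V : ℝ := (2 * (C + 1)) ^ 2 with hV
  have hC0 : 0 ≤ C := (abs_nonneg _).trans (hC 0)
  have hV0 : 0 < V := by positivity
  refine Negligible.of_le (f := fun n => 2 * Real.exp (-(δ ^ 2 * a / (2 * V) * (n : ℝ) ^ (1 : ℝ))))
    ?_ fun k => ?_
  · filter_upwards [hm.eventually_le, eventually_ge_atTop 1] with n hmn hn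
    have hn1 : (1 : ℝ) ≤ n := by exact_mod_cast hn
    have hm0 : 0 < (m n : ℝ) := by nlinarith [hm.pos, hmn.1]
    have hN : (m n : ℝ) * n ≠ 0 := by positivity
    have hcb := isCenteredBounded_comp hp (hW n) (φ := fun _ _ => φ) (c := fun _ _ => C)
      (fun _ _ => hφ) fun _ _ => hC
    have hsum : ∀ s : ℝ, s ^ 2 = 1 → ∑ _i : Fin (m n), ∑ _j : Fin n, (s * (2 * C)) ^ 2
        ≤ (m n : ℝ) * n * V := by
      intro s hs
      simp only [mul_pow s, hs, one_mul, Finset.sum_const, Finset.card_univ, Fintype.card_fin,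
        nsmul_eq_mul, ← mul_assoc (m n : ℝ)]
      gcongr
      linarith
    have ht : 0 ≤ δ * ((m n : ℝ) * n) := by positivity
    have h1 := hcb.measureReal_sum_ge_le (fun _ _ => 1) (hsum 1 (by norm_num)) ht
    have h2 := hcb.measureReal_sum_ge_le (fun _ _ => -1) (hsum (-1) (by norm_num)) ht
    have hexp : Real.exp (-(δ * ((m n : ℝ) * n)) ^ 2 / (2 * ((m n : ℝ) * n * V))) ≤
        Real.exp (-(δ ^ 2 * a / (2 * V) * (n : ℝ) ^ (1 : ℝ))) := by
      apply Real.exp_le_exp.2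
      have e : -(δ * ((m n : ℝ) * n)) ^ 2 / (2 * ((m n : ℝ) * n * V))
          = -(δ ^ 2 / (2 * V) * ((m n : ℝ) * n)) := by field_simp
      rw [e, Real.rpow_one, neg_le_neg_iff]
      have h3 : a * n ≤ (m n : ℝ) * n := by nlinarith [hmn.1, hm.pos]
      calc δ ^ 2 * a / (2 * V) * n = δ ^ 2 / (2 * V) * (a * n) := by ring
        _ ≤ _ := by gcongr
    have hsub : {ω | δ < |avg (fun i j => φ (W n ω i j)) - ∫ x, φ x * p x|} ⊆
        {ω | δ * ((m n : ℝ) * n) ≤ ∑ i, ∑ j, 1 * (φ (W n ω i j) - ∫ w, φ w * p w)} ∪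
        {ω | δ * ((m n : ℝ) * n) ≤ ∑ i, ∑ j, (-1) * (φ (W n ω i j) - ∫ w, φ w * p w)} := by
      intro ω hω
      simp only [Set.mem_union, Set.mem_ofPred_eq, ← Finset.mul_sum] at hω ⊢
      have e : avg (fun i j => φ (W n ω i j)) - ∫ x, φ x * p x =
          (∑ i, ∑ j, (φ (W n ω i j) - ∫ w, φ w * p w)) / ((m n : ℝ) * n) := by
        have := avg_affine hN 1 0 (-∫ x, φ x * p x) (fun i j => φ (W n ω i j))
          (fun i j => φ (W n ω i j))
        rw [one_mul, zero_mul, add_zero, ← sub_eq_add_neg] at this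
        rw [← this]
        simp only [avg]
        congr 1
        exact Finset.sum_congr rfl fun i _ => Finset.sum_congr rfl fun j _ => by ring
      rw [e] at hω
      rcases lt_abs.1 hω with h | h
      · left
        rw [lt_div_iff₀ (by positivity)] at h
        linarith
      · right
        rw [← neg_div, lt_div_iff₀ (by positivity)] at h
        linarith
    refine (measureReal_mono hsub).trans ((measureReal_union_le _ _).trans ?_)
    linarith
  · have := (tendsto_rpow_mul_exp_neg_rpow k (c := δ ^ 2 * a / (2 * V)) (by have := hm.pos; positivity)
      one_pos).const_mul 2
    rw [mul_zero] at this
    refine this.congr fun n => ?_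
    rw [Real.rpow_natCast]; ring

end Negligible

/-! ### Uniform deviations of kernel sums -/

section

variable {Ω : Type*} [MeasurableSpace Ω] {P : Measure Ω} {p : ℝ → ℝ} {M₁ M₂ : ℝ}

lemma IsNoiseDensity.second_moment_nonneg (hp : IsNoiseDensity p M₁ M₂) : 0 ≤ M₁ :=
  (integral_nonneg fun x => mul_nonneg (sq_nonneg x) (hp.nonneg x)).trans hp.second_moment_le

lemma IsNoiseDensity.measureReal_abs_gt_le [IsProbabilityMeasure P] (hp : IsNoiseDensity p M₁ M₂)
    {w : Ω → ℝ} (hw : HasLaw w (noiseLaw p) P) {t : ℝ} (ht : 0 < t) :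
    P.real {ω | t < |w ω|} ≤ M₁ / t ^ 2 := by
  have h1 := mul_meas_ge_le_integral_of_nonneg (μ := P) (f := fun ω => w ω ^ 2)
    (Eventually.of_forall fun ω => sq_nonneg _)
    (hp.integrable_comp_of_hasLaw hw (φ := fun x => x ^ 2) hp.sq_integrable) (t ^ 2)
  rw [hp.integral_comp_of_hasLaw hw (φ := fun x => x ^ 2) (measurable_id.pow_const 2)] at h1
  rw [le_div_iff₀ (by positivity), mul_comm]
  refine le_trans ?_ (h1.trans hp.second_moment_le)
  refine mul_le_mul_of_nonneg_left (measureReal_mono fun ω hω => ?_) (by positivity)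
  simp only [Set.mem_ofPred_eq] at hω ⊢
  rw [← sq_abs (w ω)]
  gcongr

lemma IsNoiseDensity.measureReal_exists_abs_gt_le [IsProbabilityMeasure P]
    (hp : IsNoiseDensity p M₁ M₂) {m n : ℕ} {W : Ω → Matrix (Fin m) (Fin n) ℝ}
    (hW : HasIIDEntries P W (noiseLaw p)) {t : ℝ} (ht : 0 < t) :
    P.real {ω | ∃ i j, t < |W ω i j|} ≤ (m : ℝ) * n * (M₁ / t ^ 2) := by
  have hsub : {ω | ∃ i j, t < |W ω i j|} ⊆
      ⋃ ij ∈ (Finset.univ : Finset (Fin m × Fin n)), {ω | t < |W ω ij.1 ij.2|} := by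
    rintro ω ⟨i, j, hij⟩
    simp only [Set.mem_iUnion]
    exact ⟨(i, j), Finset.mem_univ _, hij⟩
  refine (measureReal_mono hsub (measure_ne_top P _)).trans ((measureReal_biUnion_le _ _ fun ij _ =>
    hp.measureReal_abs_gt_le (hW.2 ij.1 ij.2) ht).trans ?_)
  simp

-- The exponent in Bernstein's inequality is of order `n^{1 - η'(2r+1)}`, positive by hypothesis.
-- The case `r = 0` serves the density and `r = 1` its derivative, whose estimate is divided by one
-- more power of the bandwidth. The points allowed are those at most twice the largest entry of `X +
-- W` in modulus, which covers every `Y i j + avg Y`; as only second moments are available, the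
-- largest entry is bounded by a power of `n` adapted to the decay rate `q` under test.
set_option maxHeartbeats 1000000 in
lemma negligible_kernelSum [IsProbabilityMeasure P] (hp : IsNoiseDensity p M₁ M₂) {k : ℝ → ℝ}
    {B : ℝ} (hk : IsRegularKernel k B) {m : ℕ → ℕ} {a b : ℝ} (hm : Proportional m a b)
    {X : ∀ n : ℕ, Matrix (Fin (m n)) (Fin n) ℝ} {D : ℝ} (hD : 0 ≤ D)
    (hX : ∀ᶠ n : ℕ in atTop, ∀ i j, |X n i j| ≤ D * n)
    {W : ∀ n : ℕ, Ω → Matrix (Fin (m n)) (Fin n) ℝ} (hW : ∀ n, HasIIDEntries P (W n) (noiseLaw p))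
    {η' : ℝ} (hη' : 0 < η') (r : ℕ) (hr : η' * (2 * r + 1) < 1) {δ : ℝ} (hδ : 0 < δ) :
    Negligible P fun n => {ω | ∃ x, (∀ y, (∀ i j, |(X n + W n ω) i j| ≤ y) → |x| ≤ 2 * y) ∧
      δ * (n : ℝ) ^ (-(1 / 2) : ℝ) * ((m n : ℝ) * n) * ((n : ℝ) ^ (-η')) ^ (r + 1) <
        |kernelSum k ((n : ℝ) ^ (-η')) (X n + W n ω) x
          - kernelMean k ((n : ℝ) ^ (-η')) (X n) p x|} := by
  intro q
  have hB := hk.bound_pos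
  have hM₂ := hp.bound_nonneg
  have hM₁ := hp.second_moment_nonneg
  have ha := hm.pos
  -- Small enough for two purposes: the variance term takes at most half of the linear term in the
  -- exponent, and the Chernoff parameter `lam` satisfies `lam * (2 * B) ≤ 1`.
  set c : ℝ := 1 / (4 * M₂ * B + 2 * B * δ + 1) with hc
  have hden : 0 < 4 * M₂ * B + 2 * B * δ + 1 := by positivity
  have hc0 : 0 < c := by positivity
  have hc1 : c * (M₂ * B) ≤ 1 / 4 := by
    rw [hc, div_mul_eq_mul_div, one_mul, div_le_iff₀ hden]
    nlinarith [mul_pos hB hδ]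
  have hc2 : c * δ * (2 * B) ≤ 1 := by
    rw [hc, mul_assoc, div_mul_eq_mul_div, one_mul, div_le_iff₀ hden]
    nlinarith [mul_nonneg hM₂ hB.le]
  set θ : ℝ := 1 - η' * (2 * r + 1) with hθ
  have hθ0 : 0 < θ := by simp only [hθ]; linarith
  set Q : ℝ := (q + 4) + (1 / 2 + η' * (r + 2)) with hQ
  set C : ℝ := 2 * (2 * (1 + D) * (4 * B / δ)) + 5 with hC
  have hC0 : 0 < C := by positivity
  have hlim1 := ((tendsto_natCast_rpow_neg (show (0 : ℝ) < 1 by norm_num)).const_mul (b * M₁))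
  have hlim2 := ((tendsto_rpow_mul_exp_neg_rpow (q + Q) (c := c * δ ^ 2 * a / 4)
    (by positivity) hθ0).const_mul (C * 2))
  have hlim := hlim1.add hlim2
  simp only [mul_zero, add_zero] at hlim
  refine squeeze_zero' (Eventually.of_forall fun n => by positivity) ?_ hlim
  filter_upwards [hX, hm.eventually_le, eventually_ge_atTop 1] with n hXn hmn hn
  have hn1 : (1 : ℝ) ≤ n := by exact_mod_cast hn
  have hn0 : (0 : ℝ) < n := by linarith
  have hm0 : 0 < (m n : ℝ) := lt_of_lt_of_le (by positivity) hmn.1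
  set N : ℝ := (m n : ℝ) * n with hN
  have hN0 : 0 < N := by positivity
  set h : ℝ := (n : ℝ) ^ (-η') with hh
  have hh0 : 0 < h := by positivity
  have hh1 : h ≤ 1 := Real.rpow_le_one_of_one_le_of_nonpos hn1 (by linarith)
  set s : ℝ := (n : ℝ) ^ (-(1 / 2) : ℝ) with hs
  have hs0 : 0 < s := by positivity
  have hs1 : s ≤ 1 := Real.rpow_le_one_of_one_le_of_nonpos hn1 (by norm_num)
  set t : ℝ := δ * s * N * h ^ (r + 1) with ht
  set lam : ℝ := c * δ * s * h ^ r with hlam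
  set ϑ : ℝ := δ * s * h ^ (r + 2) / (4 * B) with hϑ
  have hϑ0 : 0 < ϑ := by positivity
  set R : ℝ := 2 * ((n : ℝ) ^ (q + 4) + D * n) with hR
  have hlamB : lam * (2 * B) ≤ 1 := by
    have h1 : s * h ^ r ≤ 1 := mul_le_one₀ hs1 (by positivity) (pow_le_one₀ hh0.le hh1)
    calc lam * (2 * B) = c * δ * (2 * B) * (s * h ^ r) := by rw [hlam]; ring
      _ ≤ 1 * 1 := mul_le_mul hc2 h1 (by positivity) zero_le_one
      _ = 1 := one_mul 1
  have hunif := measureReal_exists_kernelSum_gt_le (X := X n) (R := R) (t := t) hp hk hh0 (hW n)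
    (show 0 ≤ lam by positivity) hlamB (by positivity) hϑ0 (by
      rw [ht, hϑ]; refine le_of_eq ?_; field_simp; ring)
  have hexp : Real.exp (-(lam * (t / 2)) + (m n : ℝ) * n * (lam ^ 2 * (M₂ * B * h))) ≤
      Real.exp (-(c * δ ^ 2 * a / 4 * (n : ℝ) ^ θ)) := by
    apply Real.exp_le_exp.2
    have e1 : -(lam * (t / 2)) + (m n : ℝ) * n * (lam ^ 2 * (M₂ * B * h)) =
        (c * δ ^ 2 * (s ^ 2 * N * h ^ (2 * r + 1))) * (-(1 / 2) + c * (M₂ * B)) := by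
      rw [hlam, ht, ← hN]; ring
    have e2 : s ^ 2 * (n : ℝ) ^ 2 * h ^ (2 * r + 1) = (n : ℝ) ^ θ := by
      rw [hs, hh, ← Real.rpow_natCast, ← Real.rpow_natCast, ← Real.rpow_natCast,
        ← Real.rpow_mul hn0.le, ← Real.rpow_mul hn0.le, ← Real.rpow_add hn0, ← Real.rpow_add hn0]
      congr 1
      simp only [hθ]; push_cast; ring
    have e3 : a * (n : ℝ) ^ θ ≤ s ^ 2 * N * h ^ (2 * r + 1) := by
      rw [← e2]
      have : a * (n : ℝ) ^ 2 ≤ N := by rw [hN, sq, ← mul_assoc]; gcongr; exact hmn.1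
      calc a * (s ^ 2 * (n : ℝ) ^ 2 * h ^ (2 * r + 1))
          = s ^ 2 * (a * (n : ℝ) ^ 2) * h ^ (2 * r + 1) := by ring
        _ ≤ _ := by gcongr
    rw [e1]
    have e4 : c * δ ^ 2 * (a * (n : ℝ) ^ θ) ≤ c * δ ^ 2 * (s ^ 2 * N * h ^ (2 * r + 1)) := by gcongr
    have e5 : 0 ≤ c * δ ^ 2 * (s ^ 2 * N * h ^ (2 * r + 1)) := by positivity
    nlinarith
  -- The grid has polynomial size, although the power grows with `q`; the stretched exponential
  -- absorbs it.
  have hgrid : 2 * (R / ϑ) + 5 ≤ C * (n : ℝ) ^ Q := by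
    have e1 : ϑ⁻¹ = 4 * B / δ * (n : ℝ) ^ (1 / 2 + η' * (r + 2)) := by
      have e2 : (n : ℝ) ^ (1 / 2 + η' * (r + 2)) = (s * h ^ (r + 2))⁻¹ := by
        rw [hs, hh, ← Real.rpow_natCast, ← Real.rpow_mul hn0.le, ← Real.rpow_add hn0,
          ← Real.rpow_neg hn0.le]
        congr 1; push_cast; ring
      rw [e2, hϑ]; field_simp
    have e2 : R ≤ 2 * (1 + D) * (n : ℝ) ^ ((q : ℝ) + 4) := by
      have e3 : (n : ℝ) ^ ((q : ℝ) + 4) = (n : ℝ) ^ (q + 4) := by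
        rw [← Real.rpow_natCast]; congr 1; push_cast; ring
      have e4 : (n : ℝ) ≤ (n : ℝ) ^ (q + 4) := by
        calc (n : ℝ) = (n : ℝ) ^ 1 := (pow_one _).symm
          _ ≤ _ := pow_le_pow_right₀ hn1 (by omega)
      rw [e3, hR]
      nlinarith
    have e5 : (1 : ℝ) ≤ (n : ℝ) ^ Q := Real.one_le_rpow hn1 (by positivity)
    calc 2 * (R / ϑ) + 5
        ≤ 2 * (2 * (1 + D) * (n : ℝ) ^ ((q : ℝ) + 4) *
          (4 * B / δ * (n : ℝ) ^ (1 / 2 + η' * (r + 2)))) + 5 * (n : ℝ) ^ Q := by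
          rw [div_eq_mul_inv, e1]
          gcongr
          linarith
      _ = C * (n : ℝ) ^ Q := by rw [hQ, Real.rpow_add hn0 ((q : ℝ) + 4), hC]; ring
  have hW1 := hp.measureReal_exists_abs_gt_le (hW n) (t := (n : ℝ) ^ (q + 4)) (by positivity)
  have hsub : {ω | ∃ x, (∀ y, (∀ i j, |(X n + W n ω) i j| ≤ y) → |x| ≤ 2 * y) ∧
      t < |kernelSum k h (X n + W n ω) x - kernelMean k h (X n) p x|} ⊆
      {ω | ∃ i j, (n : ℝ) ^ (q + 4) < |W n ω i j|} ∪
      {ω | ∃ x, |x| ≤ R ∧ t < |kernelSum k h (X n + W n ω) x - kernelMean k h (X n) p x|} := by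
    rintro ω ⟨x, hx, hxt⟩
    by_cases hbig : ∃ i j, (n : ℝ) ^ (q + 4) < |W n ω i j|
    · exact Or.inl hbig
    · push Not at hbig
      refine Or.inr ⟨x, hx _ fun i j => ?_, hxt⟩
      rw [Matrix.add_apply]
      refine (abs_add_le _ _).trans ?_
      linarith [hXn i j, hbig i j]
  have hbnd := (measureReal_mono hsub (measure_ne_top P _)).trans ((measureReal_union_le _ _).trans
    (add_le_add hW1 hunif))
  have hf1 : (n : ℝ) ^ q * (N * (M₁ / ((n : ℝ) ^ (q + 4)) ^ 2)) ≤ b * M₁ * (n : ℝ) ^ (-(1 : ℝ)) := by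
    have hNb : N ≤ b * (n : ℝ) ^ 2 := by rw [hN, sq, ← mul_assoc]; gcongr; exact hmn.2
    have hb : 0 ≤ b := by nlinarith [hmn.1, hmn.2]
    calc (n : ℝ) ^ q * (N * (M₁ / ((n : ℝ) ^ (q + 4)) ^ 2))
        ≤ (n : ℝ) ^ q * (b * (n : ℝ) ^ 2 * (M₁ / ((n : ℝ) ^ (q + 4)) ^ 2)) := by gcongr
      _ = b * M₁ * (1 / (n : ℝ) ^ (q + 6)) := by field_simp; ring
      _ ≤ b * M₁ * (1 / (n : ℝ) ^ 1) := by
          gcongr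
          omega
      _ = b * M₁ * (n : ℝ) ^ (-(1 : ℝ)) := by rw [Real.rpow_neg_one]; simp
  calc (n : ℝ) ^ q * P.real _ ≤ (n : ℝ) ^ q * (N * (M₁ / ((n : ℝ) ^ (q + 4)) ^ 2) +
        (C * (n : ℝ) ^ Q) * (2 * Real.exp (-(c * δ ^ 2 * a / 4 * (n : ℝ) ^ θ)))) := by
        refine mul_le_mul_of_nonneg_left (hbnd.trans (add_le_add le_rfl ?_)) (by positivity)
        gcongr
    _ ≤ b * M₁ * (n : ℝ) ^ (-(1 : ℝ)) + C * 2 * ((n : ℝ) ^ (q + Q : ℝ) *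
        Real.exp (-(c * δ ^ 2 * a / 4 * (n : ℝ) ^ θ))) := by
        rw [mul_add]
        refine add_le_add hf1 (le_of_eq ?_)
        rw [Real.rpow_add hn0 (q : ℝ) Q, Real.rpow_natCast]; ring

end

/-! ### The average of the noise -/

lemma sum_range_sq_le (K : ℕ) : ∑ n ∈ Finset.range (K + 1), (n : ℝ) ^ 2 ≤ (K : ℝ) ^ 3 := by
  induction K with
  | zero => simp
  | succ K ih =>
    rw [Finset.sum_range_succ]
    push_cast
    have : (0 : ℝ) ≤ K := Nat.cast_nonneg K
    nlinarith [sq_nonneg (K : ℝ)]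

/-- Taken at `z = x²/c` and integrated, this turns the finite second moment into the summability of
`n² P(W² > c n³)`: the indices counted satisfy `n³ < z`, and the squares up to `K` sum to at most
`K³`. -/
lemma sum_range_ite_cube_lt_le {z : ℝ} (hz : 0 ≤ z) (K : ℕ) :
    ∑ n ∈ Finset.range K, (if (n : ℝ) ^ 3 < z then (n : ℝ) ^ 2 else 0) ≤ z := by
  induction K with
  | zero => simpa using hz
  | succ K ih =>
    by_cases h : (K : ℝ) ^ 3 < z
    · refine le_trans (Finset.sum_le_sum fun n _ => ?_) ((sum_range_sq_le K).trans h.le)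
      split_ifs
      · exact le_rfl
      · positivity
    · rw [Finset.sum_range_succ, if_neg h, add_zero]
      exact ih

lemma exp_le_one_add_add_sq_mul_exp (y : ℝ) : Real.exp y ≤ 1 + y + y ^ 2 * Real.exp |y| := by
  have h := Complex.norm_exp_sub_sum_le_norm_mul_exp (y : ℂ) 2
  have e : Complex.exp (y : ℂ) - ∑ m ∈ Finset.range 2, (y : ℂ) ^ m / (m.factorial : ℂ)
      = ((Real.exp y - (1 + y) : ℝ) : ℂ) := by
    simp [Finset.sum_range_succ]
  rw [e, Complex.norm_real, Complex.norm_real, Real.norm_eq_abs, Real.norm_eq_abs, sq_abs] at h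
  linarith [le_abs_self (Real.exp y - (1 + y))]

namespace IsNoiseDensity

variable {Ω : Type*} [MeasurableSpace Ω] {P : Measure Ω} {p : ℝ → ℝ} {M₁ M₂ : ℝ}

lemma integral_avg_sq_le [IsProbabilityMeasure P] (hp : IsNoiseDensity p M₁ M₂) {m n : ℕ}
    {W : Ω → Matrix (Fin m) (Fin n) ℝ} (hW : HasIIDEntries P W (noiseLaw p)) :
    MemLp (fun ω => avg (W ω)) 2 P ∧ ∫ ω, avg (W ω) ^ 2 ∂P ≤ M₁ / ((m : ℝ) * n) := by
  have hm2 : ∀ ij : Fin m × Fin n, MemLp (fun ω => W ω ij.1 ij.2) 2 P := fun ij =>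
    (memLp_two_iff_integrable_sq (hW.2 ij.1 ij.2).aemeasurable.aestronglyMeasurable).2
      (hp.integrable_comp_of_hasLaw (hW.2 ij.1 ij.2) (φ := fun x => x ^ 2) hp.sq_integrable)
  have h0 : ∀ ij : Fin m × Fin n, ∫ ω, W ω ij.1 ij.2 ∂P = 0 := fun ij => by
    rw [hp.integral_comp_of_hasLaw (hW.2 ij.1 ij.2) (φ := fun x => x) measurable_id, hp.mean_zero]
  have hv : ∀ ij : Fin m × Fin n, variance (fun ω => W ω ij.1 ij.2) P ≤ M₁ := fun ij => by
    rw [variance_of_integral_eq_zero (hm2 ij).aemeasurable (h0 ij),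
      hp.integral_comp_of_hasLaw (hW.2 ij.1 ij.2) (φ := fun x => x ^ 2) (measurable_id.pow_const 2)]
    exact hp.second_moment_le
  set S : Ω → ℝ := ∑ ij : Fin m × Fin n, fun ω => W ω ij.1 ij.2 with hS
  have hSm : MemLp S 2 P := memLp_finsetSum' _ fun ij _ => hm2 ij
  have hS0 : ∫ ω, S ω ∂P = 0 := by
    simp only [hS, Finset.sum_apply]
    rw [integral_finsetSum _ fun ij _ => (hm2 ij).integrable (by norm_num)]
    exact Finset.sum_eq_zero fun ij _ => h0 ij
  have hSv : ∫ ω, S ω ^ 2 ∂P ≤ (m : ℝ) * n * M₁ := by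
    rw [← variance_of_integral_eq_zero hSm.aemeasurable hS0, hS,
      IndepFun.variance_sum (fun ij _ => hm2 ij) fun i _ j _ hij => hW.1.indepFun hij]
    refine (Finset.sum_le_sum fun ij _ => hv ij).trans (le_of_eq ?_)
    simp
  have e : (fun ω => avg (W ω)) = fun ω => ((m : ℝ) * n)⁻¹ * S ω := by
    ext ω
    simp only [avg, hS, Finset.sum_apply, Fintype.sum_prod_type]
    rw [div_eq_inv_mul]
  refine ⟨by rw [e]; exact hSm.const_mul _, ?_⟩
  have e2 : (fun ω => avg (W ω) ^ 2) = fun ω => (((m : ℝ) * n)⁻¹) ^ 2 * S ω ^ 2 := by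
    ext ω
    rw [congrFun e ω]; ring
  rw [e2, integral_const_mul]
  have hN : 0 ≤ (m : ℝ) * n := by positivity
  rcases hN.eq_or_lt with h | h
  · rw [← h]; simp
  · calc _ ≤ (((m : ℝ) * n)⁻¹) ^ 2 * ((m : ℝ) * n * M₁) := by gcongr
      _ = _ := by field_simp

lemma summable_sq_mul_measureReal (hp : IsNoiseDensity p M₁ M₂) {c : ℝ} (hc : 0 < c) :
    Summable fun n : ℕ => (n : ℝ) ^ 2 * (noiseLaw p).real {x | c * (n : ℝ) ^ 3 < x ^ 2} := by
  have := hp.isProbabilityMeasure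
  have hms : ∀ n : ℕ, MeasurableSet {x : ℝ | c * (n : ℝ) ^ 3 < x ^ 2} := fun n =>
    measurableSet_lt measurable_const (measurable_id.pow_const 2)
  refine summable_of_sum_range_le (c := M₁ / c) (fun n => by positivity) fun K => ?_
  have h1 : ∀ n : ℕ, (n : ℝ) ^ 2 * (noiseLaw p).real {x | c * (n : ℝ) ^ 3 < x ^ 2} =
      ∫ x, (n : ℝ) ^ 2 * Set.indicator {x : ℝ | c * (n : ℝ) ^ 3 < x ^ 2} (fun _ => 1) x
        ∂(noiseLaw p) := fun n => by
    rw [integral_const_mul, integral_indicator_const _ (hms n), smul_eq_mul, mul_one]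
  simp_rw [h1]
  have hi : ∀ n : ℕ, Integrable (fun x => (n : ℝ) ^ 2 *
      Set.indicator {x : ℝ | c * (n : ℝ) ^ 3 < x ^ 2} (fun _ => (1 : ℝ)) x) (noiseLaw p) := fun n =>
    ((integrable_const (1 : ℝ)).indicator (hms n)).const_mul _
  rw [← integral_finsetSum _ fun n _ => hi n]
  have hsq : Integrable (fun x : ℝ => x ^ 2 / c) (noiseLaw p) :=
    (hp.integrable_noiseLaw_iff.2 hp.sq_integrable).div_const c
  calc _ ≤ ∫ x, x ^ 2 / c ∂(noiseLaw p) := by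
        refine integral_mono (integrable_finsetSum _ fun n _ => hi n) hsq fun x => ?_
        refine le_trans (le_of_eq ?_) (sum_range_ite_cube_lt_le (z := x ^ 2 / c) (by positivity) K)
        refine Finset.sum_congr rfl fun n _ => ?_
        by_cases h : c * (n : ℝ) ^ 3 < x ^ 2
        · rw [Set.indicator_of_mem (by exact h), if_pos (by rwa [lt_div_iff₀' hc]), mul_one]
        · rw [Set.indicator_of_notMem (by exact h), if_neg (by rwa [lt_div_iff₀' hc]), mul_zero]
    _ ≤ M₁ / c := by
        rw [integral_div, hp.integral_noiseLaw]
        gcongr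
        exact hp.second_moment_le

/-- Truncation at level `L`. -/
lemma integral_exp_truncated_le [IsProbabilityMeasure P] (hp : IsNoiseDensity p M₁ M₂) {w : Ω → ℝ}
    (hw : HasLaw w (noiseLaw p) P) {L r σ : ℝ} (hL : 0 < L) (hr : 0 ≤ r) (hσ : |σ| = 1) :
    ∫ ω, Real.exp (r * (σ * if |w ω| ≤ L then w ω else 0)) ∂P ≤
      Real.exp (r * (M₁ / L) + r ^ 2 * M₁ * Real.exp (r * L)) := by
  set φ : ℝ → ℝ := fun x => if |x| ≤ L then x else 0 with hφ
  have hφm : Measurable φ :=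
    Measurable.ite (measurableSet_le measurable_id.abs measurable_const) measurable_id
      measurable_const
  have hφb : ∀ x, |φ x| ≤ L := fun x => by
    simp only [hφ]; split_ifs with h
    · exact h
    · simpa using hL.le
  have hφsq : ∀ x, φ x ^ 2 ≤ x ^ 2 := fun x => by
    simp only [hφ]; split_ifs with h
    · exact le_rfl
    · simpa using sq_nonneg x
  have hi1 := hp.integrable_bdd_mul hφm hφb
  have hi2 := hp.integrable_bdd_mul (hφm.pow_const 2) (C := L ^ 2) fun x => by
    rw [abs_pow]; exact pow_le_pow_left₀ (abs_nonneg _) (hφb x) 2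
  -- As the noise is centred, the truncated mean is minus the mean of the discarded part, where `|x|
  -- ≤ x²/L`.
  have hmean : |∫ x, φ x * p x| ≤ M₁ / L := by
    have h1 : ∫ x, φ x * p x = ∫ x, -((x - φ x) * p x) := by
      have h2 : (fun x => -((x - φ x) * p x)) = fun x => φ x * p x - x * p x := by ext x; ring
      rw [h2, integral_sub hi1 hp.integrable_mul_self, hp.mean_zero, sub_zero]
    rw [h1]
    refine (norm_integral_le_of_norm_le (f := fun x => -((x - φ x) * p x))
      (hp.sq_integrable.div_const L)
      (Eventually.of_forall fun x => ?_)).trans ?_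
    · rw [norm_neg, norm_mul, Real.norm_eq_abs, Real.norm_eq_abs, abs_of_nonneg (hp.nonneg x),
        mul_div_right_comm]
      refine mul_le_mul_of_nonneg_right ?_ (hp.nonneg x)
      simp only [hφ]; split_ifs with h
      · simp only [sub_self, abs_zero]; positivity
      · push Not at h
        rw [sub_zero, le_div_iff₀ hL, ← sq_abs]
        nlinarith [abs_nonneg x]
    · rw [integral_div]
      gcongr
      exact hp.second_moment_le
  have hsq : ∫ x, φ x ^ 2 * p x ≤ M₁ :=
    (integral_mono hi2 hp.sq_integrable fun x =>
      mul_le_mul_of_nonneg_right (hφsq x) (hp.nonneg x)).trans hp.second_moment_le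
  have hσ2 : σ ^ 2 = 1 := by rw [← sq_abs, hσ, one_pow]
  have hcomp : ∀ ψ : ℝ → ℝ, Measurable ψ → ∫ ω, ψ (w ω) ∂P = ∫ x, ψ x * p x := fun ψ hψ =>
    hp.integral_comp_of_hasLaw hw hψ
  have hm : Measurable fun x => Real.exp (r * (σ * φ x)) :=
    Real.measurable_exp.comp ((hφm.const_mul σ).const_mul r)
  have e1 := hcomp _ hm
  simp only [hφ] at e1
  rw [e1]
  change ∫ x, Real.exp (r * (σ * φ x)) * p x ≤ _
  set E := Real.exp (r * L) with hE
  have hpt : ∀ x, Real.exp (r * (σ * φ x)) ≤ 1 + r * σ * φ x + r ^ 2 * E * φ x ^ 2 := fun x => by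
    have h1 := exp_le_one_add_add_sq_mul_exp (r * (σ * φ x))
    have h2 : Real.exp |r * (σ * φ x)| ≤ E := by
      apply Real.exp_le_exp.2
      rw [abs_mul, abs_mul, hσ, one_mul, abs_of_nonneg hr]
      exact mul_le_mul_of_nonneg_left (hφb x) hr
    have h3 : (r * (σ * φ x)) ^ 2 = r ^ 2 * φ x ^ 2 := by rw [mul_pow, mul_pow, hσ2]; ring
    rw [h3] at h1
    nlinarith [mul_le_mul_of_nonneg_left h2 (show 0 ≤ r ^ 2 * φ x ^ 2 by positivity)]
  have hint : ∫ x, Real.exp (r * (σ * φ x)) * p x ≤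
      ∫ x, ((p x + r * σ * (φ x * p x)) + r ^ 2 * E * (φ x ^ 2 * p x)) := by
    refine integral_mono (hp.integrable_bdd_mul hm (C := E) fun x => ?_)
      ((hp.integrable.add (hi1.const_mul _)).add (hi2.const_mul _)) fun x => ?_
    · rw [Real.abs_exp]
      apply Real.exp_le_exp.2
      refine (le_abs_self _).trans ?_
      rw [abs_mul, abs_mul, hσ, one_mul, abs_of_nonneg hr]
      exact mul_le_mul_of_nonneg_left (hφb x) hr
    · refine (mul_le_mul_of_nonneg_right (hpt x) (hp.nonneg x)).trans (le_of_eq ?_)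
      ring
  have j1 : Integrable fun x => p x + r * σ * (φ x * p x) := hp.integrable.add (hi1.const_mul _)
  rw [integral_add j1 (hi2.const_mul _), integral_add hp.integrable (hi1.const_mul _),
    integral_const_mul, integral_const_mul, hp.integral_eq_one] at hint
  have hE0 : 0 < E := Real.exp_pos _
  have h5 : r * σ * ∫ x, φ x * p x ≤ r * (M₁ / L) := by
    refine (le_abs_self _).trans ?_
    rw [abs_mul, abs_mul, hσ, mul_one, abs_of_nonneg hr]
    gcongr
  have h6 : r ^ 2 * E * ∫ x, φ x ^ 2 * p x ≤ r ^ 2 * E * M₁ := by gcongr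
  have h7 := Real.add_one_le_exp (r * (M₁ / L) + r ^ 2 * M₁ * E)
  linarith

/-- Either some entry exceeds `L`, or the sum coincides with that of the truncated entries, to which
the exponential bound applies with either sign. -/
lemma measureReal_abs_sum_gt_le [IsProbabilityMeasure P] (hp : IsNoiseDensity p M₁ M₂) {m n : ℕ}
    {W : Ω → Matrix (Fin m) (Fin n) ℝ} (hW : HasIIDEntries P W (noiseLaw p)) {L r t : ℝ}
    (hL : 0 < L) (hr : 0 ≤ r) :
    P.real {ω | t < |∑ i, ∑ j, W ω i j|} ≤ (m : ℝ) * n * (noiseLaw p).real {x | L ^ 2 < x ^ 2} +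
      2 * Real.exp (-(r * t) + (m : ℝ) * n * (r * (M₁ / L) + r ^ 2 * M₁ * Real.exp (r * L))) := by
  set φ : ℝ → ℝ := fun x => if |x| ≤ L then x else 0 with hφ
  have hφm : Measurable φ :=
    Measurable.ite (measurableSet_le measurable_id.abs measurable_const) measurable_id
      measurable_const
  have hφb : ∀ x, |φ x| ≤ L := fun x => by
    simp only [hφ]; split_ifs with h
    · exact h
    · simpa using hL.le
  have hone : ∀ σ : ℝ, |σ| = 1 → P.real {ω | t ≤ ∑ ij : Fin m × Fin n, σ * φ (W ω ij.1 ij.2)} ≤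
      Real.exp (-(r * t) + (m : ℝ) * n * (r * (M₁ / L) + r ^ 2 * M₁ * Real.exp (r * L))) := by
    intro σ hσ
    have := measureReal_sum_ge_le_of_mgf_le (ξ := fun (ij : Fin m × Fin n) ω => σ * φ (W ω ij.1 ij.2))
      (hW.1.comp (fun _ x => σ * φ x) fun _ => hφm.const_mul σ)
      (fun ij => (hφm.const_mul σ).comp_aemeasurable (hW.2 ij.1 ij.2).aemeasurable) (L := L)
      (fun ij => Eventually.of_forall fun ω => by rw [abs_mul, hσ, one_mul]; exact hφb _) hr
      (fun ij => hp.integral_exp_truncated_le (hW.2 ij.1 ij.2) hL hr hσ) t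
    rw [Fintype.card_prod, Fintype.card_fin, Fintype.card_fin] at this
    push_cast at this
    exact this
  have hbig : P.real (⋃ ij ∈ (Finset.univ : Finset (Fin m × Fin n)),
      {ω | L ^ 2 < W ω ij.1 ij.2 ^ 2}) ≤ (m : ℝ) * n * (noiseLaw p).real {x | L ^ 2 < x ^ 2} := by
    refine (measureReal_biUnion_le _ _ (q := fun _ => (noiseLaw p).real {x | L ^ 2 < x ^ 2})
      fun ij _ => ?_).trans (by simp)
    exact ((hW.2 ij.1 ij.2).measureReal_eq (p := fun x => L ^ 2 < x ^ 2)
      (measurableSet_lt measurable_const (measurable_id.pow_const 2))).le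
  have hsub : {ω | t < |∑ i, ∑ j, W ω i j|} ⊆
      (⋃ ij ∈ (Finset.univ : Finset (Fin m × Fin n)), {ω | L ^ 2 < W ω ij.1 ij.2 ^ 2}) ∪
      ({ω | t ≤ ∑ ij : Fin m × Fin n, 1 * φ (W ω ij.1 ij.2)} ∪
      {ω | t ≤ ∑ ij : Fin m × Fin n, (-1) * φ (W ω ij.1 ij.2)}) := by
    intro ω hω
    by_cases hb : ∃ ij : Fin m × Fin n, L ^ 2 < W ω ij.1 ij.2 ^ 2
    · left
      obtain ⟨ij, hij⟩ := hb
      simp only [Set.mem_iUnion]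
      exact ⟨ij, Finset.mem_univ _, hij⟩
    · right
      push Not at hb
      have he : ∀ ij : Fin m × Fin n, φ (W ω ij.1 ij.2) = W ω ij.1 ij.2 := fun ij => by
        simp only [hφ]
        exact if_pos (abs_le_of_sq_le_sq (hb ij) hL.le)
      have he' : ∀ i j, φ (W ω i j) = W ω i j := fun i j => he (i, j)
      simp only [Set.mem_union, Set.mem_ofPred_eq, Fintype.sum_prod_type,
        one_mul, neg_one_mul, he', Finset.sum_neg_distrib] at hω ⊢
      exact (lt_abs.1 hω).imp le_of_lt le_of_lt
  refine (measureReal_mono hsub (measure_ne_top P _)).trans ((measureReal_union_le _ _).trans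
    (add_le_add hbig ((measureReal_union_le _ _).trans ?_)))
  rw [two_mul]
  exact add_le_add (hone 1 (by simp)) (hone (-1) (by simp))

/-- The average of the noise is almost surely `o(n ^ (-1/2))`. -/
lemma ae_eventually_abs_sum_le [IsProbabilityMeasure P] (hp : IsNoiseDensity p M₁ M₂) {m : ℕ → ℕ}
    {a b : ℝ} (hm : Proportional m a b) {W : ∀ n : ℕ, Ω → Matrix (Fin (m n)) (Fin n) ℝ}
    (hW : ∀ n, HasIIDEntries P (W n) (noiseLaw p)) {δ : ℝ} (hδ : 0 < δ) :
    ∀ᵐ ω ∂P, ∀ᶠ n : ℕ in atTop, |∑ i, ∑ j, W n ω i j| ≤ δ * (n * Real.sqrt n) := by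
  have hM₁ := hp.second_moment_nonneg
  set c : ℝ := δ ^ 2 / 64 with hc
  have hc0 : 0 < c := by positivity
  have hsum := ((hp.summable_sq_mul_measureReal hc0).mul_left b).add
    ((Real.summable_one_div_nat_pow.2 (show 1 < 2 by norm_num)).mul_left (2 * Real.exp 1))
  have hlim := ((tendsto_natCast_rpow_neg (show (0 : ℝ) < 1 / 4 by norm_num)).const_mul
    (b * M₁ / c)).eventually_le_const (u := 1) (by simp)
  have hlog : ∀ᶠ n : ℕ in atTop, Real.log n ≤ (n : ℝ) ^ (1 / 8 : ℝ) := by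
    have := ((isLittleO_log_rpow_atTop (show (0 : ℝ) < 1 / 8 by norm_num)).comp_tendsto
      tendsto_natCast_atTop_atTop).bound (show (0 : ℝ) < 1 by norm_num)
    filter_upwards [this] with n hn
    simp only [Function.comp, one_mul] at hn
    exact (le_abs_self _).trans (hn.trans (le_of_eq (Real.norm_of_nonneg (by positivity))))
  have hae := ae_eventually_notMem_of_summable (P := P)
    (E := fun n => {ω | δ * (n * Real.sqrt n) < |∑ i, ∑ j, W n ω i j|}) hsum ?_
  · filter_upwards [hae] with ω hω
    filter_upwards [hω] with n hn
    exact not_lt.1 hn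
  filter_upwards [hlim, hlog, hm.eventually_le, eventually_ge_atTop 2] with n h1 h2 hmn hn
  have hn2 : (2 : ℝ) ≤ n := by exact_mod_cast hn
  have hn0 : (0 : ℝ) < n := by linarith
  have hlog0 : 0 < Real.log n := Real.log_pos (by linarith)
  set L : ℝ := δ / 8 * (n * Real.sqrt n) with hL
  have hL0 : 0 < L := by positivity
  have hL2 : L ^ 2 = c * (n : ℝ) ^ 3 := by
    rw [hL, mul_pow, mul_pow, Real.sq_sqrt hn0.le, hc]; ring
  set r : ℝ := Real.log n / (2 * L) with hr
  have hr0 : 0 ≤ r := by positivity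
  have hmain := hp.measureReal_abs_sum_gt_le (hW n) (t := δ * (n * Real.sqrt n)) hL0 hr0
  refine hmain.trans ?_
  have hNb : (m n : ℝ) * n ≤ b * (n : ℝ) ^ 2 := by rw [sq, ← mul_assoc]; gcongr; exact hmn.2
  have hb : 0 ≤ b := by have := hm.pos; nlinarith [hmn.1, hmn.2]
  refine add_le_add ?_ ?_
  · rw [hL2]
    calc _ ≤ b * (n : ℝ) ^ 2 * (noiseLaw p).real {x | c * (n : ℝ) ^ 3 < x ^ 2} := by gcongr
      _ = _ := by ring
  · have e1 : r * (δ * (n * Real.sqrt n)) = 4 * Real.log n := by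
      have : δ * (n * Real.sqrt n) = 8 * L := by rw [hL]; ring
      rw [this, hr]; field_simp; norm_num
    have e2 : Real.exp (r * L) = (n : ℝ) ^ (1 / 2 : ℝ) := by
      rw [Real.rpow_def_of_pos hn0, hr]
      congr 1; field_simp
    have e3 : r * (M₁ / L) + r ^ 2 * M₁ * Real.exp (r * L) ≤
        M₁ / c * ((n : ℝ) ^ (-(1 / 4) : ℝ) * (n : ℝ) ^ (-2 : ℝ)) := by
      have e4 : r * (M₁ / L) + r ^ 2 * M₁ * Real.exp (r * L) =
          M₁ / L ^ 2 * (Real.log n / 2 + Real.log n ^ 2 / 4 * (n : ℝ) ^ (1 / 2 : ℝ)) := by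
        rw [e2, hr]; field_simp; ring
      have e5 : Real.log n / 2 + Real.log n ^ 2 / 4 * (n : ℝ) ^ (1 / 2 : ℝ) ≤
          (n : ℝ) ^ (3 / 4 : ℝ) := by
        have e6 : (n : ℝ) ^ (1 / 8 : ℝ) ≤ (n : ℝ) ^ (3 / 4 : ℝ) :=
          Real.rpow_le_rpow_of_exponent_le (by linarith) (by norm_num)
        have e7 : Real.log n ^ 2 * (n : ℝ) ^ (1 / 2 : ℝ) ≤ (n : ℝ) ^ (3 / 4 : ℝ) := by
          calc Real.log n ^ 2 * (n : ℝ) ^ (1 / 2 : ℝ)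
              ≤ ((n : ℝ) ^ (1 / 8 : ℝ)) ^ 2 * (n : ℝ) ^ (1 / 2 : ℝ) := by gcongr
            _ = (n : ℝ) ^ (3 / 4 : ℝ) := by
                rw [← Real.rpow_natCast, ← Real.rpow_mul hn0.le, ← Real.rpow_add hn0]
                norm_num
        have e8 : 0 ≤ (n : ℝ) ^ (3 / 4 : ℝ) := by positivity
        linarith
      rw [e4, hL2]
      calc M₁ / (c * (n : ℝ) ^ 3) * (Real.log n / 2 + Real.log n ^ 2 / 4 * (n : ℝ) ^ (1 / 2 : ℝ))
          ≤ M₁ / (c * (n : ℝ) ^ 3) * (n : ℝ) ^ (3 / 4 : ℝ) := by gcongr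
        _ = M₁ / c * ((n : ℝ) ^ (3 / 4 : ℝ) * (n : ℝ) ^ (-3 : ℝ)) := by
            rw [Real.rpow_neg hn0.le]
            norm_cast
            field_simp
        _ = M₁ / c * ((n : ℝ) ^ (-(1 / 4) : ℝ) * (n : ℝ) ^ (-2 : ℝ)) := by
            rw [← Real.rpow_add hn0, ← Real.rpow_add hn0]; norm_num
    have e9 : (m n : ℝ) * n * (r * (M₁ / L) + r ^ 2 * M₁ * Real.exp (r * L)) ≤ 1 := by
      calc _ ≤ b * (n : ℝ) ^ 2 * (M₁ / c * ((n : ℝ) ^ (-(1 / 4) : ℝ) * (n : ℝ) ^ (-2 : ℝ))) := by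
            gcongr
        _ = b * M₁ / c * (n : ℝ) ^ (-(1 / 4) : ℝ) * ((n : ℝ) ^ (2 : ℝ) * (n : ℝ) ^ (-2 : ℝ)) := by
            norm_cast; ring
        _ = b * M₁ / c * (n : ℝ) ^ (-(1 / 4) : ℝ) := by
            rw [← Real.rpow_add hn0]; norm_num
        _ ≤ 1 := h1
    rw [e1, mul_assoc 2]
    refine mul_le_mul_of_nonneg_left ?_ (by norm_num)
    calc Real.exp _ ≤ Real.exp (1 + -(Real.log n * (2 : ℕ))) := by
          apply Real.exp_le_exp.2
          push_cast
          linarith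
      _ = Real.exp 1 * (1 / (n : ℝ) ^ 2) := by
          rw [Real.exp_add, Real.exp_neg, ← Real.rpow_def_of_pos hn0]
          norm_cast
          rw [one_div]

lemma ae_tendsto_sqrt_mul_avg [IsProbabilityMeasure P] (hp : IsNoiseDensity p M₁ M₂) {m : ℕ → ℕ}
    {a b : ℝ} (hm : Proportional m a b) {W : ∀ n : ℕ, Ω → Matrix (Fin (m n)) (Fin n) ℝ}
    (hW : ∀ n, HasIIDEntries P (W n) (noiseLaw p)) :
    ∀ᵐ ω ∂P, Tendsto (fun n : ℕ => Real.sqrt n * |avg (W n ω)|) atTop (𝓝 0) := by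
  have ha := hm.pos
  have h : ∀ᵐ ω ∂P, ∀ k : ℕ, ∀ᶠ n : ℕ in atTop,
      |∑ i, ∑ j, W n ω i j| ≤ a / ((k : ℝ) + 1) * (n * Real.sqrt n) :=
    ae_all_iff.2 fun k => hp.ae_eventually_abs_sum_le hm hW (by positivity)
  filter_upwards [h] with ω hω
  rw [Metric.tendsto_atTop']
  intro ε hε
  obtain ⟨k, hk⟩ := exists_nat_one_div_lt hε
  obtain ⟨n₀, hn₀⟩ := eventually_atTop.1 ((hω k).and (hm.eventually_le.and (eventually_ge_atTop 1)))
  refine ⟨n₀, fun n hn => ?_⟩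
  obtain ⟨h1, h2, h3⟩ := hn₀ n hn.le
  have hn1 : (1 : ℝ) ≤ n := by exact_mod_cast h3
  have hn0 : (0 : ℝ) < n := by linarith
  have hm0 : 0 < (m n : ℝ) := lt_of_lt_of_le (by positivity) h2.1
  rw [Real.dist_eq, sub_zero, abs_of_nonneg (by positivity)]
  refine lt_of_le_of_lt ?_ hk
  rw [avg, abs_div, abs_of_pos (a := (m n : ℝ) * n) (by positivity)]
  calc Real.sqrt n * (|∑ i, ∑ j, W n ω i j| / ((m n : ℝ) * n))
      ≤ Real.sqrt n * (a / ((k : ℝ) + 1) * (n * Real.sqrt n) / (a * n * n)) := by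
        gcongr
        exact h2.1
    _ = 1 / ((k : ℝ) + 1) * (Real.sqrt n * Real.sqrt n / n) := by field_simp
    _ = 1 / ((k : ℝ) + 1) := by rw [Real.mul_self_sqrt hn0.le, div_self hn0.ne', mul_one]

end IsNoiseDensity

/-! ### The kernel estimates and their means -/

section KernelMean

variable {m n : ℕ} {K p : ℝ → ℝ} {B M₁ M₂ h : ℝ}

/-- The substitution `w = x - c + h z`, which exhibits the mean of a kernel estimate as a
convolution of `p`. -/
lemma integral_kernel_shift (k : ℝ → ℝ) (p : ℝ → ℝ) (hh : 0 < h) (c x : ℝ) :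
    ∫ w, k ((c + w - x) / h) * p w = h * ∫ z, k z * p (x - c + h * z) := by
  have h1 := Measure.integral_comp_mul_left (fun y => k (y / h) * p (x - c + y)) h
  have h2 := integral_add_right_eq_self (μ := volume) (fun y => k (y / h) * p (x - c + y)) (c - x)
  rw [abs_of_pos (inv_pos.2 hh), smul_eq_mul, ← h2] at h1
  have e1 : (fun z => k z * p (x - c + h * z)) = fun z => k (h * z / h) * p (x - c + h * z) := by
    ext z; rw [mul_div_cancel_left₀ _ hh.ne']
  rw [e1, h1, mul_inv_cancel_left₀ hh.ne']
  refine integral_congr_ae (Eventually.of_forall fun w => ?_)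
  ring_nf

lemma one_div_mul_kernelMean (hh : 0 < h) (X : Matrix (Fin m) (Fin n) ℝ) (x : ℝ) :
    1 / (m * n * h) * kernelMean K h X p x = smooth K h (avgSub X) p (x - avg X) := by
  have e : kernelMean K h X p x =
      h * ∑ i, ∑ j, ∫ z, K z * p (x - avg X + avgSub X i j + h * z) := by
    simp only [kernelMean, integral_kernel_shift K p hh, ← Finset.mul_sum, avgSub,
      sub_add_sub_cancel]
  have e' : ∀ S : ℝ, 1 / (m * n * h) * (h * S) = S / (m * n) := fun S => by
    rw [one_div, mul_inv, mul_assoc, inv_mul_cancel_left₀ hh.ne', div_eq_inv_mul]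
  rw [e, e']
  rfl

/-- Integration by parts moves the derivative from the kernel to the density; the boundary terms
vanish by integrability. -/
lemma integral_deriv_kernel_mul (hp : IsNoiseDensity p M₁ M₂) (hK : IsKernel K B) (hh : 0 < h)
    (c : ℝ) : ∫ z, deriv K z * p (c + h * z) = -(h * ∫ z, K z * deriv p (c + h * z)) := by
  have hv : ∀ z : ℝ, HasDerivAt (fun z => p (c + h * z)) (deriv p (c + h * z) * h) z := fun z => by
    have h1 : HasDerivAt (fun z : ℝ => c + h * z) h z := by
      simpa using ((hasDerivAt_id z).const_mul h).const_add c
    exact (hp.hasDerivAt _).comp z h1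
  have hi : Integrable fun z => p (c + h * z) :=
    (hp.integrable.comp_add_left c).comp_mul_left' hh.ne'
  have i3 : Integrable (K * fun z => p (c + h * z)) :=
    hK.integrable_mul_bdd (hp.continuous.comp (by fun_prop)) fun x => hp.abs_le _
  have i2 : Integrable (deriv K * fun z => p (c + h * z)) :=
    hi.bdd_mul hK.continuous_deriv.aestronglyMeasurable (Eventually.of_forall hK.abs_deriv_le)
  have i1 : Integrable (K * fun z => deriv p (c + h * z) * h) :=
    hK.integrable_mul_bdd (C := M₂ * h) ((hp.continuous_deriv.comp (by fun_prop)).mul_const h)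
      fun x => by rw [abs_mul, abs_of_pos hh]; gcongr; exact hp.abs_deriv_le _
  have := integral_mul_deriv_eq_deriv_mul_of_integrable (u := K) (u' := deriv K)
    (fun x _ => hK.hasDerivAt x) (fun x _ => hv x) i1 i2 i3
  rw [eq_neg_iff_add_eq_zero, ← eq_neg_iff_add_eq_zero.1 this, add_comm, ← integral_const_mul]
  congr 1
  refine integral_congr_ae (Eventually.of_forall fun w => ?_)
  ring

lemma neg_one_div_mul_kernelMean_deriv (hp : IsNoiseDensity p M₁ M₂) (hK : IsKernel K B)
    (hh : 0 < h) (X : Matrix (Fin m) (Fin n) ℝ) (x : ℝ) :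
    -(1 / (m * n * h ^ 2) * kernelMean (deriv K) h X p x) =
      smooth K h (avgSub X) (deriv p) (x - avg X) := by
  have e : kernelMean (deriv K) h X p x =
      -(h ^ 2 * ∑ i, ∑ j, ∫ z, K z * deriv p (x - avg X + avgSub X i j + h * z)) := by
    simp only [kernelMean, integral_kernel_shift (deriv K) p hh, integral_deriv_kernel_mul hp hK hh,
      mul_neg, Finset.sum_neg_distrib, ← Finset.mul_sum, avgSub, sub_add_sub_cancel]
    ring
  have e' : ∀ S : ℝ, 1 / (m * n * h ^ 2) * (h ^ 2 * S) = S / (m * n) := fun S => by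
    rw [one_div, mul_inv, mul_assoc, inv_mul_cancel_left₀ (by positivity), div_eq_inv_mul]
  rw [e, mul_neg, neg_neg, e']
  rfl

lemma pHat_eq_kernelSum (K : ℝ → ℝ) (h : ℝ) (Y : Matrix (Fin m) (Fin n) ℝ) (x : ℝ) :
    pHat K h Y x = 1 / (m * n * h) * kernelSum K h Y (x + avg Y) := by
  simp only [pHat, kernelSum, sub_sub, add_comm x]

lemma pHatDeriv_eq_kernelSum (K : ℝ → ℝ) (h : ℝ) (Y : Matrix (Fin m) (Fin n) ℝ) (x : ℝ) :
    pHatDeriv K h Y x = -(1 / (m * n * h ^ 2) * kernelSum (deriv K) h Y (x + avg Y)) := by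
  simp only [pHatDeriv, kernelSum, sub_sub, add_comm x]

lemma pHat_nonneg (hK : IsKernel K B) (hh : 0 ≤ h) (Y : Matrix (Fin m) (Fin n) ℝ) (x : ℝ) :
    0 ≤ pHat K h Y x :=
  mul_nonneg (by positivity) (Finset.sum_nonneg fun _ _ => Finset.sum_nonneg fun _ _ => hK.nonneg _)

lemma abs_pHatDeriv_le (hK : IsKernel K B) (hmn : (m : ℝ) * n ≠ 0) (hh : 0 < h)
    (Y : Matrix (Fin m) (Fin n) ℝ) (x : ℝ) : |pHatDeriv K h Y x| ≤ B / h ^ 2 := by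
  have h1 := abs_avg_le_of_forall (A := fun i j => deriv K ((Y i j - avg Y - x) / h)) hmn
    (fun i j => hK.abs_deriv_le _)
  have e : pHatDeriv K h Y x =
      -(avg (fun i j => deriv K ((Y i j - avg Y - x) / h)) / h ^ 2) := by
    simp only [pHatDeriv, avg]; field_simp
  rw [e, abs_neg, abs_div, abs_of_pos (a := h ^ 2) (by positivity)]
  gcongr

end KernelMean

/-! ### The signal class -/

/-- The sum of both powers covers either sign of the exponent: `1/2 - η` may be negative. -/
lemma rpow_le_of_mem_Icc {A B x y : ℝ} (hA : 0 < A) (hx : 0 < x) (h1 : A * x ≤ y) (h2 : y ≤ B * x)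
    (s : ℝ) : y ^ s ≤ (A ^ s + B ^ s) * x ^ s := by
  have hy : 0 < y := by nlinarith
  have hB : 0 < B := by by_contra hB; nlinarith
  rw [add_mul, ← Real.mul_rpow hA.le hx.le, ← Real.mul_rpow hB.le hx.le]
  have p1 : 0 < (A * x) ^ s := by positivity
  have p2 : 0 < (B * x) ^ s := by positivity
  rcases le_total 0 s with hs | hs
  · have := Real.rpow_le_rpow hy.le h2 hs; linarith
  · have := Real.rpow_le_rpow_of_nonpos (by positivity) h1 hs; linarith

/-- The consequences of membership in the signal class, for large `n`, with a common constant. -/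
structure SignalBounds {m : ℕ → ℕ} (X : ∀ n : ℕ, Matrix (Fin (m n)) (Fin n) ℝ) (D η : ℝ) :
    Prop where
  row : ∀ᶠ n : ℕ in atTop, ∀ i, ∑ j, X n i j ^ 2 ≤ (D * (n : ℝ) ^ (1 / 2 - η)) ^ 2
  col : ∀ᶠ n : ℕ in atTop, ∀ j, ∑ i, X n i j ^ 2 ≤ (D * (n : ℝ) ^ (1 / 2 - η)) ^ 2
  opNorm_le : ∀ᶠ n : ℕ in atTop, opNorm (X n) ≤ D * Real.sqrt n
  opNorm_hadamard_le : ∀ᶠ n : ℕ in atTop,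
    opNorm (Matrix.hadamard (X n) (X n)) ≤ D * (n : ℝ) ^ (1 / 2 - η)

section Signal

variable {m : ℕ → ℕ} {X : ∀ n : ℕ, Matrix (Fin (m n)) (Fin n) ℝ} {a b D η : ℝ}

/-- The dimensions are comparable for large `n`, so every bound of the signal class can be written
with powers of `n`. The constant is chosen before `m` and `X`, because `τ` may not depend on them.
-/
lemma exists_signalBounds {a b : ℝ} (ha : 0 < a) (M η : ℝ) : ∃ D > 0, ∀ (m : ℕ → ℕ)
    (X : ∀ n : ℕ, Matrix (Fin (m n)) (Fin n) ℝ), Proportional m a b →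
    (∀ n, X n ∈ signalClass (m n) n M η) → SignalBounds X D η := by
  set s : ℝ := 1 / 2 - η with hs
  set c : ℝ := (a ^ s + b ^ s) + (1 + (max b 1) ^ s) + (1 + (max b 1) ^ (1 / 2 : ℝ)) with hc
  have hmax : (0 : ℝ) < max b 1 := lt_of_lt_of_le one_pos (le_max_right _ _)
  have hpos : 0 < |M| * |c| + |M| + 1 := by positivity
  refine ⟨|M| * |c| + |M| + 1, hpos, fun m X hm hX => ?_⟩
  have key : ∀ᶠ n : ℕ in atTop, (0 : ℝ) < n ∧ 0 < b ∧ (m n : ℝ) ^ s ≤ (a ^ s + b ^ s) * (n : ℝ) ^ s ∧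
      ∀ t : ℝ, (max (m n) n : ℝ) ^ t ≤ (1 + (max b 1) ^ t) * (n : ℝ) ^ t := by
    filter_upwards [hm.eventually_le, eventually_ge_atTop 1] with n h1 h2
    have hn : (0 : ℝ) < n := by exact_mod_cast h2
    have hb : 0 < b := by
      by_contra hb
      have : 0 < a * n := by positivity
      nlinarith [h1.1, h1.2]
    refine ⟨hn, hb, rpow_le_of_mem_Icc ha hn h1.1 h1.2 s, fun t => ?_⟩
    have := rpow_le_of_mem_Icc (y := max (m n) n) one_pos hn (by simp) (B := max b 1)
      (max_le (h1.2.trans (by gcongr; exact le_max_left _ _))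
        (le_mul_of_one_le_left hn.le (le_max_right _ _))) t
    rwa [Real.one_rpow] at this
  have hMD : |M| ≤ |M| * |c| + |M| + 1 := by
    have : 0 ≤ |M| * |c| := by positivity
    linarith
  have scale : ∀ {x y c' : ℝ}, 0 ≤ x → 0 ≤ c' → c' ≤ c → y ≤ c' * x → 0 ≤ y →
      M * y ≤ (|M| * |c| + |M| + 1) * x := by
    intro x y c' hx hc0 hcc hy hy0
    calc M * y ≤ |M| * (c' * x) := by
          have := le_abs_self M
          have h0 := abs_nonneg M
          nlinarith
      _ ≤ |M| * (|c| * x) := by gcongr; exact hcc.trans (le_abs_self _)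
      _ ≤ _ := by nlinarith [abs_nonneg M]
  have sq_le : ∀ {S y z : ℝ}, 0 ≤ S → Real.sqrt S ≤ M * y → M * y ≤ z → S ≤ z ^ 2 := by
    intro S y z hS h1 h2
    rw [← Real.sq_sqrt hS]
    exact pow_le_pow_left₀ (Real.sqrt_nonneg _) (h1.trans h2) 2
  refine ⟨?_, ?_, ?_, ?_⟩
  · filter_upwards [key] with n ⟨hn, _, _, _⟩ i
    refine sq_le (Finset.sum_nonneg fun _ _ => sq_nonneg _) ((hX n).2.2.1 i) ?_
    gcongr
    exact (le_abs_self _).trans hMD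
  · filter_upwards [key] with n ⟨hn, hb, h1, _⟩ j
    refine sq_le (Finset.sum_nonneg fun _ _ => sq_nonneg _) ((hX n).2.2.2 j) ?_
    refine scale (by positivity) (by positivity) ?_ h1 (by positivity)
    have : 0 ≤ (max b 1) ^ s := by positivity
    have : 0 ≤ (max b 1) ^ (1 / 2 : ℝ) := by positivity
    rw [hc]; linarith
  · filter_upwards [key] with n ⟨hn, hb, _, h1⟩
    rw [Real.sqrt_eq_rpow]
    refine (hX n).1.trans (scale (by positivity) (by positivity) ?_ (h1 _) (by positivity))
    have : 0 ≤ (max b 1) ^ s := by positivity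
    have : 0 ≤ a ^ s + b ^ s := by positivity
    rw [hc]; linarith
  · filter_upwards [key] with n ⟨hn, hb, _, h1⟩
    refine (hX n).2.1.trans (scale (by positivity) (by positivity) ?_ (h1 _) (by positivity))
    have : 0 ≤ (max b 1) ^ (1 / 2 : ℝ) := by positivity
    have : 0 ≤ a ^ s + b ^ s := by positivity
    rw [hc]; linarith

lemma proportional_of_tendsto {γ : ℝ} (hγ : 0 < γ)
    (h : Tendsto (fun n : ℕ => (m n : ℝ) / n) atTop (𝓝 γ)) : Proportional m (γ / 2) (2 * γ) := by
  refine ⟨by positivity, ?_⟩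
  filter_upwards [h.eventually (Ioo_mem_nhds (show γ / 2 < γ by linarith) (show γ < 2 * γ by linarith)),
    eventually_ge_atTop 1] with n hn h1
  have hn0 : (0 : ℝ) < n := by exact_mod_cast h1
  exact ⟨((lt_div_iff₀ hn0).1 hn.1).le, ((div_lt_iff₀ hn0).1 hn.2).le⟩

namespace SignalBounds

lemma abs_le (h : SignalBounds X D η) (hD : 0 ≤ D) (hη : 0 ≤ η) :
    ∀ᶠ n : ℕ in atTop, ∀ i j, |X n i j| ≤ D * n := by
  filter_upwards [h.row, eventually_ge_atTop 1] with n h1 hn i j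
  have hn1 : (1 : ℝ) ≤ n := by exact_mod_cast hn
  refine (abs_le_of_sq_le_sq ((Finset.single_le_sum (f := fun j => X n i j ^ 2)
    (fun _ _ => sq_nonneg _) (Finset.mem_univ j)).trans (h1 i)) (by positivity)).trans ?_
  gcongr
  calc (n : ℝ) ^ (1 / 2 - η) ≤ (n : ℝ) ^ (1 : ℝ) :=
        Real.rpow_le_rpow_of_exponent_le hn1 (by linarith)
    _ = n := Real.rpow_one _

lemma abs_avg_le_of_opNorm {m n : ℕ} {A : Matrix (Fin m) (Fin n) ℝ} {c : ℝ}
    (h : opNorm A ≤ c) : |avg A| ≤ c / Real.sqrt ((m : ℝ) * n) := by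
  rcases (show (0 : ℝ) ≤ (m : ℝ) * n by positivity).eq_or_lt with h0 | h0
  · simp [avg, ← h0]
  rw [avg, abs_div, abs_of_pos h0, div_le_div_iff₀ h0 (Real.sqrt_pos.2 h0)]
  calc _ ≤ (opNorm A * Real.sqrt ((m : ℝ) * n)) * Real.sqrt ((m : ℝ) * n) := by
        gcongr; exact abs_sum_le_opNorm A
    _ = opNorm A * ((m : ℝ) * n) := by rw [mul_assoc, Real.mul_self_sqrt h0.le]
    _ ≤ _ := by gcongr

/-- For large `n`, `√(mn) ≥ √a n`. -/
lemma _root_.MatrixDenoising.Proportional.sqrt_mul_le (hm : Proportional m a b) :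
    ∀ᶠ n : ℕ in atTop, (0 : ℝ) < n ∧ 0 < (m n : ℝ) ∧ Real.sqrt a * n ≤ Real.sqrt ((m n : ℝ) * n) ∧
      Real.sqrt ((m n : ℝ) * n) ≤ Real.sqrt b * n := by
  filter_upwards [hm.eventually_le, eventually_ge_atTop 1] with n h1 h2
  have hn : (0 : ℝ) < n := by exact_mod_cast h2
  have ha := hm.pos
  have hb : 0 ≤ b := by
    have : 0 < a * n := by positivity
    by_contra hb
    nlinarith [h1.1, h1.2]
  refine ⟨hn, lt_of_lt_of_le (by positivity) h1.1, ?_, ?_⟩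
  · rw [← Real.sqrt_sq hn.le, ← Real.sqrt_mul ha.le, Real.sqrt_sq hn.le]
    apply Real.sqrt_le_sqrt
    nlinarith [h1.1]
  · rw [← Real.sqrt_sq hn.le, ← Real.sqrt_mul hb, Real.sqrt_sq hn.le]
    apply Real.sqrt_le_sqrt
    nlinarith [h1.2]

/-- The average of the squares is at most `‖X ⊙ X‖ / √(mn)`, of order `n^{-1/2-η}`. This makes the
bias caused by the signal negligible against `n^{-1/2}`. -/
lemma tendsto_avg_sq (h : SignalBounds X D η) (hm : Proportional m a b) (hη : 0 < η) :
    Tendsto (fun n : ℕ => Real.sqrt n * avg (fun i j => X n i j ^ 2)) atTop (𝓝 0) := by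
  have ha := Real.sqrt_pos.2 hm.pos
  have hlim := (tendsto_natCast_rpow_neg hη).const_mul (D / Real.sqrt a)
  rw [mul_zero] at hlim
  refine squeeze_zero' (Eventually.of_forall fun n =>
    mul_nonneg (Real.sqrt_nonneg _) (avg_nonneg fun _ _ => sq_nonneg _)) ?_ hlim
  filter_upwards [h.opNorm_hadamard_le, hm.sqrt_mul_le] with n h1 ⟨hn, hm0, h2, _⟩
  have e : (fun i j => X n i j ^ 2) = Matrix.hadamard (X n) (X n) := by
    ext i j; simp [Matrix.hadamard_apply, sq]
  rw [e]
  have h0 := (opNorm_nonneg _).trans h1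
  calc _ ≤ Real.sqrt n * (D * (n : ℝ) ^ (1 / 2 - η) / (Real.sqrt a * n)) := by
        gcongr
        exact (le_abs_self _).trans ((abs_avg_le_of_opNorm h1).trans (by gcongr))
    _ = D / Real.sqrt a * (Real.sqrt n * (n : ℝ) ^ (1 / 2 - η) * (n : ℝ)⁻¹) := by field_simp
    _ = _ := by
        rw [Real.sqrt_eq_rpow (n : ℝ), ← Real.rpow_add hn, ← Real.rpow_neg_one (n : ℝ),
          ← Real.rpow_add hn]
        ring_nf

end SignalBounds

end Signal

/-! ### Approximate scores -/

/-- `β` is a smooth function close to the regularised score `-p' / (p + ε)`, uniformly up to `δ`,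
whose mean under `p` is at most `κ`. -/
structure IsApproxScore (p : ℝ → ℝ) (M₂ ε δ κ : ℝ) (β β' : ℝ → ℝ) : Prop where
  hasDerivAt : ∀ x, HasDerivAt β (β' x) x
  abs_le : ∀ x, |β x| ≤ M₂ / ε
  abs_deriv_le : ∀ x, |β' x| ≤ M₂ / ε + M₂ ^ 2 / ε ^ 2
  abs_sub_score_le : ∀ x, |β x - regRatio ε (deriv p) p x| ≤ δ
  abs_integral_le : |∫ x, β x * p x| ≤ κ

namespace IsApproxScore

variable {p β β' : ℝ → ℝ} {M₁ M₂ ε δ κ : ℝ}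

lemma continuous (h : IsApproxScore p M₂ ε δ κ β β') : Continuous β :=
  continuous_iff_continuousAt.2 fun x => (h.hasDerivAt x).continuousAt

lemma abs_sub_le (h : IsApproxScore p M₂ ε δ κ β β') (x y : ℝ) :
    |β x - β y| ≤ (M₂ / ε + M₂ ^ 2 / ε ^ 2) * |x - y| :=
  abs_sub_le_of_hasDerivAt h.hasDerivAt h.abs_deriv_le x y

lemma abs_integral_mul_deriv_sub_le (h : IsApproxScore p M₂ ε δ κ β β') (hp : IsNoiseDensity p M₁ M₂)
    (hε : 0 < ε) : |(∫ x, β x * deriv p x) - ∫ x, regRatio ε (deriv p) p x * deriv p x| ≤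
      δ * ∫ x, |deriv p x| := by
  have i1 := hp.integrable_bdd_mul_deriv h.continuous.measurable h.abs_le
  have i2 := hp.integrable_bdd_mul_deriv (hp.measurable_score ε) (hp.abs_score_le hε)
  rw [← integral_sub i1 i2]
  simpa only [sub_mul] using hp.abs_integral_mul_deriv_le h.abs_sub_score_le

end IsApproxScore

section SmoothScore

variable {p K : ℝ → ℝ} {M₁ M₂ B : ℝ}

/-- Smoothing preserves the bounds on `p`, `p'` and `p''`, so the derivative bound does not blow up
as the bandwidths shrink. The mean is controlled by `δ₀` alone, while the uniform distance to the
score also involves the cruder error `δ₁` of the smoothed derivative. -/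
lemma isApproxScore_smooth (hp : IsNoiseDensity p M₁ M₂) (hK : IsKernel K B) {m n : ℕ}
    (hmn : (m : ℝ) * n ≠ 0) {s : Matrix (Fin m) (Fin n) ℝ} {h h' ε δ₀ δ₁ : ℝ} (hε : 0 < ε)
    (h0 : ∀ x, |smooth K h s p x - p x| ≤ δ₀) (h0' : ∀ x, |smooth K h' s p x - p x| ≤ δ₀)
    (h1 : ∀ x, |smooth K h' s (deriv p) x - deriv p x| ≤ δ₁) :
    ∃ β', IsApproxScore p M₂ ε (δ₁ / ε + M₂ * δ₀ / ε ^ 2)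
      (δ₀ * (M₂ / ε ^ 2 + (∫ x, |deriv p x|) / ε))
      (regRatio ε (smooth K h' s (deriv p)) (smooth K h s p)) β' := by
  have d0 := fun h x => hasDerivAt_smooth (h := h) (s := s) hK hp.hasDerivAt hp.abs_le
    hp.continuous_deriv hp.abs_deriv_le x
  have d1 := fun h x => hasDerivAt_smooth (h := h) (s := s) hK hp.hasDerivAt_deriv hp.abs_deriv_le
    hp.continuous_deriv_deriv hp.abs_deriv_deriv_le x
  have n0 := fun h x => smooth_nonneg (h := h) (s := s) hK hp.nonneg x
  have b1 := fun h x => abs_smooth_le (h := h) (s := s) hK hmn hp.abs_deriv_le x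
  have b2 := fun h x => abs_smooth_le (h := h) (s := s) hK hmn hp.abs_deriv_deriv_le x
  have hM := hp.bound_nonneg
  have c0 : ∀ h, Continuous (smooth K h s p) := fun h =>
    continuous_iff_continuousAt.2 fun x => (d0 h x).continuousAt
  have c1 : ∀ h, Continuous (smooth K h s (deriv p)) := fun h =>
    continuous_iff_continuousAt.2 fun x => (d1 h x).continuousAt
  refine ⟨_, fun x => hasDerivAt_regRatio hε (n0 h x) (d1 h' x) (d0 h x),
    fun x => abs_regRatio_le hε (n0 h x) (b1 h' x), fun x => ?_, fun x => ?_,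
    hp.abs_integral_regRatio_mul_le hε (n0 h) (b1 h') (c0 h) (c1 h') (d0 h') h0 h0'⟩
  · have hq := n0 h x
    set q := smooth K h s p x
    have hqε : 0 < q + ε := by linarith
    have e : ∀ u v w : ℝ, -((u * (q + ε) - v * w) / (q + ε) ^ 2) =
        -(u / (q + ε)) + v * w / (q + ε) ^ 2 := fun u v w => by field_simp; ring
    rw [e]
    refine (abs_add_le _ _).trans (add_le_add ?_ ?_)
    · rw [abs_neg, abs_div, abs_of_pos hqε]
      gcongr
      · exact b2 h' x
      · linarith
    · rw [abs_div, abs_mul, abs_of_pos (a := (q + ε) ^ 2) (by positivity), sq M₂]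
      gcongr
      · exact b1 h' x
      · exact b1 h x
      · linarith
  · refine (abs_regRatio_sub_le hε (n0 h x) (hp.nonneg x)).trans ?_
    gcongr
    · exact h1 x
    · exact hp.abs_deriv_le x
    · exact h0 x

variable {m : ℕ → ℕ} {X : ∀ n : ℕ, Matrix (Fin (m n)) (Fin n) ℝ} {a b D η : ℝ}

/-- The bias is of second order: the average of the squared signal is `o(n^{-1/2})`, and so is the
squared bandwidth `n^{-2η'}` because `η' > 1/4`. -/
lemma SignalBounds.eventually_abs_smooth_sub_le (h : SignalBounds X D η) (hm : Proportional m a b)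
    (hη : 0 < η) (hp : IsNoiseDensity p M₁ M₂) (hK : IsKernel K B) {η' : ℝ} (hη' : 1 / 4 < η')
    {δ : ℝ} (hδ : 0 < δ) : ∀ᶠ n : ℕ in atTop, ∀ x,
      |smooth K ((n : ℝ) ^ (-η')) (avgSub (X n)) p x - p x| ≤ δ * (n : ℝ) ^ (-(1 / 2) : ℝ) := by
  have hlim := ((h.tendsto_avg_sq hm hη).const_mul (2 * M₂)).add
    ((tendsto_natCast_rpow_neg (show 0 < 2 * η' - 1 / 2 by linarith)).const_mul (2 * M₂ * B))
  rw [mul_zero, mul_zero, add_zero] at hlim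
  filter_upwards [hlim.eventually_le_const hδ, hm.sqrt_mul_le] with n h1 ⟨hn, hm0, _, _⟩ x
  have hmn : (m n : ℝ) * n ≠ 0 := by positivity
  refine (abs_smooth_sub_le hK hmn hp.hasDerivAt hp.abs_le hp.bound_nonneg hp.abs_deriv_sub_le
    (avg_avgSub hmn _) x).trans ?_
  have e2 : (n : ℝ) ^ (-(2 * η' - 1 / 2)) * (n : ℝ) ^ (-(1 / 2) : ℝ) = ((n : ℝ) ^ (-η')) ^ 2 := by
    rw [← Real.rpow_add hn, ← Real.rpow_natCast, ← Real.rpow_mul hn.le]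
    congr 1; push_cast; ring
  have e3 : Real.sqrt n * (n : ℝ) ^ (-(1 / 2) : ℝ) = 1 := by
    rw [Real.sqrt_eq_rpow, ← Real.rpow_add hn]; norm_num
  have hM := hp.bound_nonneg
  calc _ ≤ 2 * M₂ * (avg (fun i j => X n i j ^ 2) + ((n : ℝ) ^ (-η')) ^ 2 * B) := by
        gcongr; exact avg_avgSub_sq_le hmn _
    _ = (2 * M₂ * (Real.sqrt n * avg (fun i j => X n i j ^ 2)) +
          2 * M₂ * B * (n : ℝ) ^ (-(2 * η' - 1 / 2))) * (n : ℝ) ^ (-(1 / 2) : ℝ) := by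
        rw [← e2]
        linear_combination (-(2 * M₂ * avg (fun i j => X n i j ^ 2))) * e3
    _ ≤ _ := by gcongr

lemma SignalBounds.tendsto_avg_sq_zero (h : SignalBounds X D η) (hm : Proportional m a b)
    (hη : 0 < η) : Tendsto (fun n : ℕ => avg (fun i j => X n i j ^ 2)) atTop (𝓝 0) := by
  refine squeeze_zero' (Eventually.of_forall fun n => avg_nonneg fun _ _ => sq_nonneg _) ?_
    (h.tendsto_avg_sq hm hη)
  filter_upwards [eventually_ge_atTop 1] with n hn
  have : (1 : ℝ) ≤ Real.sqrt n := Real.one_le_sqrt.2 (by exact_mod_cast hn)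
  exact le_mul_of_one_le_left (avg_nonneg fun _ _ => sq_nonneg _) this

lemma SignalBounds.eventually_abs_smooth_deriv_sub_le (h : SignalBounds X D η)
    (hm : Proportional m a b) (hη : 0 < η) (hp : IsNoiseDensity p M₁ M₂) (hK : IsKernel K B)
    {η' : ℝ} (hη' : 0 < η') {δ : ℝ} (hδ : 0 < δ) : ∀ᶠ n : ℕ in atTop, ∀ x,
      |smooth K ((n : ℝ) ^ (-η')) (avgSub (X n)) (deriv p) x - deriv p x| ≤ δ := by
  have hM := hp.bound_nonneg
  -- Half of `δ` goes to the Lipschitz term `M₂ * θ`, the other half to the second moments, which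
  -- tend to zero for this fixed `θ`.
  set θ : ℝ := δ / (2 * (M₂ + 1)) with hθ
  have hθ0 : 0 < θ := by positivity
  have hlim := ((h.tendsto_avg_sq_zero hm hη).const_mul (2 * M₂ / θ)).add
    ((tendsto_natCast_rpow_neg (show 0 < 2 * η' by linarith)).const_mul (2 * M₂ * B / θ))
  rw [mul_zero, mul_zero, add_zero] at hlim
  filter_upwards [hlim.eventually_le_const (half_pos hδ), hm.sqrt_mul_le] with n h1 ⟨hn, hm0, _, _⟩ x
  have hmn : (m n : ℝ) * n ≠ 0 := by positivity
  refine (abs_smooth_sub_le_of_lipschitz hK hmn hp.abs_deriv_le hp.abs_deriv_sub_le hθ0 x).trans ?_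
  have e2 : (n : ℝ) ^ (-(2 * η')) = ((n : ℝ) ^ (-η')) ^ 2 := by
    rw [← Real.rpow_natCast, ← Real.rpow_mul hn.le]
    congr 1; push_cast; ring
  have e3 : M₂ * θ ≤ δ / 2 := by
    rw [hθ, mul_div_assoc', div_le_div_iff₀ (by positivity) (by norm_num)]
    nlinarith
  calc _ ≤ M₂ * (θ + 2 * (avg (fun i j => X n i j ^ 2) + ((n : ℝ) ^ (-η')) ^ 2 * B) / θ) := by
        gcongr; exact avg_avgSub_sq_le hmn _
    _ = M₂ * θ + (2 * M₂ / θ * avg (fun i j => X n i j ^ 2) +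
          2 * M₂ * B / θ * (n : ℝ) ^ (-(2 * η'))) := by
        rw [← e2]; ring
    _ ≤ _ := by linarith

/-- The regularised score formed from the means of the kernel estimates. -/
noncomputable def smoothScore (K p : ℝ → ℝ) (η₁ η₂ ε : ℝ) {m n : ℕ} (X : Matrix (Fin m) (Fin n) ℝ) : ℝ → ℝ :=
  regRatio ε (smooth K ((n : ℝ) ^ (-η₂)) (avgSub X) (deriv p))
    (smooth K ((n : ℝ) ^ (-η₁)) (avgSub X) p)

lemma SignalBounds.eventually_isApproxScore (h : SignalBounds X D η) (hm : Proportional m a b)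
    (hη : 0 < η) (hp : IsNoiseDensity p M₁ M₂) (hK : IsKernel K B) {η₁ η₂ : ℝ} (hη₁ : 1 / 4 < η₁)
    (hη₂ : 1 / 4 < η₂) {ε δ : ℝ} (hε : 0 < ε) (hδ : 0 < δ) : ∀ᶠ n : ℕ in atTop, ∃ β',
      IsApproxScore p M₂ ε δ (δ * (n : ℝ) ^ (-(1 / 2) : ℝ)) (smoothScore K p η₁ η₂ ε (X n)) β' := by
  have hM := hp.bound_nonneg
  have hA : 0 ≤ ∫ x, |deriv p x| := integral_nonneg fun _ => abs_nonneg _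
  -- The factor by which the bias of the smoothed density enters the mean of the approximate score;
  -- the summand 1 keeps it positive.
  set c : ℝ := M₂ / ε ^ 2 + (∫ x, |deriv p x|) / ε + 1 with hc
  have hc0 : 0 < c := by positivity
  have hc1 : M₂ / ε ^ 2 ≤ c := by
    have : 0 ≤ (∫ x, |deriv p x|) / ε := by positivity
    rw [hc]; linarith
  filter_upwards [h.eventually_abs_smooth_sub_le hm hη hp hK hη₁ (δ := δ / (2 * c)) (by positivity),
    h.eventually_abs_smooth_sub_le hm hη hp hK hη₂ (δ := δ / (2 * c)) (by positivity),
    h.eventually_abs_smooth_deriv_sub_le hm hη hp hK (show 0 < η₂ by linarith)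
      (δ := δ * ε / 2) (by positivity), hm.sqrt_mul_le, eventually_ge_atTop 1]
    with n h1 h2 h3 ⟨hn, hm0, _, _⟩ hn1
  obtain ⟨β', hβ⟩ := isApproxScore_smooth hp hK (by positivity) hε h1 h2 h3
  have hr : (n : ℝ) ^ (-(1 / 2) : ℝ) ≤ 1 :=
    Real.rpow_le_one_of_one_le_of_nonpos (by exact_mod_cast hn1) (by norm_num)
  have hr0 : 0 ≤ (n : ℝ) ^ (-(1 / 2) : ℝ) := by positivity
  refine ⟨β', hβ.hasDerivAt, hβ.abs_le, hβ.abs_deriv_le, fun x => (hβ.abs_sub_score_le x).trans ?_,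
    hβ.abs_integral_le.trans ?_⟩
  · calc δ * ε / 2 / ε + M₂ * (δ / (2 * c) * (n : ℝ) ^ (-(1 / 2) : ℝ)) / ε ^ 2
        = δ / 2 + M₂ / ε ^ 2 * (δ / (2 * c)) * (n : ℝ) ^ (-(1 / 2) : ℝ) := by field_simp
      _ ≤ δ / 2 + c * (δ / (2 * c)) * 1 := by gcongr
      _ = δ := by field_simp; ring
  · calc _ ≤ δ / (2 * c) * (n : ℝ) ^ (-(1 / 2) : ℝ) * c := by gcongr; rw [hc]; linarith
      _ = δ / 2 * (n : ℝ) ^ (-(1 / 2) : ℝ) := by field_simp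
      _ ≤ _ := by gcongr; linarith

variable {Ω : Type*} [MeasurableSpace Ω] {P : Measure Ω}

/-- The estimated denoiser is uniformly close to the shifted smoothed score. -/
lemma SignalBounds.negligible_fHat [IsProbabilityMeasure P] (h : SignalBounds X D η)
    (hm : Proportional m a b) (hη : 0 < η) (hD : 0 ≤ D) (hp : IsNoiseDensity p M₁ M₂)
    (hK : IsKernel K B) {η₁ η₂ : ℝ} (hη₁ : η₁ ∈ Set.Ioo (0 : ℝ) 1)
    (hη₂ : η₂ ∈ Set.Ioo (0 : ℝ) (1 / 3))
    {W : ∀ n : ℕ, Ω → Matrix (Fin (m n)) (Fin n) ℝ} (hW : ∀ n, HasIIDEntries P (W n) (noiseLaw p))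
    {ε δ : ℝ} (hε : 0 < ε) (hδ : 0 < δ) :
    Negligible P fun n => {ω | ∃ x,
      (∀ y, (∀ i j, |(X n + W n ω) i j| ≤ y) → |x + avg (X n + W n ω)| ≤ 2 * y) ∧
      δ * (n : ℝ) ^ (-(1 / 2) : ℝ) <
        |fHat K ((n : ℝ) ^ (-η₁)) ((n : ℝ) ^ (-η₂)) ε (X n + W n ω) x -
          smoothScore K p η₁ η₂ ε (X n) (x + avg (X n + W n ω) - avg (X n))|} := by
  have hM := hp.bound_nonneg
  set c : ℝ := 1 / ε + M₂ / ε ^ 2 with hc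
  have hc0 : 0 < c := by positivity
  have hX := h.abs_le hD hη.le
  -- Normalising by `m n h` or `m n h²` turns these deviations into `δ/c · n^{-1/2}` for the density
  -- (`r = 0`, needing `η₁ < 1`) and for its derivative (`r = 1`, needing `3 η₂ < 1`).
  have g0 := negligible_kernelSum hp hK.isRegularKernel hm hD hX hW hη₁.1 0
    (by have := hη₁.2; push_cast; linarith) (δ := δ / c) (by positivity)
  have g1 := negligible_kernelSum hp hK.isRegularKernel_deriv hm hD hX hW hη₂.1 1
    (by have := hη₂.2; push_cast; linarith) (δ := δ / c) (by positivity)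
  refine (g0.union g1).mono ?_
  filter_upwards [hm.sqrt_mul_le] with n ⟨hn, hm0, _, _⟩ ω hω
  obtain ⟨x, hx, hgt⟩ := hω
  by_contra hcon
  simp only [Set.mem_union, Set.mem_ofPred_eq, not_or, not_exists, not_and, not_lt] at hcon
  have k0 := hcon.1 _ hx
  have k1 := hcon.2 _ hx
  refine absurd hgt (not_lt.2 ?_)
  set Y := X n + W n ω
  have hh₁ : 0 < (n : ℝ) ^ (-η₁) := by positivity
  have hh₂ : 0 < (n : ℝ) ^ (-η₂) := by positivity
  set h₁ := (n : ℝ) ^ (-η₁) with hh₁'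
  set h₂ := (n : ℝ) ^ (-η₂) with hh₂'
  have hmn : 0 < (m n : ℝ) * n := by positivity
  have l0 : |pHat K h₁ Y x - smooth K h₁ (avgSub (X n)) p (x + avg Y - avg (X n))| ≤
      δ / c * (n : ℝ) ^ (-(1 / 2) : ℝ) := by
    rw [pHat_eq_kernelSum, ← one_div_mul_kernelMean hh₁, ← mul_sub, abs_mul,
      abs_of_pos (by positivity), one_div, inv_mul_le_iff₀ (by positivity)]
    refine k0.trans (le_of_eq ?_)
    ring
  have l1 : |pHatDeriv K h₂ Y x - smooth K h₂ (avgSub (X n)) (deriv p) (x + avg Y - avg (X n))| ≤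
      δ / c * (n : ℝ) ^ (-(1 / 2) : ℝ) := by
    rw [pHatDeriv_eq_kernelSum, ← neg_one_div_mul_kernelMean_deriv hp hK hh₂, neg_sub_neg, ← mul_sub,
      abs_mul, abs_of_pos (by positivity), one_div, inv_mul_le_iff₀ (by positivity), abs_sub_comm]
    refine k1.trans (le_of_eq ?_)
    ring
  refine (abs_regRatio_sub_le (q₁ := pHatDeriv K h₂ Y) (q₀ := pHat K h₁ Y) hε
    (pHat_nonneg hK hh₁.le Y x) (smooth_nonneg hK hp.nonneg _)).trans ?_
  calc _ ≤ δ / c * (n : ℝ) ^ (-(1 / 2) : ℝ) / ε + M₂ * (δ / c * (n : ℝ) ^ (-(1 / 2) : ℝ)) / ε ^ 2 := by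
        gcongr
        exact abs_smooth_le hK hmn.ne' hp.abs_deriv_le _
    _ = δ / c * (n : ℝ) ^ (-(1 / 2) : ℝ) * c := by rw [hc]; ring
    _ = _ := by field_simp

end SmoothScore

/-! ### The operator norm of the error -/

lemma avg_add {m n : ℕ} (A B : Matrix (Fin m) (Fin n) ℝ) : avg (A + B) = avg A + avg B := by
  simp only [avg, Matrix.add_apply, Finset.sum_add_distrib, add_div]

section Deterministic

variable {p β β' : ℝ → ℝ} {M₁ M₂ ε δ κ : ℝ} {m n : ℕ}

/-- The matrix of the means of an approximate score at shifted arguments. -/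
lemma IsApproxScore.opNorm_integral_shift_le (h : IsApproxScore p M₂ ε δ κ β β')
    (hp : IsNoiseDensity p M₁ M₂) (hε : 0 < ε) (X : Matrix (Fin m) (Fin n) ℝ) (I : ℝ) :
    opNorm (fun i j => (∫ w, β (w + X i j) * p w) - I * X i j : Matrix (Fin m) (Fin n) ℝ) ≤
      κ * Real.sqrt ((m : ℝ) * n) +
      (|(-∫ x, regRatio ε (deriv p) p x * deriv p x) - I| + δ * ∫ x, |deriv p x|) * opNorm X +
      (M₂ / ε + M₂ ^ 2 / ε ^ 2) * (∫ x, |deriv p x|) * opNorm (Matrix.hadamard X X) := by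
  have hA : 0 ≤ ∫ x, |deriv p x| := integral_nonneg fun _ => abs_nonneg _
  have h2 := h.abs_integral_mul_deriv_sub_le hp hε
  have h1 := hp.abs_integral_shift_sub_le h.hasDerivAt h.abs_le h.abs_deriv_le
  have hb := h.abs_integral_le
  have hM := hp.bound_nonneg
  set A := ∫ x, |deriv p x|
  set c₀ := ∫ x, β x * p x
  set c := ∫ x, β x * deriv p x
  set d := ∫ x, regRatio ε (deriv p) p x * deriv p x
  set l := M₂ / ε + M₂ ^ 2 / ε ^ 2
  -- Split into the constant matrix of the mean of `β`, the multiple of `X` with coefficient `-∫ β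
  -- p' - I`, and a Taylor remainder dominated entrywise by a multiple of `X ⊙ X`.
  set R : Matrix (Fin m) (Fin n) ℝ := fun i j => (∫ w, β (w + X i j) * p w) - c₀ + X i j * c with hR
  set C₀ : Matrix (Fin m) (Fin n) ℝ := fun _ _ => c₀ with hC₀
  have e : (fun i j => (∫ w, β (w + X i j) * p w) - I * X i j : Matrix (Fin m) (Fin n) ℝ) =
      (C₀ + (-c - I) • X) + R := by
    ext i j
    change _ = c₀ + (-c - I) * X i j + ((∫ w, β (w + X i j) * p w) - c₀ + X i j * c)
    ring
  rw [e]
  refine (opNorm_add_le _ _).trans (add_le_add ((opNorm_add_le _ _).trans (add_le_add ?_ ?_)) ?_)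
  · exact opNorm_le_of_forall_abs_le ((abs_nonneg _).trans hb) fun _ _ => hb
  · rw [opNorm_smul]
    refine mul_le_mul_of_nonneg_right ?_ (opNorm_nonneg _)
    have e2 : -c - I = (-d - I) - (c - d) := by ring
    rw [e2]
    exact (abs_sub _ _).trans (add_le_add_right h2 _)
  · have hl : 0 ≤ l * A := by positivity
    rw [← abs_of_nonneg hl, ← opNorm_smul]
    refine opNorm_le_of_abs_le fun i j => ?_
    simpa only [Matrix.smul_apply, Matrix.hadamard_apply, smul_eq_mul, sq] using h1 (X i j)

end Deterministic

section

variable {p K : ℝ → ℝ} {M₁ M₂ B : ℝ} {m : ℕ → ℕ} {X : ∀ n : ℕ, Matrix (Fin (m n)) (Fin n) ℝ}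
  {a b D η : ℝ} {Ω : Type*} [MeasurableSpace Ω] {P : Measure Ω}

lemma Proportional.sqrt_add_le (hm : Proportional m a b) :
    ∀ᶠ n : ℕ in atTop, Real.sqrt ((m n : ℝ) + n) ≤ Real.sqrt (b + 1) * Real.sqrt n := by
  filter_upwards [hm.eventually_le] with n h1
  rw [← Real.sqrt_mul' _ n.cast_nonneg]
  apply Real.sqrt_le_sqrt
  linarith [h1.2]

/-- The centred parts of the error. -/
lemma SignalBounds.negligible_centered [IsProbabilityMeasure P] (h : SignalBounds X D η)
    (hm : Proportional m a b) (hη : 0 < η) (hD : 0 < D) (hp : IsNoiseDensity p M₁ M₂)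
    {W : ∀ n : ℕ, Ω → Matrix (Fin (m n)) (Fin n) ℝ} (hW : ∀ n, HasIIDEntries P (W n) (noiseLaw p))
    {ε δ : ℝ} (hε : 0 < ε) (hδ : 0 < δ) {β : ℕ → ℝ → ℝ} (hβm : ∀ n, Measurable (β n)) {C : ℝ}
    (hβC : ∀ n x, |β n x| ≤ C)
    (hβ : ∀ᶠ n : ℕ in atTop, ∀ x, |β n x - regRatio ε (deriv p) p x| ≤ δ) :
    Negligible P fun n => {ω | (24 * Real.sqrt (b + 1) + 1) * δ * Real.sqrt n <
      opNorm (fun i j => (β n (X n i j + W n ω i j) - regRatio ε (deriv p) p (W n ω i j)) -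
        ∫ w, β n (w + X n i j) * p w : Matrix (Fin (m n)) (Fin n) ℝ)} := by
  classical
  set f := regRatio ε (deriv p) p with hf
  have hfm : Measurable f := hp.measurable_score ε
  have hfC := hp.abs_score_le hε
  have hM := hp.bound_nonneg
  set l := M₂ / ε + M₂ ^ 2 / ε ^ 2 with hl
  have hl0 : 0 ≤ l := by positivity
  have hx : ∀ s : ℝ, Measurable fun w : ℝ => s + w := fun s => measurable_id.const_add s
  have i1 : ∀ n s, Integrable fun w => β n (s + w) * p w := fun n s =>
    hp.integrable_bdd_mul ((hβm n).comp (hx s)) fun x => hβC n _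
  have i2 : ∀ s, Integrable fun w => f (s + w) * p w := fun s =>
    hp.integrable_bdd_mul (hfm.comp (hx s)) fun x => hfC _
  have i3 : Integrable fun w => f w * p w := hp.integrable_bdd_mul hfm hfC
  set c : ℝ := C + M₂ / ε with hc
  -- Closeness to the score is known only for large `n`, whereas a family of entry bounds is
  -- required for every `n`; for the remaining `n` the trivial bound `c` is used.
  set cβ : ∀ n : ℕ, Fin (m n) → Fin n → ℝ := fun n _ _ =>
    if ∀ x, |β n x - f x| ≤ δ then δ else c with hcβ
  have A1 := negligible_opNorm (P := P) (R := 2 * δ) (by positivity)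
    (fun n => isCenteredBounded_comp hp (hW n)
      (φ := fun i j w => β n (X n i j + w) - f (X n i j + w))
      (fun i j => ((hβm n).comp (hx _)).sub (hfm.comp (hx _))) (c := cβ n) fun i j w => by
        simp only [hcβ]
        split_ifs with h0
        · exact h0 _
        · exact (abs_sub _ _).trans (add_le_add (hβC n _) (hfC _)))
    (by
      filter_upwards [hβ] with n hn i j
      simp only [hcβ, if_pos hn]
      rw [abs_of_pos (by positivity)])
  have hrow : ∀ {S Q : ℝ}, S ≤ Q ^ 2 → 4 * l ^ 2 * S ≤ (2 * l * Q) ^ 2 := fun {S Q} hS => by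
    nlinarith [sq_nonneg l]
  -- The Lipschitz bound makes these entries at most a multiple of `|X n i j|`, so the smallness of
  -- the rows and columns of the signal is inherited. The centring constant of `f (W)` is zero.
  have A2 := negligible_opNorm_of_rows (P := P) hm (D := 2 * l * D + 1) (by positivity) hη
    (fun n => isCenteredBounded_comp hp (hW n)
      (φ := fun i j w => f (X n i j + w) - f w)
      (fun i j => (hfm.comp (hx _)).sub hfm) (c := fun i j => l * |X n i j|) fun i j w => by
        refine (hp.abs_score_sub_le hε _ _).trans (le_of_eq ?_)
        rw [add_sub_cancel_right])
    (by
      filter_upwards [h.row] with n hn i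
      calc _ = 4 * l ^ 2 * ∑ j, X n i j ^ 2 := by
            rw [Finset.mul_sum]
            refine Finset.sum_congr rfl fun j _ => ?_
            rw [mul_pow, mul_pow, sq_abs]; ring
        _ ≤ (2 * l * (D * (n : ℝ) ^ (1 / 2 - η))) ^ 2 := hrow (hn i)
        _ ≤ _ := by
            rw [← mul_assoc]
            gcongr
            linarith)
    (by
      filter_upwards [h.col] with n hn j
      calc _ = 4 * l ^ 2 * ∑ i, X n i j ^ 2 := by
            rw [Finset.mul_sum]
            refine Finset.sum_congr rfl fun i _ => ?_
            rw [mul_pow, mul_pow, sq_abs]; ring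
        _ ≤ (2 * l * (D * (n : ℝ) ^ (1 / 2 - η))) ^ 2 := hrow (hn j)
        _ ≤ _ := by
            rw [← mul_assoc]
            gcongr
            linarith) hδ
  refine (A1.union A2).mono ?_
  filter_upwards [hm.sqrt_add_le] with n hn ω hω
  by_contra hcon
  simp only [Set.mem_union, Set.mem_ofPred_eq, not_or, not_lt] at hcon
  rw [Set.mem_ofPred_eq] at hω
  refine absurd hω (not_lt.2 ?_)
  refine le_trans (le_of_eq (congrArg opNorm ?_)) ((opNorm_add_le _ _).trans
    ((add_le_add hcon.1 hcon.2).trans ?_))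
  · ext i j
    change _ = (β n (X n i j + W n ω i j) - f (X n i j + W n ω i j) -
      ∫ w, (β n (X n i j + w) - f (X n i j + w)) * p w) +
      (f (X n i j + W n ω i j) - f (W n ω i j) - ∫ w, (f (X n i j + w) - f w) * p w)
    have e1 : ∫ w, (β n (X n i j + w) - f (X n i j + w)) * p w =
        (∫ w, β n (X n i j + w) * p w) - ∫ w, f (X n i j + w) * p w := by
      rw [← integral_sub (i1 _ _) (i2 _)]
      simp only [sub_mul]
    have e2 : ∫ w, (f (X n i j + w) - f w) * p w = ∫ w, f (X n i j + w) * p w := by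
      simp only [sub_mul]
      rw [integral_sub (i2 _) i3, hp.integral_score_mul hε, sub_zero]
    rw [e1, e2]
    simp only [add_comm (X n i j)]
    ring
  · calc _ ≤ 12 * (2 * δ) * (Real.sqrt (b + 1) * Real.sqrt n) + δ * Real.sqrt n := by gcongr
      _ = _ := by ring

/-- The error of the denoiser, in the decomposition with signal strength `I` and noise
`f_ε(W) + φ(W)`. -/
noncomputable def errorMatrix (K p : ℝ → ℝ) (η₁ η₂ ε I : ℝ) (φ : ℝ → ℝ) {m n : ℕ}
    (X W : Matrix (Fin m) (Fin n) ℝ) : Matrix (Fin m) (Fin n) ℝ :=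
  fun i j => fHat K ((n : ℝ) ^ (-η₁)) ((n : ℝ) ^ (-η₂)) ε (X + W) ((X + W) i j) - I * X i j -
    (regRatio ε (deriv p) p (W i j) + φ (W i j))

/-- Of the threshold, the terms in `D` and `R` vanish only as `ε → 0`: they come from the mismatch
between the regularised slope and `I`, and from the variance correction `φ`. The term in `n * |avg|`
stays explicit because its tail does not decay faster than every power of `n` under two moments
alone. -/
lemma SignalBounds.negligible_errorMatrix [IsProbabilityMeasure P] (h : SignalBounds X D η)
    (hm : Proportional m a b) (hη : 0 < η) (hD : 0 < D) (hp : IsNoiseDensity p M₁ M₂)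
    (hK : IsKernel K B) {η₁ η₂ : ℝ} (hη₁ : η₁ ∈ Set.Ioo (1 / 4 : ℝ) 1)
    (hη₂ : η₂ ∈ Set.Ioo (1 / 4 : ℝ) (1 / 3))
    {W : ∀ n : ℕ, Ω → Matrix (Fin (m n)) (Fin n) ℝ} (hW : ∀ n, HasIIDEntries P (W n) (noiseLaw p))
    {ε δ I R : ℝ} (hε : 0 < ε) (hδ : 0 < δ) {φ : ℝ → ℝ} (hφm : Measurable φ)
    (hφ : ∀ x, |φ x| ≤ R) (hφ0 : ∫ x, φ x * p x = 0) :
    Negligible P fun n => {ω |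
      (D * |(-∫ x, regRatio ε (deriv p) p x * deriv p x) - I| + 24 * Real.sqrt (b + 1) * R + δ) *
        Real.sqrt n + (M₂ / ε + M₂ ^ 2 / ε ^ 2) * Real.sqrt b * (n * |avg (W n ω)|) <
      opNorm (errorMatrix K p η₁ η₂ ε I φ (X n) (W n ω))} := by
  have hM := hp.bound_nonneg
  have hR : 0 ≤ R := (abs_nonneg _).trans (hφ 0)
  set A := ∫ x, |deriv p x| with hA
  have hA0 : 0 ≤ A := integral_nonneg fun _ => abs_nonneg _
  set l := M₂ / ε + M₂ ^ 2 / ε ^ 2 with hl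
  have hl0 : 0 ≤ l := by positivity
  set J := |(-∫ x, regRatio ε (deriv p) p x * deriv p x) - I| with hJ
  -- The sum of all the coefficients with which the tolerance `θ` appears in the bounds for the
  -- pieces below, so that they add up to `δ`.
  set S : ℝ := 2 * Real.sqrt b + 48 * Real.sqrt (b + 1) + 2 + A * D with hS
  have hS0 : 0 < S := by positivity
  set θ : ℝ := δ / S with hθ
  have hθ0 : 0 < θ := by positivity
  have hθS : θ * S = δ := div_mul_cancel₀ _ hS0.ne'
  have hh₁ : 0 < η₁ := by linarith [hη₁.1]
  have hh₂ : 0 < η₂ := by linarith [hη₂.1]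
  classical
  -- The smoothed score where it is known to be an approximate score, and the exact one otherwise:
  -- measurability and the bound `M₂ / ε` then hold for all `n`.
  set β : ℕ → ℝ → ℝ := fun n => if ∃ β', IsApproxScore p M₂ ε θ (θ * (n : ℝ) ^ (-(1 / 2) : ℝ))
    (smoothScore K p η₁ η₂ ε (X n)) β' then smoothScore K p η₁ η₂ ε (X n) else
    regRatio ε (deriv p) p with hβ
  have hβe := h.eventually_isApproxScore hm hη hp hK hη₁.1 hη₂.1 hε hθ0
  have hβm : ∀ n, Measurable (β n) := fun n => by
    simp only [hβ]; split_ifs with h0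
    · exact h0.choose_spec.continuous.measurable
    · exact hp.measurable_score ε
  have hβC : ∀ n x, |β n x| ≤ M₂ / ε := fun n => by
    simp only [hβ]; split_ifs with h0
    · exact h0.choose_spec.abs_le
    · exact hp.abs_score_le hε
  have hβs : ∀ᶠ n : ℕ in atTop, ∀ x, |β n x - regRatio ε (deriv p) p x| ≤ θ := by
    filter_upwards [hβe] with n hn
    simp only [hβ, if_pos hn]
    exact hn.choose_spec.abs_sub_score_le
  have E1 := h.negligible_fHat hm hη hD.le hp hK ⟨hh₁, hη₁.2⟩ ⟨hh₂, hη₂.2⟩ hW hε hθ0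
  have E3 := h.negligible_centered hm hη hD hp hW hε hθ0 hβm hβC hβs
  -- The bound `R + θ` replaces `R`, which may vanish, because a positive bound is required.
  have E6 := negligible_opNorm (P := P) (R := 2 * (R + θ)) (by positivity)
    (fun n => isCenteredBounded_comp hp (hW n) (φ := fun _ _ => φ) (fun _ _ => hφm)
      (c := fun _ _ => R + θ) fun _ _ w => (hφ w).trans (by linarith))
    (Eventually.of_forall fun n i j => by rw [abs_of_pos (by positivity)])
  refine ((E1.union E3).union E6).mono ?_
  have hnη := (tendsto_natCast_rpow_neg hη).const_mul (l * A * D)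
  rw [mul_zero] at hnη
  filter_upwards [hm.sqrt_mul_le, hm.sqrt_add_le, hβe, h.opNorm_le, h.opNorm_hadamard_le,
    hnη.eventually_le_const hθ0] with n ⟨hn, hm0, _, hmn⟩ hadd ⟨β', hsc⟩ hX1 hX2 hnη ω hω
  have hsq : (n : ℝ) ^ (-(1 / 2) : ℝ) * n = Real.sqrt n := by
    rw [Real.sqrt_eq_rpow]
    nth_rewrite 2 [← Real.rpow_one (n : ℝ)]
    rw [← Real.rpow_add hn]; norm_num
  have hβn : β n = smoothScore K p η₁ η₂ ε (X n) := if_pos ⟨β', hsc⟩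
  by_contra hcon
  simp only [Set.mem_union, Set.mem_ofPred_eq, not_or, not_lt, hβn, not_exists, not_and] at hcon
  obtain ⟨⟨g1, g3⟩, g6⟩ := hcon
  rw [Set.mem_ofPred_eq] at hω
  refine absurd hω (not_lt.2 ?_)
  set b₀ := smoothScore K p η₁ η₂ ε (X n) with hb₀
  set Y := X n + W n ω with hY
  -- The denoiser is evaluated at `Y i j`, not at the recentred entry, so its argument is displaced
  -- by exactly the average of the noise.
  have havg : avg Y - avg (X n) = avg (W n ω) := by rw [hY, avg_add]; ring
  set t1 : Matrix (Fin (m n)) (Fin n) ℝ := fun i j =>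
    fHat K ((n : ℝ) ^ (-η₁)) ((n : ℝ) ^ (-η₂)) ε Y (Y i j) - b₀ (Y i j + avg (W n ω)) with ht1
  set t2 : Matrix (Fin (m n)) (Fin n) ℝ := fun i j => b₀ (Y i j + avg (W n ω)) - b₀ (Y i j) with ht2
  set t3 : Matrix (Fin (m n)) (Fin n) ℝ := fun i j =>
    (b₀ (X n i j + W n ω i j) - regRatio ε (deriv p) p (W n ω i j)) -
        ∫ w, b₀ (w + X n i j) * p w with ht3
  set t5 : Matrix (Fin (m n)) (Fin n) ℝ := fun i j =>
    (∫ w, b₀ (w + X n i j) * p w) - I * X n i j with ht5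
  set t6 : Matrix (Fin (m n)) (Fin n) ℝ := fun i j => φ (W n ω i j) - ∫ x, φ x * p x with ht6
  have e : errorMatrix K p η₁ η₂ ε I φ (X n) (W n ω) = (((t1 + t2) + t3) + t5) + (-1 : ℝ) • t6 := by
    ext i j
    change fHat K ((n : ℝ) ^ (-η₁)) ((n : ℝ) ^ (-η₂)) ε Y (Y i j) - I * X n i j -
      (regRatio ε (deriv p) p (W n ω i j) + φ (W n ω i j)) = t1 i j + t2 i j + t3 i j + t5 i j +
      (-1) * t6 i j
    have hYij : X n i j + W n ω i j = Y i j := rfl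
    simp only [ht1, ht2, ht3, ht5, ht6, hφ0, hYij]
    ring
  have b1 : opNorm t1 ≤ θ * (n : ℝ) ^ (-(1 / 2) : ℝ) * Real.sqrt ((m n : ℝ) * n) := by
    refine opNorm_le_of_forall_abs_le (by positivity) fun i j => ?_
    have := g1 (Y i j) fun y hy => by
      have := abs_avg_le_of_forall (by positivity) hy
      calc _ ≤ |Y i j| + |avg Y| := abs_add_le _ _
        _ ≤ 2 * y := by linarith [hy i j]
    rwa [add_sub_assoc, havg] at this
  have b2 : opNorm t2 ≤ l * |avg (W n ω)| * Real.sqrt ((m n : ℝ) * n) := by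
    refine opNorm_le_of_forall_abs_le (by positivity) fun i j => ?_
    refine (hsc.abs_sub_le _ _).trans (le_of_eq ?_)
    rw [add_sub_cancel_left]
  have b5 := hsc.opNorm_integral_shift_le hp hε (X n) I
  have b6 : opNorm ((-1 : ℝ) • t6) ≤ 12 * (2 * (R + θ)) * Real.sqrt ((m n : ℝ) + n) := by
    rw [opNorm_smul, abs_neg, abs_one, one_mul]
    exact g6
  rw [e]
  have hJ0 : 0 ≤ J := abs_nonneg _
  have hn2 : (n : ℝ) ^ (1 / 2 - η) = (n : ℝ) ^ (-η) * Real.sqrt n := by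
    rw [Real.sqrt_eq_rpow, ← Real.rpow_add hn]; ring_nf
  have c1 : θ * (n : ℝ) ^ (-(1 / 2) : ℝ) * Real.sqrt ((m n : ℝ) * n) ≤
      θ * Real.sqrt b * Real.sqrt n := by
    calc _ ≤ θ * (n : ℝ) ^ (-(1 / 2) : ℝ) * (Real.sqrt b * n) := by gcongr
      _ = θ * Real.sqrt b * ((n : ℝ) ^ (-(1 / 2) : ℝ) * n) := by ring
      _ = _ := by rw [hsq]
  have c2 : l * |avg (W n ω)| * Real.sqrt ((m n : ℝ) * n) ≤
      l * Real.sqrt b * (n * |avg (W n ω)|) := by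
    calc _ ≤ l * |avg (W n ω)| * (Real.sqrt b * n) := by gcongr
      _ = _ := by ring
  have c5 : (J + θ * A) * opNorm (X n) ≤ (J + θ * A) * (D * Real.sqrt n) := by gcongr
  have c5' : l * A * opNorm (Matrix.hadamard (X n) (X n)) ≤ θ * Real.sqrt n := by
    calc _ ≤ l * A * (D * ((n : ℝ) ^ (-η) * Real.sqrt n)) := by rw [← hn2]; gcongr
      _ = l * A * D * (n : ℝ) ^ (-η) * Real.sqrt n := by ring
      _ ≤ _ := by gcongr
  have c6 : 12 * (2 * (R + θ)) * Real.sqrt ((m n : ℝ) + n) ≤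
      24 * (R + θ) * (Real.sqrt (b + 1) * Real.sqrt n) := by
    calc _ ≤ 12 * (2 * (R + θ)) * (Real.sqrt (b + 1) * Real.sqrt n) := by gcongr
      _ = _ := by ring
  have s1 := opNorm_add_le (((t1 + t2) + t3) + t5) ((-1 : ℝ) • t6)
  have s2 := opNorm_add_le ((t1 + t2) + t3) t5
  have s3 := opNorm_add_le (t1 + t2) t3
  have s4 := opNorm_add_le t1 t2
  have hfin : (D * J + 24 * Real.sqrt (b + 1) * R + δ) * Real.sqrt n =
      θ * Real.sqrt b * Real.sqrt n + (24 * Real.sqrt (b + 1) + 1) * θ * Real.sqrt n +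
      (θ * Real.sqrt b * Real.sqrt n + (J + θ * A) * (D * Real.sqrt n) + θ * Real.sqrt n) +
      24 * (R + θ) * (Real.sqrt (b + 1) * Real.sqrt n) := by
    rw [← hθS, hS]; ring
  linarith

end

/-! ### Consistency of the estimated Fisher information -/

lemma fisherHat_eq_avg {m n : ℕ} (K : ℝ → ℝ) (h h' ε : ℝ) (Y : Matrix (Fin m) (Fin n) ℝ) :
    fisherHat K h h' ε Y = avg (fun i j => fHat K h h' ε Y (Y i j - avg Y) ^ 2) + ε := by
  simp only [fisherHat, fHat, neg_sq]
  rw [one_div, inv_mul_eq_div]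
  rfl

/-- Young's inequality with weight `t`, so that only the mean square of the error `e` is needed
afterwards: single entries of the signal need not be small, but their squares average to zero. -/
lemma abs_sq_sub_sq_le {x y C e t : ℝ} (ht : 0 < t) (hy : |y| ≤ C) (hxy : |x - y| ≤ e) :
    |x ^ 2 - y ^ 2| ≤ t * C ^ 2 + (1 + 1 / t) * e ^ 2 := by
  have e1 : x ^ 2 - y ^ 2 = (x - y) ^ 2 + 2 * y * (x - y) := by ring
  have h0 : 0 ≤ |x - y| := abs_nonneg _
  have h1 : |x ^ 2 - y ^ 2| ≤ e ^ 2 + 2 * C * e := by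
    rw [e1]
    refine (abs_add_le _ _).trans (add_le_add ?_ ?_)
    · rw [abs_pow]; gcongr
    · rw [abs_mul, abs_mul, abs_two]
      have : 0 ≤ C := (abs_nonneg _).trans hy
      gcongr
  have h2 : 2 * C * e ≤ t * C ^ 2 + 1 / t * e ^ 2 := by
    have : 0 ≤ t * (C - e / t) ^ 2 := by positivity
    have e2 : t * (C - e / t) ^ 2 = t * C ^ 2 + 1 / t * e ^ 2 - 2 * C * e := by
      field_simp; ring
    linarith
  linarith

section

variable {p K : ℝ → ℝ} {M₁ M₂ B : ℝ} {m : ℕ → ℕ} {X : ∀ n : ℕ, Matrix (Fin (m n)) (Fin n) ℝ}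
  {a b D η : ℝ} {Ω : Type*} [MeasurableSpace Ω] {P : Measure Ω}

lemma SignalBounds.negligible_fisherHat [IsProbabilityMeasure P] (h : SignalBounds X D η)
    (hm : Proportional m a b) (hη : 0 < η) (hD : 0 < D) (hp : IsNoiseDensity p M₁ M₂)
    (hK : IsKernel K B) {η₁ η₂ : ℝ} (hη₁ : η₁ ∈ Set.Ioo (1 / 4 : ℝ) 1)
    (hη₂ : η₂ ∈ Set.Ioo (1 / 4 : ℝ) (1 / 3))
    {W : ∀ n : ℕ, Ω → Matrix (Fin (m n)) (Fin n) ℝ} (hW : ∀ n, HasIIDEntries P (W n) (noiseLaw p))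
    {ε δ : ℝ} (hε : 0 < ε) (hδ : 0 < δ) :
    Negligible P fun n => {ω | δ <
      |fisherHat K ((n : ℝ) ^ (-η₁)) ((n : ℝ) ^ (-η₂)) ε (X n + W n ω) -
        ((∫ x, regRatio ε (deriv p) p x ^ 2 * p x) + ε)|} := by
  have hM := hp.bound_nonneg
  set f := regRatio ε (deriv p) p with hf
  have hfm : Measurable f := hp.measurable_score ε
  have hfC := hp.abs_score_le hε
  set C := M₂ / ε with hC
  set l := M₂ / ε + M₂ ^ 2 / ε ^ 2 with hl
  -- Budget for `δ`: a quarter for the Young weight, an eighth for the uniform errors through `θ`,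
  -- an eighth for the signal, and a half for the law of large numbers.
  set t : ℝ := δ / (4 * (C ^ 2 + 1)) with ht
  have ht0 : 0 < t := by positivity
  have htC : t * C ^ 2 ≤ δ / 4 := by
    calc t * C ^ 2 ≤ t * (C ^ 2 + 1) := by gcongr; linarith
      _ = δ / 4 := by rw [ht]; field_simp
  set u : ℝ := 1 + 1 / t with hu
  have hu0 : 0 < u := by positivity
  set θ : ℝ := Real.sqrt (δ / (64 * u)) with hθ
  have hθ0 : 0 < θ := Real.sqrt_pos.2 (by positivity)
  have hθ2 : u * (8 * θ ^ 2) = δ / 8 := by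
    rw [hθ, Real.sq_sqrt (by positivity)]; field_simp; norm_num
  have hh₁ : 0 < η₁ := by linarith [hη₁.1]
  have hh₂ : 0 < η₂ := by linarith [hη₂.1]
  have E1 := h.negligible_fHat hm hη hD.le hp hK ⟨hh₁, hη₁.2⟩ ⟨hh₂, hη₂.2⟩ hW hε hθ0
  have E2 := negligible_avg (P := P) hp hm hW (hfm.pow_const 2) (C := C ^ 2)
    (fun x => by rw [abs_pow]; exact pow_le_pow_left₀ (abs_nonneg _) (hfC x) 2) (half_pos hδ)
  have hρ := (h.tendsto_avg_sq_zero hm hη).const_mul (u * (2 * l ^ 2))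
  rw [mul_zero] at hρ
  refine (E1.union E2).mono ?_
  filter_upwards [hm.sqrt_mul_le, h.eventually_isApproxScore hm hη hp hK hη₁.1 hη₂.1 hε hθ0,
    hρ.eventually_le_const (show 0 < δ / 8 by positivity), eventually_ge_atTop 1]
    with n ⟨hn, hm0, _, _⟩ ⟨β', hsc⟩ hρn hn1 ω hω
  by_contra hcon
  simp only [Set.mem_union, Set.mem_ofPred_eq, not_or, not_lt, not_exists, not_and] at hcon
  obtain ⟨g1, g2⟩ := hcon
  rw [Set.mem_ofPred_eq] at hω
  refine absurd hω (not_lt.2 ?_)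
  have hmn : (m n : ℝ) * n ≠ 0 := by positivity
  set b₀ := smoothScore K p η₁ η₂ ε (X n) with hb₀
  set Y := X n + W n ω with hY
  set F : Matrix (Fin (m n)) (Fin n) ℝ := fun i j =>
    fHat K ((n : ℝ) ^ (-η₁)) ((n : ℝ) ^ (-η₂)) ε Y (Y i j - avg Y) with hF
  have hr : (n : ℝ) ^ (-(1 / 2) : ℝ) ≤ 1 :=
    Real.rpow_le_one_of_one_le_of_nonpos (by exact_mod_cast hn1) (by norm_num)
  have hpt : ∀ i j, |F i j - f (W n ω i j)| ≤ 2 * θ + l * |avgSub (X n) i j| := fun i j => by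
    have k1 := g1 (Y i j - avg Y) fun y hy => by
      rw [sub_add_cancel]; linarith [hy i j, abs_nonneg (Y i j)]
    rw [sub_add_cancel] at k1
    have k2 := hsc.abs_sub_score_le (Y i j - avg (X n))
    have k3 := hp.abs_score_sub_le hε (Y i j - avg (X n)) (W n ω i j)
    -- The estimated information uses recentred arguments, so the noise average cancels and only the
    -- deviation of the signal from its mean remains.
    have k4 : |Y i j - avg (X n) - W n ω i j| = |avgSub (X n) i j| := by
      rw [← abs_neg]; congr 1
      change -(X n i j + W n ω i j - avg (X n) - W n ω i j) = avg (X n) - X n i j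
      ring
    rw [k4] at k3
    have k5 : θ * (n : ℝ) ^ (-(1 / 2) : ℝ) ≤ θ := mul_le_of_le_one_right hθ0.le hr
    have e : F i j - f (W n ω i j) = (F i j - b₀ (Y i j - avg (X n))) +
      (b₀ (Y i j - avg (X n)) - f (Y i j - avg (X n))) +
      (f (Y i j - avg (X n)) - f (W n ω i j)) := by ring
    rw [e]
    have k6 := abs_add_le ((F i j - b₀ (Y i j - avg (X n))) +
      (b₀ (Y i j - avg (X n)) - f (Y i j - avg (X n)))) (f (Y i j - avg (X n)) - f (W n ω i j))
    have k7 := abs_add_le (F i j - b₀ (Y i j - avg (X n)))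
      (b₀ (Y i j - avg (X n)) - f (Y i j - avg (X n)))
    linarith
  have hsq : ∀ i j, |1 * F i j ^ 2 + (-1) * f (W n ω i j) ^ 2 + 0| ≤
      (u * (2 * l ^ 2)) * avgSub (X n) i j ^ 2 + 0 * avgSub (X n) i j ^ 2 +
        (t * C ^ 2 + u * (8 * θ ^ 2)) := fun i j => by
    have e1 : 1 * F i j ^ 2 + (-1) * f (W n ω i j) ^ 2 + 0 = F i j ^ 2 - f (W n ω i j) ^ 2 := by ring
    rw [e1]
    refine (abs_sq_sub_sq_le ht0 (hfC _) (hpt i j)).trans ?_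
    have e2 : (2 * θ + l * |avgSub (X n) i j|) ^ 2 ≤ 8 * θ ^ 2 + 2 * l ^ 2 * avgSub (X n) i j ^ 2 := by
      have := sq_nonneg (2 * θ - l * |avgSub (X n) i j|)
      rw [← sq_abs (avgSub (X n) i j)]
      linarith
    have e3 := mul_le_mul_of_nonneg_left e2 hu0.le
    linarith
  have h1 := (abs_avg_le (fun i j => 1 * F i j ^ 2 + (-1) * f (W n ω i j) ^ 2 + 0)).trans
    (avg_mono hsq)
  rw [avg_affine hmn 1 (-1) 0, avg_affine hmn (u * (2 * l ^ 2)) 0] at h1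
  have h2 : u * (2 * l ^ 2) * avg (fun i j => avgSub (X n) i j ^ 2) ≤ δ / 8 :=
    (mul_le_mul_of_nonneg_left (avg_avgSub_sq_le hmn _) (by positivity)).trans hρn
  rw [fisherHat_eq_avg]
  have h3 := abs_add_le (avg (fun i j => F i j ^ 2) - avg (fun i j => f (W n ω i j) ^ 2))
    (avg (fun i j => f (W n ω i j) ^ 2) - ∫ x, f x ^ 2 * p x)
  have e4 : avg (fun i j => F i j ^ 2) + ε - ((∫ x, f x ^ 2 * p x) + ε) =
    (avg (fun i j => F i j ^ 2) - avg (fun i j => f (W n ω i j) ^ 2)) +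
    (avg (fun i j => f (W n ω i j) ^ 2) - ∫ x, f x ^ 2 * p x) := by ring
  change |avg (fun i j => F i j ^ 2) + ε - _| ≤ _
  rw [e4]
  have e5 : 1 * avg (fun i j => F i j ^ 2) + -1 * avg (fun i j => f (W n ω i j) ^ 2) + 0 =
    avg (fun i j => F i j ^ 2) - avg (fun i j => f (W n ω i j) ^ 2) := by ring
  rw [e5] at h1
  linarith

end

/-! ### Normalisation of the score to unit variance -/

/-- The root with `θ c ≥ 0` is taken. For it the cross term only helps, so `θ² V ≤ d` and the root
tends to zero with `d`. -/
lemma exists_sq_mul_add_mul_eq {V c d : ℝ} (hV : 0 < V) (hd : 0 ≤ d) :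
    ∃ θ : ℝ, θ ^ 2 * V + 2 * θ * c = d ∧ θ ^ 2 * V ≤ d := by
  have hr := Real.sq_sqrt (show 0 ≤ c ^ 2 + V * d by positivity)
  have hrc : |c| ≤ Real.sqrt (c ^ 2 + V * d) := by
    rw [← Real.sqrt_sq_eq_abs]
    exact Real.sqrt_le_sqrt (by nlinarith)
  set r := Real.sqrt (c ^ 2 + V * d)
  obtain ⟨s, hs, hsc⟩ : ∃ s : ℝ, s ^ 2 = r ^ 2 ∧ 0 ≤ (s - c) * c := by
    rcases le_total 0 c with hc | hc
    · exact ⟨r, rfl, by rw [abs_of_nonneg hc] at hrc; nlinarith⟩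
    · exact ⟨-r, neg_sq r, by rw [abs_of_nonpos hc] at hrc; nlinarith⟩
  have h1 : ((s - c) / V) ^ 2 * V + 2 * ((s - c) / V) * c = d := by
    field_simp
    linarith
  refine ⟨(s - c) / V, h1, ?_⟩
  have : 0 ≤ (s - c) / V * c := by rw [div_mul_eq_mul_div]; positivity
  linarith

namespace IsNoiseDensity

variable {p : ℝ → ℝ} {M₁ M₂ : ℝ}

lemma integral_sq_mul_pos (hp : IsNoiseDensity p M₁ M₂) {g : ℝ → ℝ} (hg : Continuous g)
    (hinj : Function.Injective g) {C : ℝ} (hC : ∀ x, |g x| ≤ C) : 0 < ∫ x, g x ^ 2 * p x := by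
  have h0 : ∀ x, 0 ≤ g x ^ 2 * p x := fun x => mul_nonneg (sq_nonneg _) (hp.nonneg x)
  refine (integral_nonneg h0).lt_of_ne fun hz => ?_
  have hi := hp.integrable_bdd_mul (hg.measurable.pow_const 2) (C := C ^ 2) fun x => by
    rw [abs_pow]; exact pow_le_pow_left₀ (abs_nonneg _) (hC x) 2
  have h1 := (integral_eq_zero_iff_of_nonneg h0 hi).1 hz.symm
  have h2 : {x | g x = 0}.Subsingleton := fun x hx y hy => hinj (Eq.trans hx (Eq.symm hy))
  have h3 : ∀ᵐ x, g x ≠ 0 := by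
    rw [ae_iff]
    simpa only [not_not] using h2.measure_zero volume
  have h4 : p =ᵐ[volume] 0 := by
    filter_upwards [h1, h3] with x h1 h3
    exact (mul_eq_zero.1 h1).resolve_left (pow_ne_zero 2 h3)
  have := hp.integral_eq_one
  rw [integral_congr_ae h4] at this
  simp at this

/-- A small multiple of a bounded centred function of the noise brings the variance of the
regularised score up to the Fisher information. -/
lemma exists_whitening (hp : IsNoiseDensity p M₁ M₂) : ∃ g θ : ℝ → ℝ, ∃ T : ℝ, Measurable g ∧
    (∀ x, |g x| ≤ Real.pi) ∧ ∫ x, g x * p x = 0 ∧ Tendsto θ (𝓝[>] 0) (𝓝 0) ∧ 0 ≤ T ∧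
    ∀ ε > 0, |θ ε| ≤ T ∧
      ∫ x, (regRatio ε (deriv p) p x / Real.sqrt (fisherInfo p) + θ ε * g x) ^ 2 * p x = 1 := by
  have hI := hp.fisherInfo_pos
  set I := fisherInfo p
  have hatan : ∀ x, |Real.arctan x| ≤ Real.pi / 2 := fun x =>
    _root_.abs_le.2 ⟨(Real.neg_pi_div_two_lt_arctan x).le, (Real.arctan_lt_pi_div_two x).le⟩
  set c₀ := ∫ x, Real.arctan x * p x
  -- Any bounded, centred, nondegenerate function would do; injectivity of `arctan` gives positive
  -- variance. An additive correction is preferred to rescaling the score: it is bounded by `π |θ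
  -- ε|`, which vanishes, whereas the available bound on the score itself is of order `1/ε`.
  set g : ℝ → ℝ := fun x => Real.arctan x - c₀ with hg
  have hgc : Continuous g := Real.continuous_arctan.sub continuous_const
  have hgb : ∀ x, |g x| ≤ Real.pi := fun x => by
    have h1 := hp.abs_integral_bdd_mul_le hatan
    refine (abs_sub _ _).trans ((add_le_add (hatan x) h1).trans (by linarith))
  have hg0 : ∫ x, g x * p x = 0 := by
    simp only [hg, sub_mul]
    rw [integral_sub (hp.integrable_bdd_mul Real.continuous_arctan.measurable hatan)
      (hp.integrable.const_mul c₀), integral_const_mul, hp.integral_eq_one, mul_one, sub_self]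
  set V := ∫ x, g x ^ 2 * p x with hV
  have hV0 : 0 < V := hp.integral_sq_mul_pos hgc
    (fun x y hxy => Real.arctan_injective (sub_left_injective hxy)) hgb
  set s : ℝ → ℝ := fun ε => ∫ x, regRatio ε (deriv p) p x ^ 2 * p x with hs
  have hd : ∀ ε > 0, 0 ≤ 1 - s ε / I := fun ε hε => by
    rw [sub_nonneg, div_le_one hI]; exact hp.integral_score_sq_le hε
  have hex : ∀ ε : ℝ, ∃ θ : ℝ, 0 < ε →
      θ ^ 2 * V + 2 * θ * ((∫ x, regRatio ε (deriv p) p x * g x * p x) / Real.sqrt I) =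
        1 - s ε / I ∧ θ ^ 2 * V ≤ 1 - s ε / I := fun ε => by
    rcases lt_or_ge 0 ε with hε | hε
    · obtain ⟨θ, h⟩ := exists_sq_mul_add_mul_eq hV0 (hd ε hε)
      exact ⟨θ, fun _ => h⟩
    · exact ⟨0, fun h => absurd h (not_lt.2 hε)⟩
  choose θ hθ using hex
  have hθle : ∀ ε > 0, |θ ε| ≤ Real.sqrt ((1 - s ε / I) / V) := fun ε hε =>
    Real.abs_le_sqrt ((le_div_iff₀ hV0).2 (hθ ε hε).2)
  refine ⟨g, θ, Real.sqrt (1 / V), hgc.measurable, hgb, hg0, ?_, Real.sqrt_nonneg _,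
    fun ε hε => ⟨(hθle ε hε).trans (Real.sqrt_le_sqrt ?_), ?_⟩⟩
  · refine squeeze_zero_norm' (a := fun ε => Real.sqrt ((1 - s ε / I) / V)) ?_ ?_
    · filter_upwards [self_mem_nhdsWithin] with ε hε using hθle ε hε
    · have h1 := ((hp.tendsto_integral_score_sq.div_const I).const_sub 1).div_const V
      rw [div_self hI.ne', sub_self, zero_div] at h1
      simpa using h1.sqrt
  · gcongr
    have : 0 ≤ s ε / I := div_nonneg
      (integral_nonneg fun x => mul_nonneg (sq_nonneg _) (hp.nonneg x)) hI.le
    linarith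
  · have hfm := hp.measurable_score ε
    have hfC := hp.abs_score_le hε
    have i1 : Integrable fun x => regRatio ε (deriv p) p x ^ 2 * p x :=
      hp.integrable_bdd_mul (hfm.pow_const 2) (C := (M₂ / ε) ^ 2) fun x => by
        rw [abs_pow]; exact pow_le_pow_left₀ (abs_nonneg _) (hfC x) 2
    have i2 : Integrable fun x => regRatio ε (deriv p) p x * g x * p x :=
      hp.integrable_bdd_mul (hfm.mul hgc.measurable) (C := M₂ / ε * Real.pi) fun x => by
        rw [abs_mul]
        exact mul_le_mul (hfC x) (hgb x) (abs_nonneg _) ((abs_nonneg _).trans (hfC x))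
    have i3 : Integrable fun x => g x ^ 2 * p x :=
      hp.integrable_bdd_mul (hgc.measurable.pow_const 2) (C := Real.pi ^ 2) fun x => by
        rw [abs_pow]; exact pow_le_pow_left₀ (abs_nonneg _) (hgb x) 2
    have e : (fun x => (regRatio ε (deriv p) p x / Real.sqrt I + θ ε * g x) ^ 2 * p x) = fun x =>
        (1 / I * (regRatio ε (deriv p) p x ^ 2 * p x) +
          2 * θ ε / Real.sqrt I * (regRatio ε (deriv p) p x * g x * p x)) +
          θ ε ^ 2 * (g x ^ 2 * p x) := by
      ext x
      have : (1 : ℝ) / I = (1 / Real.sqrt I) ^ 2 := by rw [div_pow, one_pow, Real.sq_sqrt hI.le]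
      rw [this]; ring
    have j1 := i1.const_mul (1 / I)
    have j2 := i2.const_mul (2 * θ ε / Real.sqrt I)
    have j12 : Integrable fun x => 1 / I * (regRatio ε (deriv p) p x ^ 2 * p x) +
        2 * θ ε / Real.sqrt I * (regRatio ε (deriv p) p x * g x * p x) := j1.add j2
    rw [e, integral_add j12 (i3.const_mul _), integral_add j1 j2, integral_const_mul,
      integral_const_mul, integral_const_mul]
    have := (hθ ε hε).1
    linear_combination this

end IsNoiseDensity

/-- Entrywise images of independent identically distributed entries. -/
lemma HasIIDEntries.comp {Ω : Type*} [MeasurableSpace Ω] {P : Measure Ω} {m n : ℕ}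
    {A : Ω → Matrix (Fin m) (Fin n) ℝ} {μ : Measure ℝ} (h : HasIIDEntries P A μ) {ψ : ℝ → ℝ}
    (hψ : Measurable ψ) : HasIIDEntries P (fun ω i j => ψ (A ω i j)) (μ.map ψ) := by
  refine ⟨h.1.comp (fun _ => ψ) fun _ => hψ, fun i j => ?_⟩
  exact ((HasLaw.mk hψ.aemeasurable rfl : HasLaw ψ (μ.map ψ) μ)).comp (h.2 i j)

/-! ### Limits -/

/-- With values in the extended reals the upper limit needs no boundedness side condition; the
sequence `1/(k+1)` stands for arbitrary `δ`. -/
lemma ereal_limsup_le {u : ℕ → ℝ} {t : ℝ} (h : ∀ δ > 0, ∀ᶠ n in atTop, u n ≤ t + δ) :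
    limsup (fun n => ((u n : ℝ) : EReal)) atTop ≤ (t : EReal) := by
  have hlim : Tendsto (fun k : ℕ => ((t + 1 / ((k : ℝ) + 1) : ℝ) : EReal)) atTop (𝓝 (t : EReal)) := by
    refine (continuous_coe_real_ereal.tendsto t).comp ?_
    simpa using tendsto_one_div_add_atTop_nhds_zero_nat.const_add t
  refine ge_of_tendsto' hlim fun k => limsup_le_of_le (h := ?_)
  filter_upwards [h (1 / ((k : ℝ) + 1)) (by positivity)] with n hn
  exact EReal.coe_le_coe_iff.2 hn

section

variable {p K : ℝ → ℝ} {M₁ M₂ B : ℝ} {m : ℕ → ℕ} {a b : ℝ} {Ω : Type*} [MeasurableSpace Ω]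
  {P : Measure Ω}

lemma Proportional.rpow_le (hm : Proportional m a b) : ∀ᶠ n : ℕ in atTop, (0 : ℝ) < n ∧
    1 / ((m n : ℝ) * n) ^ (1 / 4 : ℝ) ≤ 1 / Real.sqrt (Real.sqrt a) * (1 / Real.sqrt n) := by
  filter_upwards [hm.sqrt_mul_le] with n ⟨hn, hm0, h1, _⟩
  have ha := Real.sqrt_pos.2 (Real.sqrt_pos.2 hm.pos)
  have hn' := Real.sqrt_pos.2 hn
  refine ⟨hn, ?_⟩
  have e : ((m n : ℝ) * n) ^ (1 / 4 : ℝ) = Real.sqrt (Real.sqrt ((m n : ℝ) * n)) := by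
    rw [Real.sqrt_eq_rpow, Real.sqrt_eq_rpow, ← Real.rpow_mul (by positivity)]
    norm_num
  rw [e, div_mul_div_comm, one_mul, ← Real.sqrt_mul (Real.sqrt_nonneg a)]
  exact one_div_le_one_div_of_le (Real.sqrt_pos.2 (mul_pos (Real.sqrt_pos.2 hm.pos) hn))
    (Real.sqrt_le_sqrt h1)

variable {W : ∀ n : ℕ, Ω → Matrix (Fin (m n)) (Fin n) ℝ} {x : ℕ → Ω → ℝ} {T c : ℝ}

/-- Almost sure control from deviation events. -/
lemma ae_limsup_le [IsProbabilityMeasure P] (hm : Proportional m a b) (hp : IsNoiseDensity p M₁ M₂)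
    (hW : ∀ n, HasIIDEntries P (W n) (noiseLaw p))
    (h : ∀ δ > 0, Negligible P fun n =>
      {ω | (T + δ) * Real.sqrt n + c * (n * |avg (W n ω)|) < x n ω}) :
    ∀ᵐ ω ∂P, limsup (fun n : ℕ => ((1 / ((m n : ℝ) * n) ^ (1 / 4 : ℝ) * x n ω : ℝ) : EReal)) atTop ≤
      ((1 / Real.sqrt (Real.sqrt a) * |T| : ℝ) : EReal) := by
  -- Countably many tolerances suffice, so that a single null set can be discarded.
  have h1 : ∀ᵐ ω ∂P, ∀ k : ℕ, ∀ᶠ n : ℕ in atTop,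
      x n ω ≤ (T + 1 / ((k : ℝ) + 1)) * Real.sqrt n + c * (n * |avg (W n ω)|) :=
    ae_all_iff.2 fun k => by
      filter_upwards [(h (1 / ((k : ℝ) + 1)) (by positivity)).ae_eventually] with ω hω
      filter_upwards [hω] with n hn
      exact not_lt.1 hn
  filter_upwards [h1, hp.ae_tendsto_sqrt_mul_avg hm hW] with ω hω hlim
  refine ereal_limsup_le fun δ hδ => ?_
  set κ := 1 / Real.sqrt (Real.sqrt a) with hκ
  have hκ0 : 0 < κ := one_div_pos.2 (Real.sqrt_pos.2 (Real.sqrt_pos.2 hm.pos))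
  obtain ⟨k, hk⟩ := exists_nat_one_div_lt (show 0 < δ / (2 * κ) by positivity)
  have hk' : κ * (1 / ((k : ℝ) + 1)) ≤ δ / 2 := by
    rw [lt_div_iff₀ (by positivity)] at hk
    linarith
  have hl := hlim.const_mul (κ * |c|)
  rw [mul_zero] at hl
  filter_upwards [hω k, hm.rpow_le, hl.eventually_le_const (half_pos hδ)] with n h1 ⟨hn, h2⟩ h3
  have hs := Real.sqrt_pos.2 hn
  have hsn : (n : ℝ) = Real.sqrt n * Real.sqrt n := (Real.mul_self_sqrt hn.le).symm
  set s := Real.sqrt n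
  have hc0 := abs_nonneg (avg (W n ω))
  set v := |avg (W n ω)|
  have hr : 0 ≤ 1 / ((m n : ℝ) * n) ^ (1 / 4 : ℝ) := by positivity
  calc 1 / ((m n : ℝ) * n) ^ (1 / 4 : ℝ) * x n ω
      ≤ 1 / ((m n : ℝ) * n) ^ (1 / 4 : ℝ) *
        ((|T| + 1 / ((k : ℝ) + 1)) * s + |c| * (n * v)) := by
        refine mul_le_mul_of_nonneg_left (h1.trans ?_) hr
        gcongr <;> exact le_abs_self _
    _ ≤ κ * (1 / s) * ((|T| + 1 / ((k : ℝ) + 1)) * s + |c| * (n * v)) := by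
        refine mul_le_mul_of_nonneg_right h2 (by positivity)
    _ = κ * |T| + κ * (1 / ((k : ℝ) + 1)) + κ * |c| * (s * v) := by
        rw [hsn]; field_simp
    _ ≤ κ * |T| + δ := by linarith

lemma ae_limsup_abs_sub_le [IsProbabilityMeasure P] {s I : ℝ}
    (h : ∀ δ > 0, Negligible P fun n => {ω | δ < |x n ω - s|}) :
    ∀ᵐ ω ∂P, limsup (fun n : ℕ => ((|x n ω - I| : ℝ) : EReal)) atTop ≤ ((|s - I| : ℝ) : EReal) := by
  have h1 : ∀ᵐ ω ∂P, ∀ k : ℕ, ∀ᶠ n : ℕ in atTop, |x n ω - s| ≤ 1 / ((k : ℝ) + 1) :=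
    ae_all_iff.2 fun k => by
      filter_upwards [(h (1 / ((k : ℝ) + 1)) (by positivity)).ae_eventually] with ω hω
      filter_upwards [hω] with n hn
      exact not_lt.1 hn
  filter_upwards [h1] with ω hω
  refine ereal_limsup_le fun δ hδ => ?_
  obtain ⟨k, hk⟩ := exists_nat_one_div_lt hδ
  filter_upwards [hω k] with n hn
  have := abs_sub_le (x n ω) s I
  linarith

/-- Off the exceptional event the square is at most `2A²` plus twice the squared average term, whose
mean is a variance; on it the crude bound `Q` is used. Neither `x` nor the event is assumed
measurable, hence the lower integral and the inequality for the indicator. -/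
lemma lintegral_sq_le [IsProbabilityMeasure P] (hp : IsNoiseDensity p M₁ M₂) {m n : ℕ}
    {W : Ω → Matrix (Fin m) (Fin n) ℝ} (hW : HasIIDEntries P W (noiseLaw p)) {x : Ω → ℝ}
    {A c Q : ℝ} (hx0 : ∀ ω, 0 ≤ x ω) (hxQ : ∀ ω, x ω ≤ Q) :
    ∫⁻ ω, ENNReal.ofReal (x ω ^ 2) ∂P ≤ ENNReal.ofReal (2 * A ^ 2 +
      2 * c ^ 2 * (M₁ / ((m : ℝ) * n)) + Q ^ 2 * P.real {ω | A + c * |avg (W ω)| < x ω}) := by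
  obtain ⟨hL, hI⟩ := hp.integral_avg_sq_le hW
  set E := {ω | A + c * |avg (W ω)| < x ω} with hE
  have hi : Integrable (fun ω => 2 * A ^ 2 + 2 * c ^ 2 * avg (W ω) ^ 2) P :=
    (integrable_const _).add (hL.integrable_sq.const_mul _)
  have hpt : ∀ ω, ENNReal.ofReal (x ω ^ 2) ≤
      ENNReal.ofReal (2 * A ^ 2 + 2 * c ^ 2 * avg (W ω) ^ 2) +
        E.indicator (fun _ => ENNReal.ofReal (Q ^ 2)) ω := fun ω => by
    by_cases hω : ω ∈ E
    · rw [Set.indicator_of_mem hω]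
      refine le_add_left (ENNReal.ofReal_le_ofReal ?_)
      exact pow_le_pow_left₀ (hx0 ω) (hxQ ω) 2
    · rw [Set.indicator_of_notMem hω, add_zero]
      refine ENNReal.ofReal_le_ofReal ?_
      have h1 : x ω ≤ A + c * |avg (W ω)| := not_lt.1 hω
      rw [← sq_abs (avg (W ω))]
      have h2 := pow_le_pow_left₀ (hx0 ω) h1 2
      have h3 := sq_nonneg (A - c * |avg (W ω)|)
      linarith
  refine (lintegral_mono hpt).trans ?_
  rw [lintegral_add_left' hi.1.aemeasurable.ennreal_ofReal, ← ofReal_integral_eq_lintegral_ofReal hi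
    (Eventually.of_forall fun ω => by positivity), integral_add (integrable_const _)
    (hL.integrable_sq.const_mul _), integral_const, probReal_univ, one_smul, integral_const_mul]
  refine (add_le_add_right (lintegral_indicator_const_le E (ENNReal.ofReal (Q ^ 2))) _).trans ?_
  have hM := hp.second_moment_nonneg
  rw [← ofReal_measureReal (measure_ne_top P E), ← ENNReal.ofReal_mul (sq_nonneg Q),
    ← ENNReal.ofReal_add (add_nonneg (by positivity) (mul_nonneg (by positivity)
      (integral_nonneg fun ω => sq_nonneg _))) (by positivity)]
  gcongr

/-- Control of the second moment from deviation events and a crude deterministic bound. -/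
lemma limsup_lintegral_le [IsProbabilityMeasure P] (hm : Proportional m a b)
    (hp : IsNoiseDensity p M₁ M₂) (hW : ∀ n, HasIIDEntries P (W n) (noiseLaw p))
    (hx0 : ∀ n ω, 0 ≤ x n ω) {Q : ℝ} (hxQ : ∀ᶠ n : ℕ in atTop, ∀ ω, x n ω ≤ Q * (n : ℝ) ^ 2)
    (h : ∀ δ > 0, Negligible P fun n =>
      {ω | (T + δ) * Real.sqrt n + c * (n * |avg (W n ω)|) < x n ω}) :
    limsup (fun n : ℕ => ENNReal.ofReal (1 / ((m n : ℝ) * n) ^ ((1 + 1 : ℝ) / 4)) *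
      ∫⁻ ω, ENNReal.ofReal (x n ω ^ (1 + 1 : ℝ)) ∂P) atTop ≤
      ENNReal.ofReal (2 * T ^ 2 / Real.sqrt a) := by
  have ha := Real.sqrt_pos.2 hm.pos
  have hM := hp.second_moment_nonneg
  have hlim : Tendsto (fun k : ℕ => ENNReal.ofReal (2 * (T + 1 / ((k : ℝ) + 1)) ^ 2 / Real.sqrt a +
      1 / ((k : ℝ) + 1))) atTop (𝓝 (ENNReal.ofReal (2 * T ^ 2 / Real.sqrt a))) := by
    refine ENNReal.tendsto_ofReal ?_
    have h0 := tendsto_one_div_add_atTop_nhds_zero_nat (𝕜 := ℝ)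
    simpa using ((((h0.const_add T).pow 2).const_mul 2).div_const (Real.sqrt a)).add h0
  refine ge_of_tendsto' hlim fun k => limsup_le_of_le (h := ?_)
  have hk : (0 : ℝ) < 1 / ((k : ℝ) + 1) := by positivity
  set δ : ℝ := 1 / ((k : ℝ) + 1)
  have r1 := (tendsto_natCast_rpow_neg (show (0 : ℝ) < 1 by norm_num)).const_mul
    (2 * c ^ 2 * M₁ / a / Real.sqrt a)
  -- The crude bound is of order `n²`, squared `n⁴`, against an event of superpolynomially small
  -- probability.
  have r2 := (h δ hk 4).const_mul (Q ^ 2 / Real.sqrt a)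
  have r := r1.add r2
  rw [mul_zero, mul_zero, add_zero] at r
  filter_upwards [hxQ, r.eventually_le_const hk, hm.sqrt_mul_le, hm.eventually_le,
    eventually_ge_atTop 1] with n hQ hr ⟨hn, hm0, hs, _⟩ hmn hn1
  have hn1' : (1 : ℝ) ≤ n := by exact_mod_cast hn1
  have e1 : ((m n : ℝ) * n) ^ ((1 + 1 : ℝ) / 4) = Real.sqrt ((m n : ℝ) * n) := by
    rw [Real.sqrt_eq_rpow]; norm_num
  have e2 : ∀ ω, x n ω ^ (1 + 1 : ℝ) = x n ω ^ 2 := fun ω => by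
    rw [← Real.rpow_natCast]; norm_num
  simp only [e1, e2]
  have key := lintegral_sq_le hp (hW n) (x := x n) (A := (T + δ) * Real.sqrt n) (c := c * n)
    (hx0 n) hQ
  simp only [mul_assoc c] at key
  set π := P.real {ω | (T + δ) * Real.sqrt n + c * (n * |avg (W n ω)|) < x n ω}
  have hπ : 0 ≤ π := measureReal_nonneg
  refine (mul_le_mul_right key _).trans ?_
  rw [← ENNReal.ofReal_mul (by positivity)]
  refine ENNReal.ofReal_le_ofReal ?_
  have hsn : Real.sqrt n ^ 2 = n := Real.sq_sqrt hn.le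
  have ha0 := hm.pos
  have b1 : M₁ / ((m n : ℝ) * n) ≤ M₁ / (a * n * n) := by gcongr; exact hmn.1
  calc _ ≤ 1 / (Real.sqrt a * n) * (2 * ((T + δ) * Real.sqrt n) ^ 2 +
        2 * (c * n) ^ 2 * (M₁ / (a * n * n)) + (Q * (n : ℝ) ^ 2) ^ 2 * π) := by gcongr
    _ = 2 * (T + δ) ^ 2 / Real.sqrt a + (2 * c ^ 2 * M₁ / a / Real.sqrt a * (n : ℝ)⁻¹ +
        Q ^ 2 / Real.sqrt a * ((n : ℝ) ^ 3 * π)) := by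
        rw [mul_pow, hsn]; field_simp; ring
    _ ≤ 2 * (T + δ) ^ 2 / Real.sqrt a + (2 * c ^ 2 * M₁ / a / Real.sqrt a * (n : ℝ) ^ (-1 : ℝ) +
        Q ^ 2 / Real.sqrt a * ((n : ℝ) ^ 4 * π)) := by
        rw [Real.rpow_neg_one]
        gcongr
        norm_num
    _ ≤ _ := by linarith

variable {X : ∀ n : ℕ, Matrix (Fin (m n)) (Fin n) ℝ} {D η : ℝ}

/-- A deterministic polynomial bound, used only on events of negligible probability: `B / h'²` is at
most `B n` since `2 η₂ ≤ 1`. -/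
lemma SignalBounds.opNorm_errorMatrix_le (h : SignalBounds X D η) (hm : Proportional m a b)
    (hη : 0 < η) (hD : 0 < D) (hp : IsNoiseDensity p M₁ M₂) (hK : IsKernel K B) {η₁ η₂ ε I R : ℝ}
    (hη₂ : η₂ ≤ 1 / 2) (hε : 0 < ε) {φ : ℝ → ℝ} (hφ : ∀ x, |φ x| ≤ R) :
    ∀ᶠ n : ℕ in atTop, ∀ w : Matrix (Fin (m n)) (Fin n) ℝ,
      opNorm (errorMatrix K p η₁ η₂ ε I φ (X n) w) ≤
        (B / ε + |I| * D + (M₂ / ε + R)) * Real.sqrt b * (n : ℝ) ^ 2 := by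
  have hR : 0 ≤ R := (abs_nonneg _).trans (hφ 0)
  have hM := hp.bound_nonneg
  have hB := hK.bound_nonneg
  filter_upwards [hm.sqrt_mul_le, h.abs_le hD.le hη.le, eventually_ge_atTop 1]
    with n ⟨hn, hm0, _, hmn⟩ hX hn1 w
  have hn1' : (1 : ℝ) ≤ n := by exact_mod_cast hn1
  have hC : 0 ≤ (B / ε + |I| * D + (M₂ / ε + R)) * n := by positivity
  have hent : ∀ i j, |errorMatrix K p η₁ η₂ ε I φ (X n) w i j| ≤
      (B / ε + |I| * D + (M₂ / ε + R)) * n := fun i j => by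
    have hh₂ : 0 < (n : ℝ) ^ (-η₂) := by positivity
    have hBh : B / ((n : ℝ) ^ (-η₂)) ^ 2 ≤ B * n := by
      rw [Real.rpow_neg hn.le, inv_pow, div_inv_eq_mul]
      gcongr
      rw [← Real.rpow_natCast, ← Real.rpow_mul hn.le]
      calc (n : ℝ) ^ (η₂ * (2 : ℕ)) ≤ (n : ℝ) ^ (1 : ℝ) :=
            Real.rpow_le_rpow_of_exponent_le hn1' (by push_cast; linarith)
        _ = n := Real.rpow_one _
    have k1 : |fHat K ((n : ℝ) ^ (-η₁)) ((n : ℝ) ^ (-η₂)) ε (X n + w) ((X n + w) i j)| ≤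
        B * n / ε :=
      abs_regRatio_le (q₁ := pHatDeriv K ((n : ℝ) ^ (-η₂)) (X n + w))
        (q₀ := pHat K ((n : ℝ) ^ (-η₁)) (X n + w)) hε (pHat_nonneg hK (by positivity) _ _)
        ((abs_pHatDeriv_le hK (by positivity) hh₂ _ _).trans hBh)
    have k2 : |I * X n i j| ≤ |I| * (D * n) := by rw [abs_mul]; gcongr; exact hX i j
    have k3 := hp.abs_score_le hε (w i j)
    have k4 := hφ (w i j)
    have k5 : M₂ / ε + R ≤ (M₂ / ε + R) * n := le_mul_of_one_le_right (by positivity) hn1'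
    refine (abs_sub _ _).trans ((add_le_add ((abs_sub _ _).trans (add_le_add k1 k2))
      ((abs_add_le _ _).trans (add_le_add k3 k4))).trans ?_)
    calc _ ≤ B * n / ε + |I| * (D * n) + (M₂ / ε + R) * n := by gcongr
      _ = _ := by ring
  calc _ ≤ (B / ε + |I| * D + (M₂ / ε + R)) * n * Real.sqrt ((m n : ℝ) * n) :=
        opNorm_le_of_forall_abs_le hC hent
    _ ≤ (B / ε + |I| * D + (M₂ / ε + R)) * n * (Real.sqrt b * n) := by gcongr
    _ = _ := by ring

end

end MatrixDenoising

/-! ### Assembly: choice of `Z`, `Δ` and `τ`. -/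

theorem mainTheorem6 (p : ℝ → ℝ) (M₁ M₂ : ℝ) (hp : MatrixDenoising.IsNoiseDensity p M₁ M₂)
    (K : ℝ → ℝ) (B : ℝ) (hK : MatrixDenoising.IsKernel K B)
    (η₁ η₂ : ℝ) (hη₁ : η₁ ∈ Set.Ioo (1 / 4 : ℝ) 1) (hη₂ : η₂ ∈ Set.Ioo (1 / 4 : ℝ) (1 / 3))
    (γ : ℝ) (hγ : 0 < γ) (M η : ℝ) (hη : 0 < η) :
    ∃ ε₀ > (0 : ℝ), ∃ C > (0 : ℝ), ∃ ν ∈ Set.Ioc (0 : ℝ) 1, ∃ τ : ℝ → ℝ,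
      Tendsto τ (𝓝[>] 0) (𝓝 0) ∧
      ∀ (m : ℕ → ℕ), Tendsto (fun n : ℕ => (m n : ℝ) / n) atTop (𝓝 γ) →
      ∀ (X : ∀ n : ℕ, Matrix (Fin (m n)) (Fin n) ℝ),
        (∀ n, X n ∈ MatrixDenoising.signalClass (m n) n M η) →
      ∀ (Ω : Type*) [MeasurableSpace Ω] (P : Measure Ω) [IsProbabilityMeasure P]
        (W : ∀ n : ℕ, Ω → Matrix (Fin (m n)) (Fin n) ℝ),
        (∀ n, MatrixDenoising.HasIIDEntries P (W n) (MatrixDenoising.noiseLaw p)) →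
      ∃ Z Δ : ℝ → ∀ n : ℕ, Ω → Matrix (Fin (m n)) (Fin n) ℝ,
        -- the decomposition
        (∀ ε > 0, ∀ (n : ℕ) (ω : Ω),
          MatrixDenoising.denoised K ((n : ℝ) ^ (-η₁)) ((n : ℝ) ^ (-η₂)) ε (X n + W n ω) =
            MatrixDenoising.fisherInfo p • X n
              + Real.sqrt (MatrixDenoising.fisherInfo p) • Z ε n ω + Δ ε n ω) ∧
        -- the entries of `Z` are i.i.d. with mean zero and variance one
        (∀ ε > 0, ∃ ζ : Measure ℝ, IsProbabilityMeasure ζ ∧ MemLp (fun x : ℝ => x) 2 ζ ∧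
          ∫ x, x ∂ζ = 0 ∧ ∫ x, x ^ 2 ∂ζ = 1 ∧
          ∀ n : ℕ, MatrixDenoising.HasIIDEntries P (Z ε n) ζ) ∧
        -- the entries of `Z` are bounded
        (∀ᵐ ω ∂P, ∀ ε ∈ Set.Ioc (0 : ℝ) ε₀, ∀ (n : ℕ) i j, |Z ε n ω i j| ≤ C * ε⁻¹) ∧
        -- almost sure control of the error
        (∀ ε ∈ Set.Ioc (0 : ℝ) ε₀, ∀ᵐ ω ∂P,
          limsup (fun n : ℕ =>
            ((1 / ((m n : ℝ) * n) ^ (1 / 4 : ℝ) * MatrixDenoising.opNorm (Δ ε n ω) : ℝ) : EReal))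
            atTop ≤ (τ ε : EReal)) ∧
        -- control of the error in the moment of order `1 + ν`
        (∀ ε ∈ Set.Ioc (0 : ℝ) ε₀,
          limsup (fun n : ℕ =>
            ENNReal.ofReal (1 / ((m n : ℝ) * n) ^ ((1 + ν) / 4)) *
              ∫⁻ ω, ENNReal.ofReal (MatrixDenoising.opNorm (Δ ε n ω) ^ (1 + ν)) ∂P)
            atTop ≤ ENNReal.ofReal (τ ε)) ∧
        -- consistency of the estimated Fisher information
        (∀ ε ∈ Set.Ioc (0 : ℝ) ε₀, ∀ᵐ ω ∂P,
          limsup (fun n : ℕ =>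
            ((|MatrixDenoising.fisherHat K ((n : ℝ) ^ (-η₁)) ((n : ℝ) ^ (-η₂)) ε (X n + W n ω)
              - MatrixDenoising.fisherInfo p| : ℝ) : EReal))
            atTop ≤ (τ ε : EReal)) := by
  have hI := hp.fisherInfo_pos
  have hM := hp.bound_nonneg
  obtain ⟨g, θ, T, hgm, hgb, hg0, hθ, hT, hθT⟩ := hp.exists_whitening
  obtain ⟨D, hD, hsig⟩ := MatrixDenoising.exists_signalBounds (a := γ / 2) (b := 2 * γ)
    (by positivity) M η
  set I := MatrixDenoising.fisherInfo p
  have hsI : 0 < Real.sqrt I := Real.sqrt_pos.2 hI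
  set f : ℝ → ℝ → ℝ := fun ε => MatrixDenoising.regRatio ε (deriv p) p with hf
  -- The part of the error that survives `n → ∞`, in units of `√n`: slope mismatch times the bound
  -- on the signal, plus the norm of the variance correction. Both tend to zero with `ε`.
  set L : ℝ → ℝ := fun ε => D * |(-∫ x, f ε x * deriv p x) - I| +
    24 * Real.sqrt (2 * γ + 1) * (Real.sqrt I * |θ ε| * Real.pi) with hL
  have hL0 : ∀ ε, 0 ≤ L ε := fun ε => by positivity
  set κ : ℝ := 1 / Real.sqrt (Real.sqrt (γ / 2)) with hκ
  have hκ0 : 0 ≤ κ := by positivity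
  set S : ℝ → ℝ := fun ε => |((∫ x, f ε x ^ 2 * p x) + ε) - I| with hS
  have hlimL : Tendsto L (𝓝[>] 0) (𝓝 0) := by
    have h0 : Tendsto (fun ε => -∫ x, f ε x * deriv p x) (𝓝[>] 0) (𝓝 I) :=
      hp.tendsto_integral_score_mul_deriv
    have h1 := ((h0.sub_const I).abs.const_mul D)
    have h2 := ((hθ.abs.const_mul (Real.sqrt I)).mul_const Real.pi).const_mul
      (24 * Real.sqrt (2 * γ + 1))
    simpa using h1.add h2
  have hlimS : Tendsto S (𝓝[>] 0) (𝓝 0) := by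
    have h1 : Tendsto (fun ε : ℝ => ε) (𝓝[>] 0) (𝓝 0) := nhdsWithin_le_nhds
    have h0 : Tendsto (fun ε => ∫ x, f ε x ^ 2 * p x) (𝓝[>] 0) (𝓝 I) :=
      hp.tendsto_integral_score_sq
    simpa using ((h0.add h1).sub_const I).abs
  -- The three summands of `τ` serve the almost sure bound, the second moment (`ν = 1`) and the
  -- Fisher information; each is nonnegative, so the sum dominates them all. Taking `ε₀ = 1` makes
  -- `1 ≤ ε⁻¹`, which absorbs the bounded correction `T π` into `C ε⁻¹`.
  refine ⟨1, one_pos, M₂ / Real.sqrt I + T * Real.pi + 1, by positivity, 1, ⟨one_pos, le_rfl⟩,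
    fun ε => κ * L ε + 2 * L ε ^ 2 / Real.sqrt (γ / 2) + S ε, ?_, ?_⟩
  · simpa using ((hlimL.const_mul κ).add (((hlimL.pow 2).const_mul 2).div_const
      (Real.sqrt (γ / 2)))).add hlimS
  intro m hmγ X hX Ω _ P _ W hW
  have hm := MatrixDenoising.proportional_of_tendsto hγ hmγ
  have hsb := hsig m X hm hX
  -- The function defining `Z = ψ ε (W)`. Since `√I ψ = f ε + φ`, with `φ` set below, `Δ` is exactly
  -- the error matrix with correction `φ ε`.
  set ψ : ℝ → ℝ → ℝ := fun ε x => f ε x / Real.sqrt I + θ ε * g x with hψ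
  have hψm : ∀ ε, Measurable (ψ ε) := fun ε =>
    ((hp.measurable_score ε).div_const _).add (hgm.const_mul _)
  have hψb : ∀ ε > 0, ∀ x, |ψ ε x| ≤ M₂ / ε / Real.sqrt I + T * Real.pi := fun ε hε x => by
    refine (abs_add_le _ _).trans (add_le_add ?_ ?_)
    · rw [abs_div, abs_of_pos hsI]
      gcongr
      exact hp.abs_score_le hε x
    · rw [abs_mul]
      gcongr
      · exact (hθT ε hε).1
      · exact hgb x
  set φ : ℝ → ℝ → ℝ := fun ε x => Real.sqrt I * θ ε * g x with hφ
  have hφm : ∀ ε, Measurable (φ ε) := fun ε => hgm.const_mul _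
  have hφb : ∀ ε x, |φ ε x| ≤ Real.sqrt I * |θ ε| * Real.pi := fun ε x => by
    rw [abs_mul, abs_mul, abs_of_pos hsI]
    gcongr
    exact hgb x
  have hφ0 : ∀ ε, ∫ x, φ ε x * p x = 0 := fun ε => by
    simp only [hφ, mul_assoc]
    rw [integral_const_mul, integral_const_mul, hg0, mul_zero, mul_zero]
  have hdev : ∀ ε > 0, ∀ δ > 0, MatrixDenoising.Negligible P fun n =>
      {ω | (L ε + δ) * Real.sqrt n + ((M₂ / ε + M₂ ^ 2 / ε ^ 2) * Real.sqrt (2 * γ)) *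
        (n * |MatrixDenoising.avg (W n ω)|) <
      MatrixDenoising.opNorm (MatrixDenoising.errorMatrix K p η₁ η₂ ε I (φ ε) (X n) (W n ω))} :=
    fun ε hε δ hδ => hsb.negligible_errorMatrix hm hη hD hp hK hη₁ hη₂ hW hε hδ (hφm ε) (hφb ε)
      (hφ0 ε)
  have hτ : ∀ ε, 0 ≤ κ * L ε ∧ 0 ≤ 2 * L ε ^ 2 / Real.sqrt (γ / 2) ∧ 0 ≤ S ε := fun ε =>
    ⟨mul_nonneg hκ0 (hL0 ε), by positivity, abs_nonneg _⟩
  refine ⟨fun ε n ω i j => ψ ε (W n ω i j), fun ε n ω =>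
    MatrixDenoising.errorMatrix K p η₁ η₂ ε I (φ ε) (X n) (W n ω), ?_, ?_, ?_, ?_, ?_, ?_⟩
  · intro ε hε n ω
    ext i j
    change _ = I * X n i j + Real.sqrt I * (f ε (W n ω i j) / Real.sqrt I + θ ε * g (W n ω i j)) +
      (MatrixDenoising.fHat K ((n : ℝ) ^ (-η₁)) ((n : ℝ) ^ (-η₂)) ε (X n + W n ω)
        ((X n + W n ω) i j) - I * X n i j -
        (f ε (W n ω i j) + Real.sqrt I * θ ε * g (W n ω i j)))
    rw [MatrixDenoising.denoised, Matrix.of_apply, mul_add, mul_div_cancel₀ _ hsI.ne']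
    ring
  · intro ε hε
    have := hp.isProbabilityMeasure
    have hψC := hψb ε hε
    refine ⟨(MatrixDenoising.noiseLaw p).map (ψ ε),
      Measure.isProbabilityMeasure_map (hψm ε).aemeasurable, ?_, ?_, ?_,
      fun n => (hW n).comp (hψm ε)⟩
    · exact (memLp_map_measure_iff aestronglyMeasurable_id (hψm ε).aemeasurable).2
        (MemLp.of_bound (hψm ε).aestronglyMeasurable _ (Eventually.of_forall hψC))
    · rw [integral_map (f := fun x => x) (hψm ε).aemeasurable (by fun_prop), hp.integral_noiseLaw]
      have i1 := (hp.integrable_bdd_mul (hp.measurable_score ε) (hp.abs_score_le hε)).div_const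
        (Real.sqrt I)
      have i2 := (hp.integrable_bdd_mul hgm hgb).const_mul (θ ε)
      have e : (fun x => ψ ε x * p x) = fun x =>
          f ε x * p x / Real.sqrt I + θ ε * (g x * p x) := by
        ext x; simp only [hψ]; ring
      rw [e, integral_add i1 i2, integral_div, integral_const_mul, hp.integral_score_mul hε, hg0]
      simp
    · rw [integral_map (hψm ε).aemeasurable (by fun_prop), hp.integral_noiseLaw]
      exact (hθT ε hε).2
  · refine Eventually.of_forall fun ω ε hε n i j => (hψb ε hε.1 _).trans ?_
    have h1 : (1 : ℝ) ≤ ε⁻¹ := (one_le_inv₀ hε.1).2 hε.2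
    have h2 : T * Real.pi ≤ T * Real.pi * ε⁻¹ := le_mul_of_one_le_right (by positivity) h1
    have h3 : M₂ / ε / Real.sqrt I = M₂ / Real.sqrt I * ε⁻¹ := by ring
    rw [h3, add_mul, add_mul]
    linarith
  · intro ε hε
    filter_upwards [MatrixDenoising.ae_limsup_le hm hp hW (hdev ε hε.1)] with ω hω
    refine hω.trans (EReal.coe_le_coe_iff.2 ?_)
    rw [abs_of_nonneg (hL0 ε)]
    linarith [hτ ε]
  · intro ε hε
    refine (MatrixDenoising.limsup_lintegral_le hm hp hW (fun n ω => MatrixDenoising.opNorm_nonneg _)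
      ((hsb.opNorm_errorMatrix_le hm hη hD hp hK (by linarith [hη₂.2]) hε.1 (hφb ε)).mono
        fun n hn ω => hn (W n ω)) (hdev ε hε.1)).trans (ENNReal.ofReal_le_ofReal ?_)
    linarith [hτ ε]
  · intro ε hε
    filter_upwards [MatrixDenoising.ae_limsup_abs_sub_le (I := I) fun δ hδ =>
      hsb.negligible_fisherHat hm hη hD hp hK hη₁ hη₂ hW hε.1 hδ] with ω hω
    refine hω.trans (EReal.coe_le_coe_iff.2 ?_)
    change S ε ≤ _
    linarith [hτ ε]
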